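/- Let $n\ge 1$ and let $M$ be a $C^\infty$ manifold (Hausdorff, second countable, without boundary) of real dimension $2n-1$. Let ${}^0T''\subset \mathbb C\otimes TM$ be a CR structure: a $C^\infty$ complex subbundle such that, with ${}^0T'=\overline{{}^0T''}$, one has ${}^0T'\cap{}^0T''=0$, $\dim_{\mathbb C}(\mathbb C\otimes TM)/({}^0T'+{}^0T'')=1$ and $[\Gamma(M,{}^0T''),\Gamma(M,{}^0T'')]\subset\Gamma(M,{}^0T'')$. Fix a $C^\infty$ section $\xi$ of $\mathbb C\otimes TM$ with $\xi_x\notin{}^0T'_x+{}^0T''_x$ for every $x\in M$, so that $\mathbb C\otimes TM={}^0T'+{}^0T''+\mathbb C\xi$, and put $T'={}^0T'+\mathbb C\xi$. Assume that $(M,{}^0T'')$ is strongly pseudoconvex: at every point the Levi form $L(Z,W)=-\sqrt{-1}\,[Z,\overline W]_{\mathbb C\xi}$ on ${}^0T''$ (the $\mathbb C\xi$-part of the bracket, read as a multiple of $\xi$) is positive definite or negative definite. All forms are smooth and complex valued, and a subscript denotes the part of a form in the indicated summand. For $p,q\ge 0$ let $$C^{p,q}=\Gamma(M,\wedge^p(T')^*\wedge\wedge^q({}^0T'')^*),\qquad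 \bar\partial_b u=(du)_{\wedge^p(T')^*\wedge\wedge^{q+1}({}^0T'')^*}\quad(u\in C^{p,q}),$$ and let $H^{p,q}(M)=(\operatorname{Ker}\bar\partial_b\cap C^{p,q})/\bar\partial_bC^{p,q-1}$ be the Kohn–Rossi cohomology. Let $$D^{p,q}=\Gamma(M,(\mathbb C\xi)^*\wedge\wedge^{p-1}({}^0T')^*\wedge\wedge^q({}^0T'')^*)\ (p\ge1),\qquad D^{0,q}=0,$$ $$F^{p,q}=\{u\in D^{p,q}:(du)_{\wedge^p({}^0T')^*\wedge\wedge^{q+1}({}^0T'')^*}=0\},\qquad F^k=\sum_{p+q=k}F^{p,q},$$ and for $u\in F^{p,q}$ let $d''u=(du)_{(\mathbb C\xi)^*\wedge\wedge^{p-1}({}^0T')^*\wedge\wedge^{q+1}({}^0T'')^*}$ (on $F^{0,q}=0$, $d''=0$). Spaces with a negative index are $0$. Then: 1. If $p+q=n$, then $\operatorname{Ker}d''\cap F^{p,q}\subset\operatorname{Ker}\bar\partial_b\cap C^{p,q}$, and the induced map $\operatorname{Ker}d''\cap F^{p,q}\to H^{p,q}(M)$ is surjective. 2. If $p+q\ge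 n+1$, then the inclusion $\operatorname{Ker}d''\cap F^{p,q}\subset\operatorname{Ker}\bar\partial_b\cap C^{p,q}$ holds and induces a $\mathbb C$-linear isomorphism $$\frac{\operatorname{Ker}d''\cap F^{p,q}}{d''F^{p,q-1}}\;\simeq\;H^{p,q}(M).$$ 3. If $k=n$, the natural map from $\operatorname{Ker}d\cap F^k$ to the de Rham cohomology $H^k(M,\mathbb C)=\operatorname{Ker}d/\operatorname{Im}d$ of complex $k$-forms is surjective. 4. If $k\ge n+1$, the inclusion $\operatorname{Ker}d\cap F^k\subset\operatorname{Ker}d$ induces a $\mathbb C$-linear isomorphism $$\frac{\operatorname{Ker}d\cap F^k}{dF^{k-1}}\;\simeq\;\frac{\operatorname{Ker}d}{\operatorname{Im}d}=H^k(M,\mathbb C).$$ -/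

import Mathlib

open scoped Manifold ContDiff TensorProduct Topology
open VectorField

noncomputable section

namespace CRManifold

/-! ### Multilinear algebra on a complexified vector space -/

section Algebra

/-- The real part `ℂ ⊗ V → V`, `(a + ib) ⊗ v ↦ a v`. -/
def rePart (V : Type*) [AddCommGroup V] [Module ℝ V] : (ℂ ⊗[ℝ] V) →ₗ[ℝ] V :=
  (TensorProduct.lid ℝ V).toLinearMap ∘ₗ LinearMap.rTensor V Complex.reLm

/-- The imaginary part `ℂ ⊗ V → V`, `(a + ib) ⊗ v ↦ b v`. -/
def imPart (V : Type*) [AddCommGroup V] [Module ℝ V] : (ℂ ⊗[ℝ] V) →ₗ[ℝ] V :=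
  (TensorProduct.lid ℝ V).toLinearMap ∘ₗ LinearMap.rTensor V Complex.imLm

/-- The inclusion `V → ℂ ⊗ V`, `v ↦ 1 ⊗ v`. -/
def ofReal (V : Type*) [AddCommGroup V] [Module ℝ V] : V →ₗ[ℝ] (ℂ ⊗[ℝ] V) :=
  TensorProduct.mk ℝ ℂ V 1

/-- Complex conjugation on `ℂ ⊗ V`, a conjugate-linear map. -/
def conj (V : Type*) [AddCommGroup V] [Module ℝ V] :
    (ℂ ⊗[ℝ] V) →ₛₗ[starRingEnd ℂ] (ℂ ⊗[ℝ] V) where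
  toFun := LinearMap.rTensor V Complex.conjAe.toLinearMap
  map_add' := map_add _
  map_smul' := by
    intro c z
    induction z with
    | zero => simp
    | add x y hx hy => simp only [smul_add, map_add, hx, hy]
    | tmul a v => simp [TensorProduct.smul_tmul']

theorem conj_tmul (V : Type*) [AddCommGroup V] [Module ℝ V] (a : ℂ) (v : V) :
    conj V (a ⊗ₜ[ℝ] v) = (starRingEnd ℂ a) ⊗ₜ[ℝ] v := rfl

theorem conj_conj (V : Type*) [AddCommGroup V] [Module ℝ V] (z : ℂ ⊗[ℝ] V) :
    conj V (conj V z) = z := by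
  induction z with
  | zero => simp
  | add x y hx hy => simp only [map_add, hx, hy]
  | tmul a v => simp [conj_tmul]

theorem rePart_tmul (V : Type*) [AddCommGroup V] [Module ℝ V] (a : ℂ) (v : V) :
    rePart V (a ⊗ₜ[ℝ] v) = a.re • v := by simp [rePart]

theorem imPart_tmul (V : Type*) [AddCommGroup V] [Module ℝ V] (a : ℂ) (v : V) :
    imPart V (a ⊗ₜ[ℝ] v) = a.im • v := by simp [imPart]

theorem rePart_I_smul (V : Type*) [AddCommGroup V] [Module ℝ V] (z : ℂ ⊗[ℝ] V) :
    rePart V (Complex.I • z) = - imPart V z := by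
  induction z with
  | zero => simp
  | add x y hx hy => simp only [smul_add, map_add, hx, hy, neg_add]
  | tmul a v => simp [TensorProduct.smul_tmul', rePart_tmul, imPart_tmul]

theorem imPart_I_smul (V : Type*) [AddCommGroup V] [Module ℝ V] (z : ℂ ⊗[ℝ] V) :
    imPart V (Complex.I • z) = rePart V z := by
  induction z with
  | zero => simp
  | add x y hx hy => simp only [smul_add, map_add, hx, hy]
  | tmul a v => simp [TensorProduct.smul_tmul', rePart_tmul, imPart_tmul]

/-- The number of indices `j` with `f j = i`. -/
def countOf {ι : Type*} [DecidableEq ι] {k : ℕ} (f : Fin k → ι) (i : ι) : ℕ :=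
  (Finset.univ.filter fun j => f j = i).card

theorem countOf_comp_perm {ι : Type*} [DecidableEq ι] {k : ℕ} (f : Fin k → ι)
    (σ : Equiv.Perm (Fin k)) : countOf (f ∘ σ) = countOf f := by
  funext i
  refine Finset.card_equiv σ ?_
  intro j
  simp

/-- A sum `∑ w(f) u(P_{f 1} v_1, …, P_{f k} v_k)` over all `f : {1, …, k} → ι`, with weights that
do not depend on the order of the values of `f`, vanishes as soon as two arguments are equal. -/
theorem mix_eq_zero {R V V' N ι : Type*} [CommRing R] [AddCommGroup V] [Module R V]
    [AddCommGroup V'] [Module R V'] [AddCommGroup N] [Module R N] [Fintype ι] [DecidableEq ι]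
    {S : Type*} [Ring S] [Module S N]
    {k : ℕ} (P : ι → V' →ₗ[R] V) (u : V [⋀^Fin k]→ₗ[R] N) (w : (Fin k → ι) → S)
    (hw : ∀ f (σ : Equiv.Perm (Fin k)), w (f ∘ σ) = w f) (v : Fin k → V') (i j : Fin k)
    (hv : v i = v j) (hij : i ≠ j) :
    ∑ f : Fin k → ι, w f • u (fun l => P (f l) (v l)) = 0 := by
  have hvs : ∀ l, v (Equiv.swap i j l) = v l := by
    intro l
    by_cases h1 : l = i
    · subst h1; simp [hv]
    · by_cases h2 : l = j
      · subst h2; simp [hv]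
      · rw [Equiv.swap_apply_of_ne_of_ne h1 h2]
  refine Finset.sum_involution (fun f _ => f ∘ Equiv.swap i j) ?_ ?_ ?_ ?_
  · intro f _
    rw [hw]
    have : (fun l => P ((f ∘ Equiv.swap i j) l) (v l))
        = (fun l => P (f l) (v l)) ∘ Equiv.swap i j := by
      funext l
      simp [hvs]
    rw [this, u.map_swap _ hij, smul_neg, add_neg_cancel]
  · intro f _ hne heq
    apply hne
    have hf : f i = f j := by
      have := congrFun heq j
      simpa using this
    rw [u.map_eq_zero_of_eq _ (by simp [hf, hv]) hij, smul_zero]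
  · intro f _
    exact Finset.mem_univ _
  · intro f _
    funext l
    simp

/-- Let `P i`, `i : ι`, be endomorphisms of `V` (the projections of a decomposition of `V`) and
let `c : ι → ℕ`. The component of multidegree `c` of an alternating `k`-form `u`:
`(v_1, …, v_k) ↦ ∑ u(P_{f 1} v_1, …, P_{f k} v_k)`, the sum being over the maps
`f : {1, …, k} → ι` that take each value `i` exactly `c i` times. -/
def component {V ι : Type*} [AddCommGroup V] [Module ℂ V] [Fintype ι] [DecidableEq ι]
    (P : ι → V →ₗ[ℂ] V) (c : ι → ℕ) (k : ℕ) :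
    (V [⋀^Fin k]→ₗ[ℂ] ℂ) →ₗ[ℂ] (V [⋀^Fin k]→ₗ[ℂ] ℂ) where
  toFun u :=
    { (∑ f ∈ Finset.univ.filter (fun f : Fin k → ι => countOf f = c),
        u.toMultilinearMap.compLinearMap (fun j => P (f j)) : MultilinearMap ℂ _ ℂ) with
      map_eq_zero_of_eq' := by
        intro v i j hv hij
        have := mix_eq_zero P u (fun f => if countOf f = c then (1 : ℂ) else 0)
          (by intro f σ; simp only [countOf_comp_perm]) v i j hv hij
        simpa [← Finset.sum_filter] using this }
  map_add' u v := by
    ext z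
    simp [Finset.sum_add_distrib]
  map_smul' a u := by
    ext z
    simp [Finset.mul_sum]

theorem component_apply {V ι : Type*} [AddCommGroup V] [Module ℂ V] [Fintype ι] [DecidableEq ι]
    (P : ι → V →ₗ[ℂ] V) (c : ι → ℕ) (k : ℕ) (u : V [⋀^Fin k]→ₗ[ℂ] ℂ) (v : Fin k → V) :
    component P c k u v =
      ∑ f ∈ Finset.univ.filter (fun f : Fin k → ι => countOf f = c),
        u (fun j => P (f j) (v j)) := by
  simp [component]

/-- Auxiliary: the parts of a complex vector, `0 ↦ Re`, `1 ↦ Im`. -/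
def part (V : Type*) [AddCommGroup V] [Module ℝ V] (b : Fin 2) : (ℂ ⊗[ℝ] V) →ₗ[ℝ] V :=
  if b = 0 then rePart V else imPart V

/-- Auxiliary: the sum that defines the complex-multilinear extension. -/
def complexifyAux {V : Type*} [AddCommGroup V] [Module ℝ V] {k : ℕ} (u : V [⋀^Fin k]→ₗ[ℝ] ℂ) :
    MultilinearMap ℝ (fun _ : Fin k => ℂ ⊗[ℝ] V) ℂ :=
  ∑ f : Fin k → Fin 2, (∏ j, (if f j = 0 then (1 : ℂ) else Complex.I)) •
    u.toMultilinearMap.compLinearMap (fun j => part V (f j))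

theorem complexifyAux_apply {V : Type*} [AddCommGroup V] [Module ℝ V] {k : ℕ}
    (u : V [⋀^Fin k]→ₗ[ℝ] ℂ) (z : Fin k → ℂ ⊗[ℝ] V) :
    complexifyAux u z = ∑ f : Fin k → Fin 2,
      (∏ j, (if f j = 0 then (1 : ℂ) else Complex.I)) • u (fun j => part V (f j) (z j)) := by
  simp [complexifyAux]

theorem complexifyAux_I_smul {V : Type*} [AddCommGroup V] [Module ℝ V] {k : ℕ}
    (u : V [⋀^Fin k]→ₗ[ℝ] ℂ) (z : Fin k → ℂ ⊗[ℝ] V) (i : Fin k) (w : ℂ ⊗[ℝ] V) :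
    complexifyAux u (Function.update z i (Complex.I • w)) =
      Complex.I * complexifyAux u (Function.update z i w) := by
  rw [complexifyAux_apply, complexifyAux_apply, Finset.mul_sum]
  have hinv : Function.Involutive
      (fun f : Fin k → Fin 2 => Function.update f i (1 - f i)) := by
    intro f
    have : ∀ b : Fin 2, 1 - (1 - b) = b := by decide
    simp [this]
  refine Fintype.sum_equiv hinv.toPerm _ _ ?_
  intro f
  have hperm : (Function.Involutive.toPerm _ hinv : Equiv.Perm (Fin k → Fin 2)) f = Function.update f i (1 - f i) := rfl
  rw [hperm]
  have key : ∀ (x : ℂ ⊗[ℝ] V) (g : Fin k → Fin 2),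
      (fun j => part V (g j) (Function.update z i x j))
        = Function.update (fun j => part V (g j) (z j)) i (part V (g i) x) := by
    intro x g
    funext j
    by_cases h : j = i
    · subst h; simp
    · simp [h]
  have key2 : ∀ x : V, Function.update
      (fun j => part V (Function.update f i (1 - f i) j) (z j)) i x
        = Function.update (fun j => part V (f j) (z j)) i x := by
    intro x
    funext j
    by_cases h : j = i
    · subst h; simp
    · simp [h]
  rw [key, key, key2]
  rw [← Finset.mul_prod_erase _ _ (Finset.mem_univ i),
    ← Finset.mul_prod_erase (a := i) _ (fun j => if Function.update f i (1 - f i) j = 0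
      then (1 : ℂ) else Complex.I) (Finset.mem_univ i)]
  have hprod : ∏ j ∈ Finset.univ.erase i, (if Function.update f i (1 - f i) j = 0
      then (1 : ℂ) else Complex.I) = ∏ j ∈ Finset.univ.erase i,
        (if f j = 0 then (1 : ℂ) else Complex.I) := by
    refine Finset.prod_congr rfl fun j hj => ?_
    rw [Function.update_of_ne (Finset.ne_of_mem_erase hj)]
  rw [hprod]
  have h2 : f i = 0 ∨ f i = 1 := by
    generalize f i = b
    revert b
    decide
  rcases h2 with h | h
  · simp [h, part, rePart_I_smul, AlternatingMap.map_update_neg, ← mul_assoc]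
  · simp [h, part, imPart_I_smul, ← mul_assoc]

/-- The complex-multilinear extension to `ℂ ⊗ V` of a complex-valued alternating form on the real
vector space `V`. -/
def complexify {V : Type*} [AddCommGroup V] [Module ℝ V] {k : ℕ} (u : V [⋀^Fin k]→ₗ[ℝ] ℂ) :
    (ℂ ⊗[ℝ] V) [⋀^Fin k]→ₗ[ℂ] ℂ where
  toFun := complexifyAux u
  map_update_add' := by
    intro inst z i x y
    have hinst : inst = instDecidableEqFin k := Subsingleton.elim _ _
    subst hinst
    exact (complexifyAux u).map_update_add z i x y
  map_update_smul' := by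
    intro inst z i c x
    have hinst : inst = instDecidableEqFin k := Subsingleton.elim _ _
    subst hinst
    have hr : ∀ (r : ℝ) (y : ℂ ⊗[ℝ] V), complexifyAux u (Function.update z i ((r : ℂ) • y)) =
        r • complexifyAux u (Function.update z i y) := by
      intro r y
      rw [← (complexifyAux u).map_update_smul]
      congr 2
    have hc : c • x = (c.re : ℂ) • x + (c.im : ℂ) • (Complex.I • x) := by
      rw [← mul_smul, ← add_smul, Complex.re_add_im]
    change complexifyAux u _ = c • complexifyAux u _
    rw [hc, (complexifyAux u).map_update_add, hr, hr, complexifyAux_I_smul]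
    conv_rhs => rw [← Complex.re_add_im c]
    simp only [Complex.real_smul, smul_eq_mul]
    ring
  map_eq_zero_of_eq' := by
    intro z i j hz hij
    change complexifyAux u z = 0
    rw [complexifyAux_apply]
    refine mix_eq_zero (part V) u _ ?_ z i j hz hij
    intro f σ
    exact Equiv.prod_comp σ (fun j => if f j = 0 then (1 : ℂ) else Complex.I)

/-- `complexify u` restricts to `u` on real vectors. -/
theorem complexify_ofReal {V : Type*} [AddCommGroup V] [Module ℝ V] {k : ℕ}
    (u : V [⋀^Fin k]→ₗ[ℝ] ℂ) (v : Fin k → V) :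
    complexify u (fun j => ofReal V (v j)) = u v := by
  change complexifyAux u _ = _
  rw [complexifyAux_apply, Finset.sum_eq_single (fun _ => 0)]
  · simp [part, ofReal, rePart_tmul]
  · intro f _ hf
    obtain ⟨j, hj⟩ : ∃ j, f j ≠ 0 := by
      by_contra! h
      exact hf (funext h)
    rw [u.map_coord_zero j (by simp [part, hj, ofReal, imPart_tmul]), smul_zero]
  · simp

/-- The restriction to the real vector space `V` of a complex-multilinear form on `ℂ ⊗ V`. -/
def realRestrict {V : Type*} [AddCommGroup V] [Module ℝ V] {k : ℕ}
    (u : (ℂ ⊗[ℝ] V) [⋀^Fin k]→ₗ[ℂ] ℂ) : V [⋀^Fin k]→ₗ[ℝ] ℂ :=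
  AlternatingMap.compLinearMap
    { u.toMultilinearMap.restrictScalars ℝ with
      map_eq_zero_of_eq' := fun v _ _ hv hij => u.map_eq_zero_of_eq v hv hij }
    (ofReal V)

theorem realRestrict_apply {V : Type*} [AddCommGroup V] [Module ℝ V] {k : ℕ}
    (u : (ℂ ⊗[ℝ] V) [⋀^Fin k]→ₗ[ℂ] ℂ) (v : Fin k → V) :
    realRestrict u v = u (fun j => ofReal V (v j)) := rfl

/-- An alternating form on a finite-dimensional real normed space is continuous. -/
def toContinuousForm {E : Type*} [NormedAddCommGroup E] [NormedSpace ℝ E]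
    [FiniteDimensional ℝ E] {k : ℕ} (u : E [⋀^Fin k]→ₗ[ℝ] ℂ) : E [⋀^Fin k]→L[ℝ] ℂ where
  toMultilinearMap := u.toMultilinearMap
  cont := by
    let b := Module.finBasis ℝ E
    have h : ∀ v : Fin k → E, u v = ∑ r : Fin k → Fin (Module.finrank ℝ E),
        (∏ i, b.repr (v i) (r i)) • u (fun i => b (r i)) := by
      intro v
      have hv : v = fun i => ∑ j, b.repr (v i) j • b j := by
        funext i
        exact (b.sum_repr (v i)).symm
      conv_lhs => rw [hv]
      change u.toMultilinearMap _ = _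
      rw [MultilinearMap.map_sum]
      refine Finset.sum_congr rfl fun r _ => ?_
      rw [MultilinearMap.map_smul_univ]
      rfl
    have hc : ∀ j, Continuous fun x : E => b.repr x j := fun j =>
      LinearMap.continuous_of_finiteDimensional (b.coord j)
    change Continuous fun v => u v
    rw [show (fun v : Fin k → E => u v) = fun v => ∑ r : Fin k → Fin (Module.finrank ℝ E),
        (∏ i, b.repr (v i) (r i)) • u (fun i => b (r i)) from funext h]
    refine continuous_finsetSum _ fun r _ => ?_
    have hp : Continuous fun v : Fin k → E => ∏ i, b.repr (v i) (r i) :=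
      continuous_finsetProd _ fun i _ => (hc (r i)).comp (continuous_apply i)
    exact hp.smul continuous_const
  map_eq_zero_of_eq' := u.map_eq_zero_of_eq'

theorem toContinuousForm_apply {E : Type*} [NormedAddCommGroup E] [NormedSpace ℝ E]
    [FiniteDimensional ℝ E] {k : ℕ} (u : E [⋀^Fin k]→ₗ[ℝ] ℂ) (v : Fin k → E) :
    toContinuousForm u v = u v := rfl

theorem complexify_add {V : Type*} [AddCommGroup V] [Module ℝ V] {k : ℕ}
    (u v : V [⋀^Fin k]→ₗ[ℝ] ℂ) : complexify (u + v) = complexify u + complexify v := by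
  ext z
  change complexifyAux (u + v) z = complexifyAux u z + complexifyAux v z
  simp [complexifyAux_apply, mul_add, Finset.sum_add_distrib]

theorem complexify_smul {V : Type*} [AddCommGroup V] [Module ℝ V] {k : ℕ}
    (c : ℂ) (u : V [⋀^Fin k]→ₗ[ℝ] ℂ) : complexify (c • u) = c • complexify u := by
  ext z
  change complexifyAux (c • u) z = c * complexifyAux u z
  simp [complexifyAux_apply, Finset.mul_sum, mul_left_comm]

/-- The complex conjugate of a complex subspace of `ℂ ⊗ V`. -/
def conjSubmodule {V : Type*} [AddCommGroup V] [Module ℝ V] (W : Submodule ℂ (ℂ ⊗[ℝ] V)) :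
    Submodule ℂ (ℂ ⊗[ℝ] V) :=
  W.comap (conj V)

theorem mem_conjSubmodule {V : Type*} [AddCommGroup V] [Module ℝ V]
    (W : Submodule ℂ (ℂ ⊗[ℝ] V)) (z : ℂ ⊗[ℝ] V) : z ∈ conjSubmodule W ↔ conj V z ∈ W :=
  Iff.rfl

end Algebra

/-! ### Complex vector fields and complex differential forms on a manifold -/

section Forms

variable {E : Type*} [NormedAddCommGroup E] [NormedSpace ℝ E]
variable {M : Type*} [TopologicalSpace M] [ChartedSpace E M]

variable (E) in
/-- The complexified tangent space `ℂ ⊗ T_x M`. -/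
abbrev CTangent (x : M) : Type _ := ℂ ⊗[ℝ] TangentSpace 𝓘(ℝ, E) x

/-- The real part of a complex vector field. -/
def reField (Z : ∀ x : M, CTangent E x) (x : M) : TangentSpace 𝓘(ℝ, E) x :=
  rePart (TangentSpace 𝓘(ℝ, E) x) (Z x)

/-- The imaginary part of a complex vector field. -/
def imField (Z : ∀ x : M, CTangent E x) (x : M) : TangentSpace 𝓘(ℝ, E) x :=
  imPart (TangentSpace 𝓘(ℝ, E) x) (Z x)

/-- The complex conjugate of a complex vector field. -/
def conjField (Z : ∀ x : M, CTangent E x) (x : M) : CTangent E x :=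
  conj (TangentSpace 𝓘(ℝ, E) x) (Z x)

/-- A complex vector field is `C^∞` on `U` if its real and imaginary parts are `C^∞` sections of
the tangent bundle over `U`. -/
def SmoothFieldOn [IsManifold 𝓘(ℝ, E) ∞ M] (Z : ∀ x : M, CTangent E x) (U : Set M) : Prop :=
  ContMDiffOn 𝓘(ℝ, E) 𝓘(ℝ, E).tangent ∞
    (fun x => (⟨x, reField Z x⟩ : TangentBundle 𝓘(ℝ, E) M)) U ∧
  ContMDiffOn 𝓘(ℝ, E) 𝓘(ℝ, E).tangent ∞
    (fun x => (⟨x, imField Z x⟩ : TangentBundle 𝓘(ℝ, E) M)) U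

/-- The Lie bracket of complex vector fields, the complex bilinear extension of the Lie bracket of
real vector fields: `[X + iY, X' + iY'] = ([X, X'] - [Y, Y']) + i ([X, Y'] + [Y, X'])`. -/
def cBracket (Z W : ∀ x : M, CTangent E x) (x : M) : CTangent E x :=
  (1 : ℂ) ⊗ₜ[ℝ] (mlieBracket 𝓘(ℝ, E) (reField Z) (reField W) x
      - mlieBracket 𝓘(ℝ, E) (imField Z) (imField W) x) +
    Complex.I ⊗ₜ[ℝ] (mlieBracket 𝓘(ℝ, E) (reField Z) (imField W) x
      + mlieBracket 𝓘(ℝ, E) (imField Z) (reField W) x)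

variable (E M) in
/-- Complex differential forms of degree `k`, not necessarily smooth: sections of
`⋀^k (ℂ ⊗ TM)^*`. -/
abbrev CForm (k : ℕ) : Type _ := ∀ x : M, (CTangent E x) [⋀^Fin k]→ₗ[ℂ] ℂ

/-- The derivative at `x` of the chart at `x`. -/
def chartDeriv (x : M) : TangentSpace 𝓘(ℝ, E) x →L[ℝ] E :=
  mfderiv 𝓘(ℝ, E) 𝓘(ℝ, E) (extChartAt 𝓘(ℝ, E) x) x

/-- The derivative at `y` of the inverse of the chart at `x₀`. -/
def chartSymmDeriv (x₀ : M) (y : E) :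
    E →L[ℝ] TangentSpace 𝓘(ℝ, E) ((extChartAt 𝓘(ℝ, E) x₀).symm y) :=
  mfderiv 𝓘(ℝ, E) 𝓘(ℝ, E) (extChartAt 𝓘(ℝ, E) x₀).symm y

variable [FiniteDimensional ℝ E]

/-- The expression of a form in the chart at `x₀`: its pullback under the inverse of the chart, a
complex-valued form on (an open set of) the model space `E`. -/
def inChart {k : ℕ} (u : CForm E M k) (x₀ : M) (y : E) : E [⋀^Fin k]→L[ℝ] ℂ :=
  toContinuousForm ((realRestrict (u ((extChartAt 𝓘(ℝ, E) x₀).symm y))).compLinearMap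
    (chartSymmDeriv x₀ y).toLinearMap)

theorem inChart_add {k : ℕ} (u v : CForm E M k) (x₀ : M) :
    inChart (u + v) x₀ = inChart u x₀ + inChart v x₀ := rfl

theorem inChart_smul {k : ℕ} (c : ℂ) (u : CForm E M k) (x₀ : M) :
    inChart (c • u) x₀ = c • inChart u x₀ := rfl

variable (E M) in
/-- `Γ(M, ⋀^k (ℂ ⊗ TM)^*)`: the forms whose expressions in all charts are `C^∞`. -/
def smoothForms (k : ℕ) : Submodule ℂ (CForm E M k) where
  carrier := {u | ∀ x₀ : M,
    ContDiffOn ℝ ∞ (inChart u x₀) (extChartAt 𝓘(ℝ, E) x₀).target}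
  add_mem' := by
    intro u v hu hv x₀
    rw [inChart_add]
    exact (hu x₀).add (hv x₀)
  zero_mem' := by
    intro x₀
    exact contDiffOn_const (c := (0 : E [⋀^Fin k]→L[ℝ] ℂ))
  smul_mem' := by
    intro c u hu x₀
    rw [inChart_smul]
    exact (hu x₀).const_smul c

variable (E M) in
/-- The complex vector space of smooth complex `k`-forms. -/
def SmoothForm (k : ℕ) : Type _ := smoothForms E M k

instance (k : ℕ) : AddCommGroup (SmoothForm E M k) :=
  inferInstanceAs (AddCommGroup (smoothForms E M k))

instance (k : ℕ) : Module ℂ (SmoothForm E M k) :=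
  inferInstanceAs (Module ℂ (smoothForms E M k))

variable (E M) in
/-- The inclusion of the smooth forms into all forms. -/
def incl (k : ℕ) : SmoothForm E M k →ₗ[ℂ] CForm E M k := (smoothForms E M k).subtype

/-- The exterior derivative of a form: at the point `x`, it is the exterior derivative of the
expression of the form in the chart at `x`, pulled back by that chart (and extended complex
multilinearly). -/
def extD {k : ℕ} (u : CForm E M k) : CForm E M (k + 1) := fun x =>
  complexify ((extDeriv (inChart u x) (extChartAt 𝓘(ℝ, E) x x)).toAlternatingMap.compLinearMap
    (chartDeriv x).toLinearMap)

theorem differentiableAt_inChart {k : ℕ} (u : CForm E M k) (hu : u ∈ smoothForms E M k) (x : M) :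
    DifferentiableAt ℝ (inChart u x) (extChartAt 𝓘(ℝ, E) x x) :=
  ((hu x).contDiffAt ((isOpen_extChartAt_target x).mem_nhds
    (mem_extChartAt_target x))).differentiableAt (by simp)

/-- The exterior derivative on smooth forms, as a complex linear map. -/
def d (k : ℕ) : SmoothForm E M k →ₗ[ℂ] CForm E M (k + 1) where
  toFun u := extD u.1
  map_add' u v := by
    funext x
    change extD (u.1 + v.1) x = extD u.1 x + extD v.1 x
    simp only [extD, inChart_add]
    rw [extDeriv_add (differentiableAt_inChart _ u.2 x) (differentiableAt_inChart _ v.2 x),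
      ← complexify_add]
    rfl
  map_smul' c u := by
    funext x
    have h : extDeriv (inChart (c • u.1) x) (extChartAt 𝓘(ℝ, E) x x) =
        c • extDeriv (inChart u.1 x) (extChartAt 𝓘(ℝ, E) x x) := by
      ext v
      rw [inChart_smul, ContinuousAlternatingMap.smul_apply,
        extDeriv_apply ((differentiableAt_inChart _ u.2 x).const_smul c),
        extDeriv_apply (differentiableAt_inChart _ u.2 x),
        ]
      have hs (v : Fin k → E) : fderiv ℝ (fun y => (c • inChart u.1 x) y v)
          (extChartAt 𝓘(ℝ, E) x x) =
          c • fderiv ℝ (fun y => inChart u.1 x y v) (extChartAt 𝓘(ℝ, E) x x) := by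
        have h0 := differentiableAt_inChart _ u.2 x
        exact fderiv_const_smul (f := fun y => inChart u.1 x y v) (by fun_prop) c
      simp only [hs]
      simp [Finset.mul_sum, mul_left_comm]
    change extD (c • u.1) x = c • extD u.1 x
    simp only [extD]
    rw [h, ← complexify_smul]
    rfl

end Forms

/-! ### CR structures -/

section CR

variable (E : Type*) [NormedAddCommGroup E] [NormedSpace ℝ E]
variable (M : Type*) [TopologicalSpace M] [ChartedSpace E M] [IsManifold 𝓘(ℝ, E) ∞ M]

/-- A (hypersurface type) CR structure `⁰T''` on `M`: a `C^∞` complex subbundle of `ℂ ⊗ TM` with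
`⁰T'' ∩ conj ⁰T'' = 0`, with `(ℂ ⊗ TM) / (⁰T'' + conj ⁰T'')` of complex rank one, and with
`[Γ(⁰T''), Γ(⁰T'')] ⊆ Γ(⁰T'')`. -/
structure CRStructure where
  /-- the fibre of `⁰T''` at a point -/
  T'' : ∀ x : M, Submodule ℂ (CTangent E x)
  /-- `⁰T''` has a smooth frame near every point -/
  exists_frame : ∀ x : M, ∃ U : Set M, IsOpen U ∧ x ∈ U ∧ ∃ (r : ℕ)
    (Z : Fin r → ∀ y : M, CTangent E y), (∀ i, SmoothFieldOn (Z i) U) ∧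
      ∀ y ∈ U, LinearIndependent ℂ (fun i => Z i y) ∧
        Submodule.span ℂ (Set.range fun i => Z i y) = T'' y
  inf_conj : ∀ x : M, T'' x ⊓ conjSubmodule (T'' x) = ⊥
  finrank_quotient : ∀ x : M,
    Module.finrank ℂ (CTangent E x ⧸ (T'' x ⊔ conjSubmodule (T'' x))) = 1
  bracket_mem : ∀ Z W : ∀ x : M, CTangent E x,
    SmoothFieldOn Z Set.univ → SmoothFieldOn W Set.univ →
    (∀ x, Z x ∈ T'' x) → (∀ x, W x ∈ T'' x) → ∀ x, cBracket Z W x ∈ T'' x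

variable {E M}

/-- A `C^∞` section `ξ` of `ℂ ⊗ TM` with `ξ_x ∉ ⁰T'_x + ⁰T''_x` at every point `x`, where
`⁰T' = conj ⁰T''`. It defines the decomposition `ℂ ⊗ TM = ⁰T' + ⁰T'' + ℂ ξ`. -/
structure Supplement (S : CRStructure E M) where
  /-- the vector field -/
  ξ : ∀ x : M, CTangent E x
  smooth : SmoothFieldOn ξ Set.univ
  not_mem : ∀ x : M, ξ x ∉ S.T'' x ⊔ conjSubmodule (S.T'' x)

namespace Supplement

variable {S : CRStructure E M} (X : Supplement S)

/-- `⁰T'`, the complex conjugate of `⁰T''`. -/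
def T10 (_X : Supplement S) (x : M) : Submodule ℂ (CTangent E x) := conjSubmodule (S.T'' x)

/-- `⁰T''`. -/
def T01 (_X : Supplement S) (x : M) : Submodule ℂ (CTangent E x) := S.T'' x

/-- The line `ℂ ξ`. -/
def line (x : M) : Submodule ℂ (CTangent E x) := Submodule.span ℂ {X.ξ x}

theorem disjoint_T (x : M) : Disjoint (X.T10 x) (X.T01 x) :=
  (disjoint_iff.2 (S.inf_conj x)).symm

theorem isCompl_line (x : M) : IsCompl (X.line x) (X.T10 x ⊔ X.T01 x) := by
  have hn : X.ξ x ∉ X.T10 x ⊔ X.T01 x := by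
    rw [sup_comm]
    exact X.not_mem x
  have hf : Module.finrank ℂ (CTangent E x ⧸ (X.T10 x ⊔ X.T01 x)) = 1 := by
    rw [sup_comm]
    exact S.finrank_quotient x
  constructor
  · rw [disjoint_comm, line]
    exact Submodule.disjoint_span_singleton_of_notMem hn
  · rw [codisjoint_iff, eq_top_iff]
    intro z _
    have h0 : (X.T10 x ⊔ X.T01 x).mkQ (X.ξ x) ≠ 0 := by
      simpa using hn
    obtain ⟨c, hc⟩ := (finrank_eq_one_iff_of_nonzero' _ h0).1 hf ((X.T10 x ⊔ X.T01 x).mkQ z)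
    have : z - c • X.ξ x ∈ X.T10 x ⊔ X.T01 x := by
      rw [← Submodule.ker_mkQ (X.T10 x ⊔ X.T01 x), LinearMap.mem_ker, map_sub, map_smul, hc,
        sub_self]
    have h2 := Submodule.add_mem_sup
      ((X.line x).smul_mem c (Submodule.mem_span_singleton_self (X.ξ x))) this
    simpa using h2

theorem isCompl_T10 (x : M) : IsCompl (X.T10 x) (X.T01 x ⊔ X.line x) :=
  ⟨(X.disjoint_T x).disjoint_sup_right_of_disjoint_sup_left (X.isCompl_line x).symm.disjoint,
    codisjoint_assoc.1 (X.isCompl_line x).symm.codisjoint⟩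

/-- `T' = ⁰T' + ℂ ξ`. -/
def T' (x : M) : Submodule ℂ (CTangent E x) := X.T10 x ⊔ X.line x

theorem isCompl_T01 (x : M) : IsCompl (X.T01 x) (X.T' x) := by
  have h := (X.isCompl_line x).symm
  rw [sup_comm] at h
  exact ⟨(X.disjoint_T x).symm.disjoint_sup_right_of_disjoint_sup_left h.disjoint,
    codisjoint_assoc.1 h.codisjoint⟩

/-- The projections of `ℂ ⊗ TM = T' + ⁰T''` onto `T'` (index `0`) and `⁰T''` (index `1`). -/
def proj₂ (x : M) : Fin 2 → CTangent E x →ₗ[ℂ] CTangent E x :=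
  ![(X.T' x).projection (X.T01 x) (X.isCompl_T01 x).symm,
    (X.T01 x).projection (X.T' x) (X.isCompl_T01 x)]

/-- The projections of `ℂ ⊗ TM = ℂ ξ + ⁰T' + ⁰T''` onto `ℂ ξ` (index `0`), `⁰T'` (index `1`)
and `⁰T''` (index `2`). -/
def proj₃ (x : M) : Fin 3 → CTangent E x →ₗ[ℂ] CTangent E x :=
  ![(X.line x).projection (X.T10 x ⊔ X.T01 x) (X.isCompl_line x),
    (X.T10 x).projection (X.T01 x ⊔ X.line x) (X.isCompl_T10 x),
    (X.T01 x).projection (X.T' x) (X.isCompl_T01 x)]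

/-- The Levi form `L(Z_x, W_x) = -i [Z, conj W]_{ℂ ξ}` at `x`, for sections `Z`, `W` of `⁰T''`: a
multiple of `ξ_x`. -/
def levi (Z W : ∀ x : M, CTangent E x) (x : M) : CTangent E x :=
  X.proj₃ x 0 (-Complex.I • cBracket Z (conjField W) x)

/-- `(M, ⁰T'')` is strongly pseudoconvex: at every point the Levi form is positive definite or
negative definite. -/
def StronglyPseudoconvex : Prop :=
  ∀ x : M,
    (∀ Z : ∀ y : M, CTangent E y, SmoothFieldOn Z Set.univ → (∀ y, Z y ∈ S.T'' y) → Z x ≠ 0 →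
      ∃ t : ℝ, 0 < t ∧ X.levi Z Z x = (t : ℂ) • X.ξ x) ∨
    (∀ Z : ∀ y : M, CTangent E y, SmoothFieldOn Z Set.univ → (∀ y, Z y ∈ S.T'' y) → Z x ≠ 0 →
      ∃ t : ℝ, t < 0 ∧ X.levi Z Z x = (t : ℂ) • X.ξ x)

/-! ### The spaces `C^{p,q}` and Kohn–Rossi cohomology -/

/-- The part of a form in `⋀^p (T')^* ∧ ⋀^q (⁰T'')^*`. -/
def part₂ (p q k : ℕ) : CForm E M k →ₗ[ℂ] CForm E M k :=
  LinearMap.pi fun x => component (X.proj₂ x) ![p, q] k ∘ₗ LinearMap.proj x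

/-- The part of a form in `⋀^a (ℂ ξ)^* ∧ ⋀^p (⁰T')^* ∧ ⋀^q (⁰T'')^*`. -/
def part₃ (a p q k : ℕ) : CForm E M k →ₗ[ℂ] CForm E M k :=
  LinearMap.pi fun x => component (X.proj₃ x) ![a, p, q] k ∘ₗ LinearMap.proj x

variable [FiniteDimensional ℝ E]

/-- `C^{p,q} = Γ(M, ⋀^p (T')^* ∧ ⋀^q (⁰T'')^*)`. -/
def C (p q : ℕ) : Submodule ℂ (SmoothForm E M (p + q)) :=
  LinearMap.eqLocus (X.part₂ p q (p + q) ∘ₗ incl E M (p + q))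
    (incl E M (p + q))

/-- `∂̄_b u = (du)_{⋀^p (T')^* ∧ ⋀^{q+1} (⁰T'')^*}`. -/
def dbar (p q : ℕ) : SmoothForm E M (p + q) →ₗ[ℂ] CForm E M (p + (q + 1)) :=
  X.part₂ p (q + 1) (p + q + 1) ∘ₗ d (p + q)

/-- `Ker ∂̄_b ∩ C^{p,q}`. -/
def kerDbar (p q : ℕ) : Submodule ℂ (SmoothForm E M (p + q)) :=
  X.C p q ⊓ LinearMap.ker (X.dbar p q)

/-- `∂̄_b C^{p,q-1}`, the zero space for `q = 0`. -/
def imDbar (p : ℕ) : (q : ℕ) → Submodule ℂ (CForm E M (p + q))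
  | 0 => ⊥
  | q + 1 => (X.C p q).map (X.dbar p q)

/-- `∂̄_b C^{p,q-1}` inside `Ker ∂̄_b ∩ C^{p,q}`. -/
def boundDbar (p q : ℕ) : Submodule ℂ (X.kerDbar p q) :=
  (X.imDbar p q).comap (incl E M (p + q) ∘ₗ (X.kerDbar p q).subtype)

/-- The Kohn–Rossi cohomology `H^{p,q}(M) = (Ker ∂̄_b ∩ C^{p,q}) / ∂̄_b C^{p,q-1}`. -/
abbrev KohnRossi (p q : ℕ) : Type _ := X.kerDbar p q ⧸ X.boundDbar p q

/-! ### The spaces `D^{p,q}`, `F^{p,q}`, `F^k` -/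

/-- The forms of `D^{p,q}` among the forms of degree `k`, where
`D^{p,q} = Γ(M, (ℂ ξ)^* ∧ ⋀^{p-1} (⁰T')^* ∧ ⋀^q (⁰T'')^*)` if `p ≥ 1`, and `D^{0,q} = 0`.
The degree of these forms is `k = p + q`. -/
def D : (p q k : ℕ) → Submodule ℂ (SmoothForm E M k)
  | 0, _, _ => ⊥
  | p + 1, q, k => LinearMap.eqLocus (X.part₃ 1 p q k ∘ₗ incl E M k)
      (incl E M k)

/-- `F^{p,q} = {u ∈ D^{p,q} : (du)_{⋀^p (⁰T')^* ∧ ⋀^{q+1} (⁰T'')^*} = 0}`, for `k = p + q`. -/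
def F (p q k : ℕ) : Submodule ℂ (SmoothForm E M k) :=
  X.D p q k ⊓ LinearMap.ker (X.part₃ 0 p (q + 1) (k + 1) ∘ₗ d k)

/-- `F^k = ∑_{p+q=k} F^{p,q}`. -/
def Ftot (k : ℕ) : Submodule ℂ (SmoothForm E M k) :=
  ⨆ (p : ℕ) (q : ℕ) (_ : p + q = k), X.F p q k

/-- `d'' u = (du)_{(ℂ ξ)^* ∧ ⋀^{p-1} (⁰T')^* ∧ ⋀^{q+1} (⁰T'')^*}` for `u ∈ F^{p,q}`, with
`d'' = 0` for `p = 0` (where `F^{0,q} = 0`). -/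
def dSecond : (p q k : ℕ) → SmoothForm E M k →ₗ[ℂ] CForm E M (k + 1)
  | 0, _, _ => 0
  | p + 1, q, k => X.part₃ 1 p (q + 1) (k + 1) ∘ₗ d k

/-- `Ker d'' ∩ F^{p,q}`. -/
def kerSecond (p q : ℕ) : Submodule ℂ (SmoothForm E M (p + q)) :=
  X.F p q (p + q) ⊓ LinearMap.ker (X.dSecond p q (p + q))

/-- `d'' F^{p,q-1}`, the zero space for `q = 0`. -/
def imSecond (p : ℕ) : (q : ℕ) → Submodule ℂ (CForm E M (p + q))
  | 0 => ⊥
  | q + 1 => (X.F p q (p + q)).map (X.dSecond p q (p + q))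

/-- `d'' F^{p,q-1}` inside `Ker d'' ∩ F^{p,q}`. -/
def boundSecond (p q : ℕ) : Submodule ℂ (X.kerSecond p q) :=
  (X.imSecond p q).comap (incl E M (p + q) ∘ₗ (X.kerSecond p q).subtype)

/-- The cohomology of the `d''`-complex on `F^{p,q}`: `(Ker d'' ∩ F^{p,q}) / d'' F^{p,q-1}`. -/
abbrev HSecond (p q : ℕ) : Type _ := X.kerSecond p q ⧸ X.boundSecond p q

/-- `Ker d ∩ F^k`. -/
def kerF (k : ℕ) : Submodule ℂ (SmoothForm E M k) :=
  X.Ftot k ⊓ LinearMap.ker (d k)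

/-- `d F^{k-1}`, the zero space for `k = 0`. -/
def imF : (k : ℕ) → Submodule ℂ (CForm E M k)
  | 0 => ⊥
  | k + 1 => (X.Ftot k).map (d k)

/-- `d F^{k-1}` inside `Ker d ∩ F^k`. -/
def boundF (k : ℕ) : Submodule ℂ (X.kerF k) :=
  (X.imF k).comap (incl E M k ∘ₗ (X.kerF k).subtype)

/-- The cohomology of the complex `(F^k, d)`: `(Ker d ∩ F^k) / d F^{k-1}`. -/
abbrev HF (k : ℕ) : Type _ := X.kerF k ⧸ X.boundF k

end Supplement

end CR

/-! ### De Rham cohomology -/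

section DeRham

variable (E : Type*) [NormedAddCommGroup E] [NormedSpace ℝ E] [FiniteDimensional ℝ E]
variable (M : Type*) [TopologicalSpace M] [ChartedSpace E M]

/-- The closed complex `k`-forms. -/
def kerD (k : ℕ) : Submodule ℂ (SmoothForm E M k) := LinearMap.ker (d k)

/-- The exact complex `k`-forms, the zero space for `k = 0`. -/
def imD : (k : ℕ) → Submodule ℂ (CForm E M k)
  | 0 => ⊥
  | k + 1 => LinearMap.range (d (E := E) (M := M) k)

/-- The exact `k`-forms inside the closed ones. -/
def boundD (k : ℕ) : Submodule ℂ (kerD E M k) :=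
  (imD E M k).comap (incl E M k ∘ₗ (kerD E M k).subtype)

/-- The de Rham cohomology `Ker d / Im d` of complex forms of degree `k`. -/
abbrev DeRham (k : ℕ) : Type _ := kerD E M k ⧸ boundD E M k

end DeRham

end CRManifold

end

/-!
The proof is Lefschetz theory on the horizontal bundle `H = ⁰T' + ⁰T''`. Let `θ` be the 1-form with
`θ(ξ) = 1` that vanishes on `H`. Since `⁰T''` is involutive, and hence `⁰T'` as well, `dθ` vanishes on
pairs of vectors of `⁰T''` and on pairs of vectors of `⁰T'` (`dBilin_theta_T01`, `dBilin_theta_T10`): on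
`H` it has type `(1, 1)`. On `⁰T''` the number `dθ(Z, conj Z)` is a non-zero multiple of the Levi form
`L(Z, Z)` (`dBilin_theta_ne_zero`), so that strong pseudoconvexity makes `dθ` non-degenerate on `H`
(`dthetaHor_nondegenerate`); only `L(Z, Z) ≠ 0` for `Z ≠ 0` matters for this.

Write `2 N + 1` for the real dimension, so that `N = n - 1` and `H` has complex dimension `2 N`. On
horizontal forms let `L` be exterior multiplication by `dθ`, and `Λ` contraction with the bivector
inverse to `dθ`. Up to the normalization of the two operators, `[L, Λ]` is multiplication by `k - N` on
horizontal `k`-forms (`lefschetz_commutator`). This is an identity of multilinear algebra for any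
non-degenerate 2-form (`wedgeTwo_commutator`) and needs no metric. A descending induction on the degree,
starting above the top degree, then shows that `L` maps onto the smooth horizontal forms of every degree
`k > N` with `k ≥ 2` (`exists_lefschetz_preimage`). There is no choice of local solutions in this: `Λ`
maps smooth forms to smooth forms, and so does the right inverse that is built from it.

Since `d(θ ∧ γ)` and `dθ ∧ γ` agree on horizontal vectors, every smooth horizontal form of degree
`k ≥ n` is the horizontal part of `dv` for a form `v` that is a multiple of `θ`
(`exists_vertical_primitive`). Call a form vertical if it vanishes on horizontal vectors. A form of degree
`k ≥ n` thus becomes vertical after an exact form has been subtracted (`exists_sub_d_vertical`). As `dθ`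
has type `(1, 1)`, the construction respects types: the part of type `(a + 1, b + 1)` of the horizontal
part of `dv` is determined by the part of `v` in `(ℂ ξ)^* ∧ ∧^a (⁰T')^* ∧ ∧^b (⁰T'')^*`
(`exists_type_of_extD_ne_zero`). Therefore an element of `C^{p,q}` with `p + q ≥ n` can be moved into
`D^{p,q}` by an element of `∂̄_b C^{p,q-1}` (`exists_mem_D`).

It remains to compare the complexes. On `F^{p,q}` the operators `∂̄_b` and `d''` agree
(`dbar_eq_dSecond`), and an element `u` of `D^{p,q}` lies in `F^{p,q}` as soon as `∂̄_b u` lies in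
`D^{p,q+1}` (`mem_F_of_part₃_dbar`, `part₃_zero_of_mem_D`). In total degree, `F^k` consists of the
vertical forms with vertical derivative (`Ftot_eq_verticalForms`). So a cocycle in degree at least `n` is
cohomologous to one in the subcomplex, which gives the surjectivity; and if a cocycle of the subcomplex in
degree at least `n + 1` is the derivative of a form, that form has degree at least `n` and can be replaced
by a form of the subcomplex, which gives the injectivity. For `∂̄_b` the replacement does not change the
derivative because `∂̄_b ∂̄_b = 0` (`dbar_dbar`). This follows from involutivity: `d` raises the maximal
number of arguments in `⁰T''` on which a form does not vanish by at most one (`vanishesFrom_extD`).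

Forms are families of alternating forms on the complexified tangent spaces `ℂ ⊗ T_x M`. Their smoothness
is tested on smooth complex vector fields (`smoothForm_apply`, `smoothForm_of_apply`), the exterior
derivative of a 1-form is related to the Lie bracket by computation in a chart
(`dBilin_eq_neg_bracket`), and the Leibniz rule is needed for products with a 1-form only
(`extD_wedgeOne`). The wedge products carry no factors (`wedgeOne`, `wedgeTwo`); multiplication by a
bilinear form antisymmetrizes it, which produces the factors `2` and `4` below.
-/

set_option linter.unusedSectionVars false

noncomputable section

namespace CRManifold

/-! ### Exterior and interior multiplication -/

section Exterior

variable {R V : Type*} [CommRing R] [AddCommGroup V] [Module R V]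

/-- Exterior multiplication `α ∧ γ` of a form `γ` by a linear form `α`, without factors:
`(α ∧ γ)(v_0, …, v_k) = ∑ (-1)^i α(v_i) γ(…, v̂_i, …)`. -/
def wedgeOne {k : ℕ} : (V →ₗ[R] R) →ₗ[R] (V [⋀^Fin k]→ₗ[R] R) →ₗ[R] (V [⋀^Fin (k + 1)]→ₗ[R] R) :=
  LinearMap.mk₂ R (fun α γ => AlternatingMap.alternatizeUncurryFin (α.smulRight γ))
    (fun α α' γ => by
      ext v
      simp [AlternatingMap.alternatizeUncurryFin_apply, add_mul, Finset.sum_add_distrib])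
    (fun c α γ => by
      ext v
      simp [AlternatingMap.alternatizeUncurryFin_apply, Finset.mul_sum, mul_left_comm, mul_assoc])
    (fun α γ γ' => by
      ext v
      simp [AlternatingMap.alternatizeUncurryFin_apply, Finset.sum_add_distrib])
    (fun c α γ => by
      ext v
      simp [AlternatingMap.alternatizeUncurryFin_apply, Finset.mul_sum, mul_left_comm])

theorem wedgeOne_eq {k : ℕ} (α : V →ₗ[R] R) (γ : V [⋀^Fin k]→ₗ[R] R) :
    wedgeOne α γ = AlternatingMap.alternatizeUncurryFin (α.smulRight γ) := rfl

theorem wedgeOne_apply {k : ℕ} (α : V →ₗ[R] R) (γ : V [⋀^Fin k]→ₗ[R] R) (v : Fin (k + 1) → V) :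
    wedgeOne α γ v = ∑ i : Fin (k + 1), (-1) ^ (i : ℕ) * (α (v i) * γ (i.removeNth v)) := by
  rw [wedgeOne_eq, AlternatingMap.alternatizeUncurryFin_apply]
  simp [zsmul_eq_mul]

/-- Exterior multiplication of a form `γ` by a bilinear form `B = ∑ α ⊗ β`, the sum of the
`α ∧ (β ∧ γ)`. If `B` is alternating, this is `2 B ∧ γ`. -/
def wedgeTwo {k : ℕ} (B : V →ₗ[R] V →ₗ[R] R) :
    (V [⋀^Fin k]→ₗ[R] R) →ₗ[R] (V [⋀^Fin (k + 1 + 1)]→ₗ[R] R) where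
  toFun γ := AlternatingMap.alternatizeUncurryFin ((wedgeOne.flip γ) ∘ₗ B)
  map_add' γ γ' := by
    rw [map_add, LinearMap.add_comp, AlternatingMap.alternatizeUncurryFin_add]
  map_smul' c γ := by
    rw [map_smul, LinearMap.smul_comp, AlternatingMap.alternatizeUncurryFin_smul]
    rfl

theorem wedgeTwo_eq {k : ℕ} (B : V →ₗ[R] V →ₗ[R] R) (γ : V [⋀^Fin k]→ₗ[R] R) :
    wedgeTwo B γ = AlternatingMap.alternatizeUncurryFin ((wedgeOne.flip γ) ∘ₗ B) := rfl

theorem wedgeTwo_apply {k : ℕ} (B : V →ₗ[R] V →ₗ[R] R) (γ : V [⋀^Fin k]→ₗ[R] R)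
    (v : Fin (k + 1 + 1) → V) :
    wedgeTwo B γ v = ∑ i : Fin (k + 1 + 1), (-1) ^ (i : ℕ) * ∑ j : Fin (k + 1), (-1) ^ (j : ℕ) *
      (B (v i) (i.removeNth v j) * γ (j.removeNth (i.removeNth v))) := by
  rw [wedgeTwo_eq, AlternatingMap.alternatizeUncurryFin_apply]
  simp [zsmul_eq_mul, wedgeOne_apply]

/-- The commutation rule of interior multiplication and alternation: the vector `v` either becomes the
first argument of `f`, or is inserted into one of the forms `f w`. -/
theorem curryLeft_alternatizeUncurryFin {k : ℕ} (f : V →ₗ[R] V [⋀^Fin (k + 1)]→ₗ[R] R) (v : V) :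
    (AlternatingMap.alternatizeUncurryFin f).curryLeft v =
      f v - AlternatingMap.alternatizeUncurryFin
        ((AlternatingMap.curryLeftLinearMap (R := R) (M := V) (N := R) (n := k)).flip v ∘ₗ f) := by
  ext w
  rw [AlternatingMap.curryLeft_apply_apply, AlternatingMap.alternatizeUncurryFin_apply,
    Fin.sum_univ_succ, AlternatingMap.sub_apply, AlternatingMap.alternatizeUncurryFin_apply,
    sub_eq_add_neg, ← Finset.sum_neg_distrib]
  congr 1
  · simp [Matrix.vecCons]
  · refine Finset.sum_congr rfl fun i _ => ?_
    have : i.succ.removeNth (Matrix.vecCons v w) = Matrix.vecCons v (i.removeNth w) := by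
      rcases k with _ | k
      · funext j
        fin_cases i
        fin_cases j
        rfl
      · funext j
        refine Fin.cases ?_ (fun j => ?_) j
        · simp [Fin.removeNth]
        · simp [Fin.removeNth]
    rw [this]
    simp [pow_succ]

theorem curryLeft_wedgeOne {k : ℕ} (α : V →ₗ[R] R) (γ : V [⋀^Fin (k + 1)]→ₗ[R] R) (v : V) :
    (wedgeOne α γ).curryLeft v = α v • γ - wedgeOne α (γ.curryLeft v) := by
  rw [wedgeOne_eq, curryLeft_alternatizeUncurryFin]
  congr 1

theorem curryLeft_wedgeTwo {k : ℕ} (B : V →ₗ[R] V →ₗ[R] R) (hB : ∀ v w, B v w = - B w v)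
    (γ : V [⋀^Fin (k + 1)]→ₗ[R] R) (v : V) :
    (wedgeTwo B γ).curryLeft v = wedgeTwo B (γ.curryLeft v) + (2 : R) • wedgeOne (B v) γ := by
  rw [wedgeTwo_eq, curryLeft_alternatizeUncurryFin]
  have h : (AlternatingMap.curryLeftLinearMap (R := R) (M := V) (N := R) (n := k + 1)).flip v ∘ₗ
      (wedgeOne.flip γ) ∘ₗ B = (-1 : R) • ((B v).smulRight γ) +
        (-1 : R) • (wedgeOne.flip (γ.curryLeft v)) ∘ₗ B := by
    ext w : 1
    change (wedgeOne (B w) γ).curryLeft v =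
      (-1 : R) • (B v w • γ) + (-1 : R) • wedgeOne (B w) (γ.curryLeft v)
    rw [curryLeft_wedgeOne, hB w v]
    module
  rw [h, AlternatingMap.alternatizeUncurryFin_add,
    AlternatingMap.alternatizeUncurryFin_smul, AlternatingMap.alternatizeUncurryFin_smul,
    ← wedgeOne_eq, ← wedgeTwo_eq, two_smul]
  simp only [LinearMap.flip_apply, LinearMap.comp_apply]
  module

theorem removeNth_eq_insert {k : ℕ} (γ : V [⋀^Fin (k + 1)]→ₗ[R] R) (i : Fin (k + 1)) (w : V)
    (v : Fin (k + 1) → V) :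
    (-1 : R) ^ (i : ℕ) * γ (Matrix.vecCons w (i.removeNth v)) = γ (Function.update v i w) := by
  have h := γ.map_insertNth i w (i.removeNth v)
  rw [Fin.insertNth_removeNth] at h
  rw [h]
  simp [zsmul_eq_mul]

/-- `α ∧ ι_w γ` replaces each argument `v_i` in turn by `α(v_i) w`. -/
theorem wedgeOne_curryLeft_apply {k : ℕ} (α : V →ₗ[R] R) (γ : V [⋀^Fin (k + 1)]→ₗ[R] R) (w : V)
    (v : Fin (k + 1) → V) :
    wedgeOne α (γ.curryLeft w) v = ∑ i, γ (Function.update v i (α (v i) • w)) := by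
  rw [wedgeOne_apply]
  refine Finset.sum_congr rfl fun i _ => ?_
  rw [γ.map_update_smul, smul_eq_mul, ← removeNth_eq_insert, AlternatingMap.curryLeft_apply_apply]
  ring

theorem sum_alternatingMap_apply {ι : Type*} (s : Finset ι) {k : ℕ}
    (f : ι → V [⋀^Fin k]→ₗ[R] R) (v : Fin k → V) : (∑ b ∈ s, f b) v = ∑ b ∈ s, f b v :=
  map_sum (AddMonoidHom.mk' (fun g : V [⋀^Fin k]→ₗ[R] R => g v) fun _ _ => rfl) f s

/-- If `∑ α_b ⊗ w_b` is the endomorphism `T`, then `∑ α_b ∧ ι_{w_b}` acts on forms as the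
derivation defined by `T`. -/
theorem sum_wedgeOne_curryLeft_apply {ι : Type*} (s : Finset ι) (α : ι → V →ₗ[R] R) (w : ι → V)
    (T : V → V) (hT : ∀ v, ∑ b ∈ s, α b v • w b = T v) {k : ℕ} (γ : V [⋀^Fin (k + 1)]→ₗ[R] R)
    (v : Fin (k + 1) → V) :
    (∑ b ∈ s, wedgeOne (α b) (γ.curryLeft (w b))) v = ∑ i, γ (Function.update v i (T (v i))) := by
  rw [sum_alternatingMap_apply]
  simp only [wedgeOne_curryLeft_apply]
  rw [Finset.sum_comm]
  refine Finset.sum_congr rfl fun i _ => ?_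
  rw [← hT, γ.map_update_sum]

/-- The commutator of exterior multiplication by an alternating bilinear form `B` and of the
contraction with the bivector `∑ a_b ∧ c_b` inverse to `B` on the range of a projection `H`. -/
theorem wedgeTwo_commutator {ι : Type*} (s : Finset ι) (B : V →ₗ[R] V →ₗ[R] R)
    (hB : ∀ v w, B v w = - B w v) (a c : ι → V) (H : V → V) (N : R)
    (h1 : ∀ z, ∑ b ∈ s, B (a b) z • c b = - H z) (h2 : ∀ z, ∑ b ∈ s, B (c b) z • a b = H z)
    (h3 : ∑ b ∈ s, B (c b) (a b) = 2 * N) {k : ℕ} (β : V [⋀^Fin (k + 1 + 1)]→ₗ[R] R)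
    (hβ : ∀ v i, β (Function.update v i (H (v i))) = β v) :
    wedgeTwo B (∑ b ∈ s, (β.curryLeft (c b)).curryLeft (a b)) -
      ∑ b ∈ s, ((wedgeTwo B β).curryLeft (c b)).curryLeft (a b) =
        (4 * (((k + 2 : ℕ) : R) - N)) • β := by
  have e1 : ∑ b ∈ s, wedgeOne (B (a b)) (β.curryLeft (c b)) = (-((k + 2 : ℕ) : R)) • β := by
    ext v
    rw [sum_wedgeOne_curryLeft_apply s (fun b => B (a b)) c (fun z => - H z) h1]
    simp only [AlternatingMap.map_update_neg, hβ]
    simp [add_assoc, one_add_one_eq_two]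
    ring
  have e2 : ∑ b ∈ s, wedgeOne (B (c b)) (β.curryLeft (a b)) = ((k + 2 : ℕ) : R) • β := by
    ext v
    rw [sum_wedgeOne_curryLeft_apply s (fun b => B (c b)) a H h2]
    simp only [hβ]
    simp [add_assoc, one_add_one_eq_two]
  have e3 : ∀ b, ((wedgeTwo B β).curryLeft (c b)).curryLeft (a b) =
      wedgeTwo B ((β.curryLeft (c b)).curryLeft (a b)) +
      ((2 : R) • wedgeOne (B (a b)) (β.curryLeft (c b)) + ((2 * B (c b) (a b)) • β -
        (2 : R) • wedgeOne (B (c b)) (β.curryLeft (a b)))) := by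
    intro b
    rw [curryLeft_wedgeTwo B hB, AlternatingMap.curryLeft_add, LinearMap.add_apply,
      curryLeft_wedgeTwo B hB, AlternatingMap.curryLeft_smul, LinearMap.smul_apply,
      curryLeft_wedgeOne]
    module
  simp only [e3, Finset.sum_add_distrib, Finset.sum_sub_distrib, ← Finset.smul_sum, e1, e2,
    ← Finset.sum_smul, ← Finset.mul_sum, h3, map_sum]
  module

theorem wedgeOne_compLinearMap {V' : Type*} [AddCommGroup V'] [Module R V'] {k : ℕ}
    (α : V →ₗ[R] R) (γ : V [⋀^Fin k]→ₗ[R] R) (T : V' →ₗ[R] V) :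
    (wedgeOne α γ).compLinearMap T = wedgeOne (α ∘ₗ T) (γ.compLinearMap T) := by
  ext v
  simp only [AlternatingMap.compLinearMap_apply, wedgeOne_apply]
  rfl

theorem wedgeTwo_compLinearMap {V' : Type*} [AddCommGroup V'] [Module R V'] {k : ℕ}
    (B : V →ₗ[R] V →ₗ[R] R) (γ : V [⋀^Fin k]→ₗ[R] R) (T : V' →ₗ[R] V) :
    (wedgeTwo B γ).compLinearMap T = wedgeTwo (B.compl₁₂ T T) (γ.compLinearMap T) := by
  ext v
  simp only [AlternatingMap.compLinearMap_apply, wedgeTwo_apply]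
  rfl

/-- A form killed by interior multiplication with `ξ` does not change if multiples of `ξ` are
subtracted from its arguments. -/
theorem compLinearMap_eq_self_of_curryLeft_eq_zero {k : ℕ} (u : V [⋀^Fin (k + 1)]→ₗ[R] R) (ξ : V)
    (hu : u.curryLeft ξ = 0) (T : V →ₗ[R] V) (hT : ∀ v, ∃ c : R, v - T v = c • ξ) :
    u.compLinearMap T = u := by
  have hup : ∀ v i, u (Function.update v i ξ) = 0 := by
    intro v i
    rw [← removeNth_eq_insert, ← AlternatingMap.curryLeft_apply_apply, hu]
    simp
  ext v
  have key : ∀ s : Finset (Fin (k + 1)), u (s.piecewise (fun i => T (v i)) v) = u v := by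
    intro s
    induction s using Finset.induction_on with
    | empty => simp
    | insert i s hi ih =>
      obtain ⟨c, hc⟩ := hT (v i)
      rw [Finset.piecewise_insert, show T (v i) = v i + (-c) • ξ by rw [neg_smul, ← hc]; abel,
        u.map_update_add, u.map_update_smul, hup, smul_zero, add_zero, ← ih]
      congr 1
      funext j
      by_cases h : j = i
      · subst h; simp [hi]
      · simp [h]
  have := key Finset.univ
  simpa using this

end Exterior

/-! ### Solving `L γ = β` in degrees above the middle -/

/-- If `[L, Λ]` acts on the space `W k` as a positive multiple of `k - N`, for `k` at least `2`,
and `W k` is zero for large `k`, then `L` is surjective onto `W k` for `k > N`. By descending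
induction on the degree, `L Λ + c` is surjective for `c ≥ 0`: it is `Λ L + e` with `e > 0`, and
`e⁻¹ (1 - Λ (L Λ + e)⁻¹ L)` is a right inverse of `Λ L + e`. -/
theorem exists_lefschetz_preimage {W : ℕ → Type*} [∀ k, AddCommGroup (W k)] [∀ k, Module ℂ (W k)]
    (L : ∀ k, W k →ₗ[ℂ] W (k + 2)) (Λ : ∀ k, W (k + 2) →ₗ[ℂ] W k) (N K : ℕ)
    (hK : ∀ k, K ≤ k → ∀ β : W k, β = 0)
    (hc : ∀ k, ∀ β : W (k + 2), L k (Λ k β) - Λ (k + 2) (L (k + 2) β) =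
      (4 * (((k + 2 : ℕ) : ℂ) - N)) • β)
    (k : ℕ) (hk : N < k + 2) (β : W (k + 2)) : ∃ γ, L k γ = β := by
  have key : ∀ m k : ℕ, N < k + 2 → K ≤ k + 2 + m → ∀ c : ℕ, ∀ β : W (k + 2),
      ∃ γ, L k (Λ k γ) + (c : ℂ) • γ = β := by
    intro m
    induction m using Nat.strong_induction_on with
    | _ m ih =>
      intro k hk hKm c β
      by_cases hlt : K ≤ k + 2
      · exact ⟨0, by rw [hK _ hlt β]; simp⟩
      · obtain ⟨s, hs⟩ : ∃ s : ℕ, k + 2 = N + s := ⟨k + 2 - N, by omega⟩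
        have hs0 : 0 < s := by omega
        obtain ⟨δ, hδ⟩ := ih (m - 1) (by omega) (k + 2) (by omega) (by omega) (c + 4 * s)
          (L (k + 2) β)
        have he : ((c + 4 * s : ℕ) : ℂ) ≠ 0 := by
          norm_cast
          omega
        set e : ℂ := ((c + 4 * s : ℕ) : ℂ) with hedef
        refine ⟨e⁻¹ • (β - Λ (k + 2) δ), ?_⟩
        have h1 := hc k (e⁻¹ • (β - Λ (k + 2) δ))
        have h2 : (4 * (((k + 2 : ℕ) : ℂ) - N)) = e - c := by
          rw [hs, hedef]; push_cast; ring
        rw [h2, sub_eq_iff_eq_add] at h1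
        rw [h1]
        have h3 : L (k + 2) (Λ (k + 2) δ) = L (k + 2) β - e • δ := by rw [← hδ]; abel
        simp only [map_smul, map_sub, h3]
        have h4 : (e - c) • e⁻¹ • (β - Λ (k + 2) δ) + e⁻¹ • (Λ (k + 2) (L (k + 2) β) -
            (Λ (k + 2) (L (k + 2) β) - e • Λ (k + 2) δ)) + (c : ℂ) • e⁻¹ • (β - Λ (k + 2) δ) =
            (e * e⁻¹) • β := by module
        rw [h4, mul_inv_cancel₀ he, one_smul]
  obtain ⟨γ, hγ⟩ := key K k hk (by omega) 0 β
  exact ⟨Λ k γ, by simpa using hγ⟩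

/-! ### Components of forms with respect to a decomposition -/

section Components

variable {V ι : Type*} [AddCommGroup V] [Module ℂ V] [Fintype ι] [DecidableEq ι]

/-- The endomorphisms `P i` are the projections of a direct sum decomposition. A tuple `v` with
`P (f j) (v j) = v j` for all `j` is called homogeneous. -/
structure IsDecomposition (P : ι → V →ₗ[ℂ] V) : Prop where
  proj_self : ∀ i v, P i (P i v) = P i v
  proj_of_ne : ∀ i j v, i ≠ j → P i (P j v) = 0
  sum_proj : ∀ v, ∑ i, P i v = v

theorem IsDecomposition.map_eq_sum {P : ι → V →ₗ[ℂ] V} (hP : IsDecomposition P) {k : ℕ}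
    (u : V [⋀^Fin k]→ₗ[ℂ] ℂ) (v : Fin k → V) :
    u v = ∑ f : Fin k → ι, u (fun j => P (f j) (v j)) := by
  conv_lhs => rw [show v = fun j => ∑ i, P i (v j) from funext fun j => (hP.sum_proj (v j)).symm]
  exact u.toMultilinearMap.map_sum fun j i => P i (v j)

/-- Two forms agree if they agree on the tuples of homogeneous vectors. -/
theorem IsDecomposition.ext {P : ι → V →ₗ[ℂ] V} (hP : IsDecomposition P) {k : ℕ}
    {u w : V [⋀^Fin k]→ₗ[ℂ] ℂ}
    (h : ∀ (f : Fin k → ι) (v : Fin k → V), (∀ j, P (f j) (v j) = v j) → u v = w v) : u = w := by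
  ext v
  rw [hP.map_eq_sum u, hP.map_eq_sum w]
  exact Finset.sum_congr rfl fun f _ => h f _ fun j => hP.proj_self _ _

theorem IsDecomposition.component_apply_of_proj {P : ι → V →ₗ[ℂ] V} (hP : IsDecomposition P)
    (c : ι → ℕ) {k : ℕ} (u : V [⋀^Fin k]→ₗ[ℂ] ℂ) (f : Fin k → ι) (v : Fin k → V)
    (hv : ∀ j, P (f j) (v j) = v j) :
    component P c k u v = if countOf f = c then u v else 0 := by
  have h0 : ∀ g : Fin k → ι, g ≠ f → u (fun j => P (g j) (v j)) = 0 := by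
    intro g hg
    obtain ⟨j, hj⟩ := Function.ne_iff.1 hg
    refine u.map_coord_zero j ?_
    rw [← hv j, hP.proj_of_ne _ _ _ hj]
  rw [component_apply, Finset.sum_filter, Finset.sum_eq_single f]
  · simp only [hv]
  · intro g _ hg
    rw [h0 g hg, ite_self]
  · simp

theorem IsDecomposition.component_component {P : ι → V →ₗ[ℂ] V} (hP : IsDecomposition P)
    (c c' : ι → ℕ) {k : ℕ} (u : V [⋀^Fin k]→ₗ[ℂ] ℂ) :
    component P c k (component P c' k u) = if c = c' then component P c k u else 0 := by
  refine hP.ext fun f v hv => ?_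
  rw [hP.component_apply_of_proj c _ f v hv, hP.component_apply_of_proj c' _ f v hv]
  split_ifs with h1 h2 h3 h3 h3
  · rw [hP.component_apply_of_proj c u f v hv, if_pos h1]
  · exact absurd (h1.symm.trans h2) h3
  · exact absurd (h1.trans h3) h2
  · rfl
  · rw [hP.component_apply_of_proj c u f v hv, if_neg h1]
  · rfl

theorem countOf_eq_add_removeNth {ι : Type*} [DecidableEq ι] {k : ℕ} (f : Fin (k + 1) → ι)
    (i : Fin (k + 1)) (a : ι) :
    countOf f a = (if f i = a then 1 else 0) + countOf (i.removeNth f) a := by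
  simp only [countOf, Finset.card_filter]
  rw [Fin.sum_univ_succAbove _ i]
  rfl

theorem sum_countOf {k : ℕ} (f : Fin k → ι) : ∑ a, countOf f a = k := by
  simp only [countOf]
  rw [← Finset.card_eq_sum_card_fiberwise (f := f) (t := Finset.univ) (by simp)]
  simp

theorem exists_of_countOf_pos {ι : Type*} [DecidableEq ι] {k : ℕ} {f : Fin k → ι} {a : ι}
    (h : 0 < countOf f a) : ∃ j, f j = a := by
  obtain ⟨j, hj⟩ := Finset.card_pos.1 h
  exact ⟨j, (Finset.mem_filter.1 hj).2⟩

theorem countOf_pos {ι : Type*} [DecidableEq ι] {k : ℕ} {f : Fin k → ι} (j : Fin k) :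
    0 < countOf f (f j) :=
  Finset.card_pos.2 ⟨j, by simp⟩

/-- A form of which the value on a homogeneous tuple is zero unless its multidegree lies in a
finite set is the sum of its components over that set. -/
theorem IsDecomposition.sum_component {P : ι → V →ₗ[ℂ] V} (hP : IsDecomposition P) {k : ℕ}
    (u : V [⋀^Fin k]→ₗ[ℂ] ℂ) (s : Finset (ι → ℕ))
    (hs : ∀ (f : Fin k → ι) (v : Fin k → V), (∀ j, P (f j) (v j) = v j) →
      countOf f ∉ s → u v = 0) : ∑ c ∈ s, component P c k u = u := by
  refine hP.ext fun f v hv => ?_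
  rw [sum_alternatingMap_apply]
  simp only [hP.component_apply_of_proj _ u f v hv, Finset.sum_ite_eq]
  split_ifs with h
  · rfl
  · exact (hs f v hv h).symm

theorem alternating_eq_zero_of_finrank_lt [FiniteDimensional ℂ V] {k : ℕ}
    (hk : Module.finrank ℂ V < k) (u : V [⋀^Fin k]→ₗ[ℂ] ℂ) : u = 0 := by
  ext v
  refine u.map_linearDependent v fun h => ?_
  have := h.fintype_card_le_finrank
  simp at this
  omega

end Components

/-! ### Charts and smooth real vector fields -/

section Fields

variable {E : Type*} [NormedAddCommGroup E] [NormedSpace ℝ E]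
variable {M : Type*} [TopologicalSpace M] [ChartedSpace E M] [IsManifold 𝓘(ℝ, E) ∞ M]

instance isManifold_one : IsManifold 𝓘(ℝ, E) 1 M := IsManifold.of_le (n := ∞) (by simp)

/-- The derivative at `y` of the chart at `x₀`. -/
def coordMap (x₀ y : M) : TangentSpace 𝓘(ℝ, E) y →L[ℝ] E :=
  mfderiv 𝓘(ℝ, E) 𝓘(ℝ, E) (extChartAt 𝓘(ℝ, E) x₀) y

theorem chartSymmDeriv_coordMap (x₀ : M) {y : E} (hy : y ∈ (extChartAt 𝓘(ℝ, E) x₀).target)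
    (v : TangentSpace 𝓘(ℝ, E) ((extChartAt 𝓘(ℝ, E) x₀).symm y)) :
    chartSymmDeriv x₀ y (coordMap x₀ ((extChartAt 𝓘(ℝ, E) x₀).symm y) v) = v := by
  have h := mfderivWithin_extChartAt_symm_comp_mfderiv_extChartAt (I := 𝓘(ℝ, E)) hy
  rw [ModelWithCorners.range_eq_univ, mfderivWithin_univ] at h
  exact congrArg (fun f : TangentSpace 𝓘(ℝ, E) ((extChartAt 𝓘(ℝ, E) x₀).symm y) →L[ℝ] _ => f v) h

/-- A real vector field is `C^∞` at a point. -/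
def RealSmoothAt (X : ∀ x : M, TangentSpace 𝓘(ℝ, E) x) (x : M) : Prop :=
  ContMDiffAt 𝓘(ℝ, E) 𝓘(ℝ, E).tangent ∞ (fun y => (⟨y, X y⟩ : TangentBundle 𝓘(ℝ, E) M)) x

theorem realSmoothAt_iff (X : ∀ x : M, TangentSpace 𝓘(ℝ, E) x) {x₀ x : M}
    (hx : x ∈ (extChartAt 𝓘(ℝ, E) x₀).source) :
    RealSmoothAt X x ↔
      ContMDiffAt 𝓘(ℝ, E) 𝓘(ℝ, E) ∞ (fun y => coordMap x₀ y (X y)) x := by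
  have hx' : x ∈ (trivializationAt E (TangentSpace 𝓘(ℝ, E)) x₀).baseSet := by
    simpa using hx
  rw [RealSmoothAt]
  refine (Bundle.Trivialization.contMDiffAt_section_iff (IB := 𝓘(ℝ, E)) (n := ∞) _ hx').trans ?_
  refine Filter.EventuallyEq.contMDiffAt_iff ?_
  have : (trivializationAt E (TangentSpace 𝓘(ℝ, E)) x₀).baseSet ∈ 𝓝 x :=
    (Bundle.Trivialization.open_baseSet _).mem_nhds hx'
  filter_upwards [this] with y hy
  have hy' : y ∈ (chartAt E x₀).source := by simpa using hy
  have := TangentBundle.continuousLinearMapAt_trivializationAt (I := 𝓘(ℝ, E)) hy'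
  rw [coordMap, ← this]
  exact (Bundle.Trivialization.continuousLinearMapAt_apply_of_mem ℝ _ hy (X y)).symm

end Fields

/-! ### Smooth complex functions -/

section Functions

variable {E : Type*} [NormedAddCommGroup E] [NormedSpace ℝ E]
variable {M : Type*} [TopologicalSpace M] [ChartedSpace E M]

/-- A complex function on `M` is `C^∞` at a point. -/
def CSmoothAt (f : M → ℂ) (x : M) : Prop := ContMDiffAt 𝓘(ℝ, E) 𝓘(ℝ, ℂ) ∞ f x

variable {f g : M → ℂ} {x : M}

theorem CSmoothAt.comp_contDiff {F G : Type*} [NormedAddCommGroup F] [NormedSpace ℝ F]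
    [NormedAddCommGroup G] [NormedSpace ℝ G] {h : F → G} {f : M → F}
    (hf : ContMDiffAt 𝓘(ℝ, E) 𝓘(ℝ, F) ∞ f x) (hh : ContDiffAt ℝ ∞ h (f x)) :
    ContMDiffAt 𝓘(ℝ, E) 𝓘(ℝ, G) ∞ (fun y => h (f y)) x :=
  hh.contMDiffAt.comp x hf

theorem CSmoothAt.congr (hf : CSmoothAt (E := E) f x) (h : ∀ᶠ y in 𝓝 x, g y = f y) :
    CSmoothAt (E := E) g x :=
  ContMDiffAt.congr_of_eventuallyEq hf h

theorem CSmoothAt.const (c : ℂ) : CSmoothAt (E := E) (fun _ : M => c) x := contMDiffAt_const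

theorem CSmoothAt.add (hf : CSmoothAt (E := E) f x) (hg : CSmoothAt (E := E) g x) :
    CSmoothAt (E := E) (fun y => f y + g y) x :=
  CSmoothAt.comp_contDiff (h := fun p : ℂ × ℂ => p.1 + p.2) (f := fun y => (f y, g y))
    (ContMDiffAt.prodMk_space hf hg) (contDiff_fst.add contDiff_snd).contDiffAt

theorem CSmoothAt.mul (hf : CSmoothAt (E := E) f x) (hg : CSmoothAt (E := E) g x) :
    CSmoothAt (E := E) (fun y => f y * g y) x :=
  CSmoothAt.comp_contDiff (h := fun p : ℂ × ℂ => p.1 * p.2) (f := fun y => (f y, g y))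
    (ContMDiffAt.prodMk_space hf hg) (contDiff_fst.mul contDiff_snd).contDiffAt

theorem CSmoothAt.neg (hf : CSmoothAt (E := E) f x) : CSmoothAt (E := E) (fun y => - f y) x := by
  simpa using (CSmoothAt.const (-1)).mul hf

theorem CSmoothAt.sub (hf : CSmoothAt (E := E) f x) (hg : CSmoothAt (E := E) g x) :
    CSmoothAt (E := E) (fun y => f y - g y) x := by
  simpa [sub_eq_add_neg] using hf.add hg.neg

theorem CSmoothAt.inv (hf : CSmoothAt (E := E) f x) (h0 : f x ≠ 0) :
    CSmoothAt (E := E) (fun y => (f y)⁻¹) x :=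
  CSmoothAt.comp_contDiff (h := fun z : ℂ => z⁻¹) hf (contDiffAt_inv ℝ h0)

theorem CSmoothAt.star (hf : CSmoothAt (E := E) f x) :
    CSmoothAt (E := E) (fun y => (starRingEnd ℂ) (f y)) x :=
  CSmoothAt.comp_contDiff (h := fun z : ℂ => (starRingEnd ℂ) z) hf
    (Complex.conjCLE.contDiff).contDiffAt

theorem CSmoothAt.sum {ι : Type*} (s : Finset ι) {f : ι → M → ℂ}
    (hf : ∀ i ∈ s, CSmoothAt (E := E) (f i) x) : CSmoothAt (E := E) (fun y => ∑ i ∈ s, f i y) x := by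
  classical
  induction s using Finset.induction_on with
  | empty => simpa using CSmoothAt.const 0
  | insert i s hi ih =>
    simp only [Finset.sum_insert hi]
    exact (hf i (Finset.mem_insert_self i s)).add
      (ih fun j hj => hf j (Finset.mem_insert_of_mem hj))

theorem CSmoothAt.prod {ι : Type*} (s : Finset ι) {f : ι → M → ℂ}
    (hf : ∀ i ∈ s, CSmoothAt (E := E) (f i) x) : CSmoothAt (E := E) (fun y => ∏ i ∈ s, f i y) x := by
  classical
  induction s using Finset.induction_on with
  | empty => simpa using CSmoothAt.const 1
  | insert i s hi ih =>
    simp only [Finset.prod_insert hi]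
    exact (hf i (Finset.mem_insert_self i s)).mul
      (ih fun j hj => hf j (Finset.mem_insert_of_mem hj))

/-- The solution of a linear system with smooth coefficients is smooth. -/
theorem CSmoothAt.of_linear_system {ι : Type*} [Fintype ι] [DecidableEq ι] {A : M → Matrix ι ι ℂ}
    {b c : M → ι → ℂ} (hA : ∀ i j, CSmoothAt (E := E) (fun y => A y i j) x)
    (hb : ∀ i, CSmoothAt (E := E) (fun y => b y i) x) (hdet : (A x).det ≠ 0)
    (hc : ∀ᶠ y in 𝓝 x, ∀ i, ∑ j, A y i j * c y j = b y i) (j : ι) :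
    CSmoothAt (E := E) (fun y => c y j) x := by
  have hdets : ∀ B : M → Matrix ι ι ℂ, (∀ i j, CSmoothAt (E := E) (fun y => B y i j) x) →
      CSmoothAt (E := E) (fun y => (B y).det) x := by
    intro B hB
    simp only [Matrix.det_apply']
    exact CSmoothAt.sum _ fun σ _ => (CSmoothAt.const _).mul (CSmoothAt.prod _ fun i _ => hB _ _)
  have hne : ∀ᶠ y in 𝓝 x, (A y).det ≠ 0 :=
    (ContMDiffAt.continuousAt (hdets A hA)).eventually_ne hdet
  have hs : CSmoothAt (E := E) (fun y => ((A y).det)⁻¹ *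
      ∑ i, ((A y).updateRow i (Pi.single j 1)).det * b y i) x := by
    refine ((hdets A hA).inv hdet).mul (CSmoothAt.sum _ fun i _ => CSmoothAt.mul (hdets _ ?_) (hb i))
    intro i' j'
    by_cases h : i' = i
    · subst h
      simpa using CSmoothAt.const _
    · simpa [Matrix.updateRow_ne h] using hA i' j'
  refine hs.congr ?_
  filter_upwards [hc, hne] with y hy hy0
  have h1 : (A y).mulVec (c y) = b y := by
    funext i
    exact hy i
  have h2 : (A y)⁻¹.mulVec (b y) = c y := by
    rw [← h1, Matrix.mulVec_mulVec, Matrix.nonsing_inv_mul _ (Ne.isUnit hy0), Matrix.one_mulVec]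
  rw [← h2, Matrix.inv_def, Matrix.smul_mulVec]
  simp [Matrix.mulVec, dotProduct, Matrix.adjugate_apply]

end Functions

section Real
variable {E : Type*} [NormedAddCommGroup E] [NormedSpace ℝ E] [FiniteDimensional ℝ E]
variable {M : Type*} [TopologicalSpace M] [ChartedSpace E M] [IsManifold 𝓘(ℝ, E) ∞ M]

theorem inChart_coordMap {k : ℕ} (u : CForm E M k) (x₀ : M) {y : E}
    (hy : y ∈ (extChartAt 𝓘(ℝ, E) x₀).target)
    (v : Fin k → TangentSpace 𝓘(ℝ, E) ((extChartAt 𝓘(ℝ, E) x₀).symm y)) :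
    inChart u x₀ y (fun i => coordMap x₀ ((extChartAt 𝓘(ℝ, E) x₀).symm y) (v i)) =
      u ((extChartAt 𝓘(ℝ, E) x₀).symm y) (fun i => ofReal _ (v i)) := by
  rw [inChart, toContinuousForm_apply, AlternatingMap.compLinearMap_apply, realRestrict_apply]
  congr 1
  funext i
  exact congrArg _ (chartSymmDeriv_coordMap x₀ hy (v i))

theorem apply_eq_inChart {k : ℕ} (u : CForm E M k) {x₀ x : M}
    (hx : x ∈ (extChartAt 𝓘(ℝ, E) x₀).source) (v : Fin k → TangentSpace 𝓘(ℝ, E) x) :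
    u x (fun i => ofReal _ (v i)) =
      inChart u x₀ (extChartAt 𝓘(ℝ, E) x₀ x) (fun i => coordMap x₀ x (v i)) := by
  obtain ⟨y, hy, rfl⟩ : ∃ y ∈ (extChartAt 𝓘(ℝ, E) x₀).target, (extChartAt 𝓘(ℝ, E) x₀).symm y = x :=
    ⟨_, (extChartAt 𝓘(ℝ, E) x₀).map_source hx, (extChartAt 𝓘(ℝ, E) x₀).left_inv hx⟩
  rw [(extChartAt 𝓘(ℝ, E) x₀).right_inv hy, inChart_coordMap u x₀ hy]

end Real

/-! ### Real and imaginary parts -/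

section Parts

variable {V : Type*} [AddCommGroup V] [Module ℝ V]

theorem re_add_I_smul_im (z : ℂ ⊗[ℝ] V) :
    ofReal V (rePart V z) + Complex.I • ofReal V (imPart V z) = z := by
  induction z with
  | zero => simp
  | add x y hx hy =>
    conv_rhs => rw [← hx, ← hy]
    simp only [map_add, smul_add]
    abel
  | tmul a v =>
    simp only [rePart_tmul, imPart_tmul, ofReal, TensorProduct.mk_apply, TensorProduct.tmul_smul,
      TensorProduct.smul_tmul', ← TensorProduct.add_tmul]
    congr 1
    apply Complex.ext <;> simp

theorem rePart_ofReal (v : V) : rePart V (ofReal V v) = v := by simp [ofReal, rePart_tmul]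

theorem imPart_ofReal (v : V) : imPart V (ofReal V v) = 0 := by simp [ofReal, imPart_tmul]

theorem rePart_conj (z : ℂ ⊗[ℝ] V) : rePart V (conj V z) = rePart V z := by
  induction z with
  | zero => simp
  | add x y hx hy => simp only [map_add, hx, hy]
  | tmul a v => simp [conj_tmul, rePart_tmul]

theorem imPart_conj (z : ℂ ⊗[ℝ] V) : imPart V (conj V z) = - imPart V z := by
  induction z with
  | zero => simp
  | add x y hx hy => simp only [map_add, hx, hy, neg_add]
  | tmul a v => simp [conj_tmul, imPart_tmul]

/-- The complex-linear extension to `ℂ ⊗ V` of a real linear form on `V`. -/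
def complexFun (l : V →ₗ[ℝ] ℝ) : (ℂ ⊗[ℝ] V) →ₗ[ℂ] ℂ where
  toFun z := (l (rePart V z) : ℂ) + Complex.I * (l (imPart V z) : ℂ)
  map_add' z w := by simp only [map_add, Complex.ofReal_add]; ring
  map_smul' c z := by
    induction z with
    | zero => simp
    | add x y hx hy =>
      simp only [smul_add, map_add, Complex.ofReal_add, RingHom.id_apply, smul_eq_mul] at hx hy ⊢
      linear_combination hx + hy
    | tmul a v =>
      simp only [TensorProduct.smul_tmul', rePart_tmul, imPart_tmul, map_smul, smul_eq_mul,
        RingHom.id_apply]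
      apply Complex.ext <;> simp <;> ring

theorem complexFun_apply (l : V →ₗ[ℝ] ℝ) (z : ℂ ⊗[ℝ] V) :
    complexFun l z = (l (rePart V z) : ℂ) + Complex.I * (l (imPart V z) : ℂ) := rfl

theorem complexFun_ofReal (l : V →ₗ[ℝ] ℝ) (v : V) : complexFun l (ofReal V v) = l v := by
  simp [complexFun_apply, rePart_ofReal, imPart_ofReal]

theorem complexFun_conj (l : V →ₗ[ℝ] ℝ) (z : ℂ ⊗[ℝ] V) :
    complexFun l (conj V z) = (starRingEnd ℂ) (complexFun l z) := by
  rw [complexFun_apply, complexFun_apply, rePart_conj, imPart_conj]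
  simp

theorem complexFun_re (l : V →ₗ[ℝ] ℝ) (z : ℂ ⊗[ℝ] V) : (complexFun l z).re = l (rePart V z) := by
  simp [complexFun_apply]

theorem complexFun_im (l : V →ₗ[ℝ] ℝ) (z : ℂ ⊗[ℝ] V) : (complexFun l z).im = l (imPart V z) := by
  simp [complexFun_apply]

/-- Complex alternating forms on `ℂ ⊗ V` that agree on real vectors are equal. -/
theorem form_ext_real {k : ℕ} {u w : (ℂ ⊗[ℝ] V) [⋀^Fin k]→ₗ[ℂ] ℂ}
    (h : ∀ v : Fin k → V, u (fun j => ofReal V (v j)) = w (fun j => ofReal V (v j))) : u = w := by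
  let b := Module.Free.chooseBasis ℝ V
  refine Module.Basis.ext_alternating (Algebra.TensorProduct.basis ℂ b) fun r _ => ?_
  have : (fun i => (Algebra.TensorProduct.basis ℂ b) (r i)) = fun i => ofReal V (b (r i)) := by
    funext i
    simp [ofReal, Algebra.TensorProduct.basis_apply]
  rw [this, h]

end Parts

/-! ### Smooth complex vector fields -/

section ComplexFields

variable {E : Type*} [NormedAddCommGroup E] [NormedSpace ℝ E] [FiniteDimensional ℝ E]
variable {M : Type*} [TopologicalSpace M] [ChartedSpace E M] [IsManifold 𝓘(ℝ, E) ∞ M]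

/-- A complex vector field is `C^∞` at a point. -/
def FieldSmoothAt (Z : ∀ x : M, CTangent E x) (x : M) : Prop :=
  RealSmoothAt (reField Z) x ∧ RealSmoothAt (imField Z) x

variable (E M) in
/-- The `C^∞` complex vector fields on `M`. -/
def SmoothField (Z : ∀ x : M, CTangent E x) : Prop := ∀ x, FieldSmoothAt Z x

theorem smoothFieldOn_univ_iff (Z : ∀ x : M, CTangent E x) :
    SmoothFieldOn Z Set.univ ↔ SmoothField E M Z := by
  rw [SmoothFieldOn, contMDiffOn_univ, contMDiffOn_univ]
  exact ⟨fun h x => ⟨h.1 x, h.2 x⟩, fun h => ⟨fun x => (h x).1, fun x => (h x).2⟩⟩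

theorem SmoothFieldOn.fieldSmoothAt {Z : ∀ x : M, CTangent E x} {U : Set M}
    (h : SmoothFieldOn Z U) (hU : IsOpen U) {x : M} (hx : x ∈ U) : FieldSmoothAt Z x :=
  ⟨h.1.contMDiffAt (hU.mem_nhds hx), h.2.contMDiffAt (hU.mem_nhds hx)⟩

/-- The `i`-th coordinate, in the chart at `x₀`, of a complex tangent vector at `x`. -/
def coordFun (x₀ : M) (i : Fin (Module.finrank ℝ E)) (x : M) : CTangent E x →ₗ[ℂ] ℂ :=
  complexFun ((Module.finBasis ℝ E).coord i ∘ₗ (coordMap x₀ x).toLinearMap)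

theorem realSmoothAt_iff_coord (X : ∀ x : M, TangentSpace 𝓘(ℝ, E) x) {x₀ x : M}
    (hx : x ∈ (extChartAt 𝓘(ℝ, E) x₀).source) :
    RealSmoothAt X x ↔ ∀ i, ContMDiffAt 𝓘(ℝ, E) 𝓘(ℝ, ℝ) ∞
      (fun y => (Module.finBasis ℝ E).coord i (coordMap x₀ y (X y))) x := by
  rw [realSmoothAt_iff X hx]
  constructor
  · intro h i
    exact CSmoothAt.comp_contDiff (h := fun e => (Module.finBasis ℝ E).coord i e) h
      (LinearMap.toContinuousLinearMap ((Module.finBasis ℝ E).coord i)).contDiff.contDiffAt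
  · intro h
    have h1 := contMDiffAt_pi_space.2 h
    have h2 := CSmoothAt.comp_contDiff (h := fun c => (Module.finBasis ℝ E).equivFun.symm c) h1
      (LinearMap.toContinuousLinearMap
        (Module.finBasis ℝ E).equivFun.symm.toLinearMap).contDiff.contDiffAt
    refine h2.congr_of_eventuallyEq (Filter.Eventually.of_forall fun y => ?_)
    exact ((Module.finBasis ℝ E).equivFun.symm_apply_apply _).symm

theorem cSmoothAt_iff_re_im {f : M → ℂ} {x : M} : CSmoothAt (E := E) f x ↔
    ContMDiffAt 𝓘(ℝ, E) 𝓘(ℝ, ℝ) ∞ (fun y => (f y).re) x ∧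
      ContMDiffAt 𝓘(ℝ, E) 𝓘(ℝ, ℝ) ∞ (fun y => (f y).im) x := by
  constructor
  · intro h
    exact ⟨CSmoothAt.comp_contDiff (h := Complex.re) h Complex.reCLM.contDiff.contDiffAt,
      CSmoothAt.comp_contDiff (h := Complex.im) h Complex.imCLM.contDiff.contDiffAt⟩
  · rintro ⟨h1, h2⟩
    have := CSmoothAt.comp_contDiff (h := fun p : ℝ × ℝ => Complex.equivRealProdCLM.symm p)
      (ContMDiffAt.prodMk_space h1 h2) Complex.equivRealProdCLM.symm.contDiff.contDiffAt
    refine ContMDiffAt.congr_of_eventuallyEq this (Filter.Eventually.of_forall fun y => ?_)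
    exact (Complex.equivRealProdCLM.symm_apply_apply (f y)).symm

/-- A complex vector field is smooth if its coordinates are smooth. -/
theorem fieldSmoothAt_iff (Z : ∀ x : M, CTangent E x) {x₀ x : M}
    (hx : x ∈ (extChartAt 𝓘(ℝ, E) x₀).source) :
    FieldSmoothAt Z x ↔ ∀ i, CSmoothAt (E := E) (fun y => coordFun x₀ i y (Z y)) x := by
  rw [FieldSmoothAt, realSmoothAt_iff_coord _ hx, realSmoothAt_iff_coord _ hx, ← forall_and]
  refine forall_congr' fun i => ?_
  rw [cSmoothAt_iff_re_im]
  simp only [coordFun, complexFun_re, complexFun_im]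
  rfl

variable {Z W : ∀ x : M, CTangent E x} {x : M}

theorem FieldSmoothAt.add (hZ : FieldSmoothAt Z x) (hW : FieldSmoothAt W x) :
    FieldSmoothAt (fun y => Z y + W y) x := by
  rw [fieldSmoothAt_iff _ (mem_extChartAt_source x)] at *
  intro i
  simpa using (hZ i).add (hW i)

theorem FieldSmoothAt.smul {f : M → ℂ} (hf : CSmoothAt (E := E) f x) (hZ : FieldSmoothAt Z x) :
    FieldSmoothAt (fun y => f y • Z y) x := by
  rw [fieldSmoothAt_iff _ (mem_extChartAt_source x)] at *
  intro i
  simpa using hf.mul (hZ i)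

theorem FieldSmoothAt.sub (hZ : FieldSmoothAt Z x) (hW : FieldSmoothAt W x) :
    FieldSmoothAt (fun y => Z y - W y) x := by
  rw [fieldSmoothAt_iff _ (mem_extChartAt_source x)] at *
  intro i
  simpa using (hZ i).sub (hW i)

theorem FieldSmoothAt.sum {ι : Type*} (s : Finset ι) {Z : ι → ∀ x : M, CTangent E x}
    (hZ : ∀ i ∈ s, FieldSmoothAt (Z i) x) : FieldSmoothAt (fun y => ∑ i ∈ s, Z i y) x := by
  rw [fieldSmoothAt_iff _ (mem_extChartAt_source x)]
  intro i
  have := CSmoothAt.sum s fun j hj =>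
    (fieldSmoothAt_iff _ (mem_extChartAt_source x)).1 (hZ j hj) i
  simpa using this

theorem FieldSmoothAt.conj (hZ : FieldSmoothAt Z x) : FieldSmoothAt (conjField Z) x := by
  rw [fieldSmoothAt_iff _ (mem_extChartAt_source x)] at *
  intro i
  have := (hZ i).star
  simp only [coordFun, ← complexFun_conj] at this
  exact this

theorem FieldSmoothAt.congr (hZ : FieldSmoothAt Z x) (h : ∀ᶠ y in 𝓝 x, W y = Z y) :
    FieldSmoothAt W x := by
  rw [fieldSmoothAt_iff _ (mem_extChartAt_source x)] at *
  intro i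
  refine (hZ i).congr ?_
  filter_upwards [h] with y hy
  rw [hy]

theorem fieldSmoothAt_ofReal {X : ∀ x : M, TangentSpace 𝓘(ℝ, E) x} (hX : RealSmoothAt X x) :
    FieldSmoothAt (fun y => ofReal _ (X y)) x := by
  rw [fieldSmoothAt_iff _ (mem_extChartAt_source x)]
  rw [realSmoothAt_iff_coord _ (mem_extChartAt_source x)] at hX
  intro i
  have := CSmoothAt.comp_contDiff (h := fun r : ℝ => (r : ℂ)) (hX i)
    Complex.ofRealCLM.contDiff.contDiffAt
  refine CSmoothAt.congr this (Filter.Eventually.of_forall fun y => ?_)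
  rw [coordFun, complexFun_ofReal]
  rfl

/-! ### Cutoff functions and coordinate frames -/

variable [T2Space M]

/-- There are smooth functions that are `1` near a given point and vanish outside of a given
neighbourhood of it. -/
theorem exists_cutoff {x₀ : M} {U : Set M} (hU : U ∈ 𝓝 x₀) :
    ∃ ρ : M → ℝ, (∀ x, CSmoothAt (E := E) (fun y => (ρ y : ℂ)) x) ∧ (∀ᶠ y in 𝓝 x₀, ρ y = 1) ∧
      tsupport ρ ⊆ U := by
  obtain ⟨ρ, -, hρ⟩ := (SmoothBumpFunction.nhds_basis_tsupport (I := 𝓘(ℝ, E)) x₀).mem_iff.1 hU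
  refine ⟨ρ, fun x => ?_, ρ.eventuallyEq_one, hρ⟩
  exact CSmoothAt.comp_contDiff (h := fun r : ℝ => (r : ℂ)) (ρ.contMDiff x)
    Complex.ofRealCLM.contDiff.contDiffAt

/-- The real coordinate vector fields, cut off to smooth fields on `M`. -/
theorem exists_coord_field (x₀ : M) {x₁ : M} (hx₁ : x₁ ∈ (extChartAt 𝓘(ℝ, E) x₀).source) (e : E) :
    ∃ X : ∀ x : M, TangentSpace 𝓘(ℝ, E) x, (∀ x, RealSmoothAt X x) ∧
      ∀ᶠ y in 𝓝 x₁, coordMap x₀ y (X y) = e := by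
  have hs := (isOpen_extChartAt_source (I := 𝓘(ℝ, E)) x₀).mem_nhds hx₁
  have hinv : ∀ y ∈ (extChartAt 𝓘(ℝ, E) x₀).source, coordMap x₀ y ((coordMap x₀ y).inverse e) = e := by
    intro y hy
    have := isInvertible_mfderiv_extChartAt (I := 𝓘(ℝ, E)) hy
    exact this.self_apply_inverse e
  obtain ⟨ρ, h1, h2, h3⟩ := exists_cutoff (E := E) hs
  refine ⟨fun y => ρ y • (coordMap x₀ y).inverse e, fun x => ?_, ?_⟩
  · by_cases hx : x ∈ (extChartAt 𝓘(ℝ, E) x₀).source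
    · rw [realSmoothAt_iff _ hx]
      have hρ := (cSmoothAt_iff_re_im.1 (h1 x)).1
      have := CSmoothAt.comp_contDiff (h := fun r : ℝ => r • e) hρ
        (contDiff_id.smul contDiff_const).contDiffAt
      refine this.congr_of_eventuallyEq ?_
      filter_upwards [(isOpen_extChartAt_source (I := 𝓘(ℝ, E)) x₀).mem_nhds hx] with y hy
      rw [map_smul, hinv y hy]
      simp
    · have hx' : x ∉ tsupport ρ := fun h => hx (h3 h)
      rw [realSmoothAt_iff _ (mem_extChartAt_source x)]
      refine (contMDiffAt_const (c := (0 : E))).congr_of_eventuallyEq ?_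
      filter_upwards [notMem_tsupport_iff_eventuallyEq.1 hx'] with y hy
      simp [hy]
  · filter_upwards [h2, hs] with y hy hy'
    rw [hy, one_smul, hinv y hy']

end ComplexFields

/-! ### Smooth forms and their values on smooth vector fields -/

section EvalSmooth

variable {E : Type*} [NormedAddCommGroup E] [NormedSpace ℝ E] [FiniteDimensional ℝ E]

theorem continuousAlternating_eq_sum {k : ℕ} (u : E [⋀^Fin k]→L[ℝ] ℂ) (v : Fin k → E) :
    u v = ∑ r : Fin k → Fin (Module.finrank ℝ E),
      (∏ i, (Module.finBasis ℝ E).coord (r i) (v i)) • u (fun i => Module.finBasis ℝ E (r i)) := by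
  have hv : v = fun i => ∑ j, (Module.finBasis ℝ E).coord j (v i) • Module.finBasis ℝ E j := by
    funext i
    exact ((Module.finBasis ℝ E).sum_repr (v i)).symm
  conv_lhs => rw [hv]
  refine (u.toMultilinearMap.map_sum _).trans (Finset.sum_congr rfl fun r _ => ?_)
  exact u.toMultilinearMap.map_smul_univ _ _

theorem contDiff_alternating_apply (k : ℕ) :
    ContDiff ℝ ∞ (fun p : (E [⋀^Fin k]→L[ℝ] ℂ) × (Fin k → E) => p.1 p.2) := by
  rw [show (fun p : (E [⋀^Fin k]→L[ℝ] ℂ) × (Fin k → E) => p.1 p.2) = _ from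
    funext fun p => continuousAlternating_eq_sum p.1 p.2]
  refine ContDiff.sum fun r _ => ContDiff.fun_smul ?_ ?_
  · refine contDiff_prod fun i _ => ?_
    have h1 : ContDiff ℝ ∞ (fun e => (Module.finBasis ℝ E).coord (r i) e) :=
      (LinearMap.toContinuousLinearMap ((Module.finBasis ℝ E).coord (r i))).contDiff
    exact h1.comp ((contDiff_apply ℝ E i).comp contDiff_snd)
  · exact (ContinuousAlternatingMap.apply ℝ E ℂ (fun i => Module.finBasis ℝ E (r i))).contDiff.comp
      contDiff_fst

/-- A family of alternating forms is smooth if its values on the tuples of basis vectors are. -/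
theorem contDiffAt_alternating_of_basis {F : Type*} [NormedAddCommGroup F] [NormedSpace ℝ F]
    {k : ℕ} {f : F → E [⋀^Fin k]→L[ℝ] ℂ} {y : F}
    (h : ∀ r : Fin k → Fin (Module.finrank ℝ E),
      ContDiffAt ℝ ∞ (fun z => f z (fun i => Module.finBasis ℝ E (r i))) y) :
    ContDiffAt ℝ ∞ f y := by
  let T : (E [⋀^Fin k]→L[ℝ] ℂ) →ₗ[ℝ] ((Fin k → Fin (Module.finrank ℝ E)) → ℂ) :=
    LinearMap.pi fun r =>
      (ContinuousAlternatingMap.apply ℝ E ℂ (fun i => Module.finBasis ℝ E (r i))).toLinearMap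
  have hT : LinearMap.ker T = ⊥ := by
    rw [LinearMap.ker_eq_bot']
    intro u hu
    ext v
    rw [continuousAlternating_eq_sum]
    have h0 : ∀ r : Fin k → Fin (Module.finrank ℝ E), u (fun i => Module.finBasis ℝ E (r i)) = 0 := fun r => congrFun hu r
    simp [h0]
  obtain ⟨S, hS⟩ := T.exists_leftInverse_of_injective hT
  have h1 : ContDiffAt ℝ ∞ (fun z => T (f z)) y := contDiffAt_pi.2 h
  have h2 := (LinearMap.toContinuousLinearMap S).contDiff.contDiffAt.comp y h1
  refine h2.congr_of_eventuallyEq (Filter.Eventually.of_forall fun z => ?_)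
  exact (congrArg (fun g : (E [⋀^Fin k]→L[ℝ] ℂ) →ₗ[ℝ] _ => g (f z)) hS).symm

variable {M : Type*} [TopologicalSpace M] [ChartedSpace E M] [IsManifold 𝓘(ℝ, E) ∞ M]

theorem smoothForm_apply_real {k : ℕ} {u : CForm E M k} (hu : u ∈ smoothForms E M k) {x : M}
    {X : Fin k → ∀ x : M, TangentSpace 𝓘(ℝ, E) x} (hX : ∀ i, RealSmoothAt (X i) x) :
    CSmoothAt (E := E) (fun y => u y (fun i => ofReal _ (X i y))) x := by
  have h1 : ContMDiffAt 𝓘(ℝ, E) 𝓘(ℝ, E [⋀^Fin k]→L[ℝ] ℂ) ∞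
      (fun y => inChart u x (extChartAt 𝓘(ℝ, E) x y)) x :=
    CSmoothAt.comp_contDiff (h := inChart u x) contMDiffAt_extChartAt
      ((hu x).contDiffAt ((isOpen_extChartAt_target x).mem_nhds (mem_extChartAt_target x)))
  have h2 : ContMDiffAt 𝓘(ℝ, E) 𝓘(ℝ, Fin k → E) ∞ (fun y i => coordMap x y (X i y)) x :=
    contMDiffAt_pi_space.2 fun i => (realSmoothAt_iff _ (mem_extChartAt_source x)).1 (hX i)
  have h3 := CSmoothAt.comp_contDiff (h1.prodMk_space h2) (contDiff_alternating_apply k).contDiffAt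
  refine CSmoothAt.congr h3 ?_
  filter_upwards [(isOpen_extChartAt_source (I := 𝓘(ℝ, E)) x).mem_nhds (mem_extChartAt_source x)]
    with y hy
  exact apply_eq_inChart u hy _

theorem form_apply_eq_sum_parts {V : Type*} [AddCommGroup V] [Module ℝ V] {k : ℕ}
    (u : (ℂ ⊗[ℝ] V) [⋀^Fin k]→ₗ[ℂ] ℂ) (z : Fin k → ℂ ⊗[ℝ] V) :
    u z = ∑ f : Fin k → Fin 2, (∏ j, (if f j = 0 then (1 : ℂ) else Complex.I)) *
      u (fun j => ofReal V (part V (f j) (z j))) := by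
  have hz : z = fun j => ∑ b : Fin 2, (if b = 0 then (1 : ℂ) else Complex.I) •
      ofReal V (part V b (z j)) := by
    funext j
    rw [Fin.sum_univ_two]
    simpa [part] using (re_add_I_smul_im (z j)).symm
  conv_lhs => rw [hz]
  refine (u.toMultilinearMap.map_sum _).trans (Finset.sum_congr rfl fun r _ => ?_)
  exact u.toMultilinearMap.map_smul_univ _ _

/-- The values of a smooth form on smooth complex vector fields are smooth. -/
theorem smoothForm_apply {k : ℕ} {u : CForm E M k} (hu : u ∈ smoothForms E M k) {x : M}
    {Z : Fin k → ∀ x : M, CTangent E x} (hZ : ∀ i, FieldSmoothAt (Z i) x) :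
    CSmoothAt (E := E) (fun y => u y (fun i => Z i y)) x := by
  simp only [fun y => form_apply_eq_sum_parts (u y) (fun i => Z i y)]
  refine CSmoothAt.sum _ fun f _ => (CSmoothAt.const _).mul ?_
  refine smoothForm_apply_real hu (X := fun i y => part _ (f i) (Z i y)) fun i => ?_
  by_cases h : f i = 0
  · simp only [part, h, if_true]
    exact (hZ i).1
  · simp only [part, h, if_false]
    exact (hZ i).2

variable [T2Space M]

/-- A form is smooth if its values on smooth vector fields are smooth. -/
theorem smoothForm_of_apply {k : ℕ} {u : CForm E M k}
    (h : ∀ Z : Fin k → ∀ x : M, CTangent E x, (∀ i, SmoothField E M (Z i)) →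
      ∀ x, CSmoothAt (E := E) (fun y => u y (fun i => Z i y)) x) : u ∈ smoothForms E M k := by
  intro x₀ y hy
  refine ContDiffAt.contDiffWithinAt (contDiffAt_alternating_of_basis fun r => ?_)
  set φ := extChartAt 𝓘(ℝ, E) x₀ with hφ
  have hx := φ.map_target hy
  choose X hX1 hX2 using fun i => exists_coord_field x₀ hx (Module.finBasis ℝ E i)
  have h1 := h (fun i y => ofReal _ (X (r i) y)) (fun i x => fieldSmoothAt_ofReal (hX1 (r i) x))
    (φ.symm y)
  have hsymm : ContMDiffAt 𝓘(ℝ, E) 𝓘(ℝ, E) ∞ φ.symm y :=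
    (contMDiffOn_extChartAt_symm x₀).contMDiffAt ((isOpen_extChartAt_target x₀).mem_nhds hy)
  have h2 : ContMDiffAt 𝓘(ℝ, E) 𝓘(ℝ, ℂ) ∞
      (fun z => u (φ.symm z) (fun i => ofReal _ (X (r i) (φ.symm z)))) y :=
    ContMDiffAt.comp y h1 hsymm
  refine h2.contDiffAt.congr_of_eventuallyEq ?_
  have h3 : ∀ᶠ z in 𝓝 y, ∀ i, coordMap x₀ (φ.symm z) (X i (φ.symm z)) = Module.finBasis ℝ E i :=
    hsymm.continuousAt.eventually (Filter.eventually_all.2 hX2)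
  filter_upwards [h3, (isOpen_extChartAt_target x₀).mem_nhds hy] with z hz hzt
  have h4 := inChart_coordMap u x₀ hzt (fun i => X (r i) (φ.symm z))
  refine Eq.trans ?_ h4
  congr 1
  funext i
  exact (hz (r i)).symm

/-- The complex linear forms `α_x` on the spaces `ℂ ⊗ T_x M`, as a differential form. -/
def toForm (α : ∀ x : M, CTangent E x →ₗ[ℂ] ℂ) : CForm E M 1 :=
  fun x => AlternatingMap.ofSubsingleton ℂ _ _ 0 (α x)

variable (E M) in
/-- The complex linear forms `α_x` on the spaces `ℂ ⊗ T_x M` depend smoothly on `x`. -/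
def SmoothCov (α : ∀ x : M, CTangent E x →ₗ[ℂ] ℂ) : Prop :=
  ∀ Z, SmoothField E M Z → ∀ x, CSmoothAt (E := E) (fun y => α y (Z y)) x

theorem SmoothCov.toForm_mem {α : ∀ x : M, CTangent E x →ₗ[ℂ] ℂ} (hα : SmoothCov E M α) :
    toForm α ∈ smoothForms E M 1 :=
  smoothForm_of_apply fun Z hZ x => hα (Z 0) (hZ 0) x

theorem SmoothCov.apply {α : ∀ x : M, CTangent E x →ₗ[ℂ] ℂ} (hα : SmoothCov E M α)
    {Z : ∀ x : M, CTangent E x} {x : M} (hZ : FieldSmoothAt Z x) :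
    CSmoothAt (E := E) (fun y => α y (Z y)) x :=
  smoothForm_apply hα.toForm_mem (Z := fun _ => Z) fun _ => hZ

omit [T2Space M] in
theorem coordFun_injective {x₀ x : M} (hx : x ∈ (extChartAt 𝓘(ℝ, E) x₀).source) {z w : CTangent E x}
    (h : ∀ i, coordFun x₀ i x z = coordFun x₀ i x w) : z = w := by
  have hinj : Function.Injective (coordMap (E := E) x₀ x) :=
    (isInvertible_mfderiv_extChartAt (I := 𝓘(ℝ, E)) hx).injective
  have hre : rePart _ z = rePart _ w := by
    refine hinj ((Module.finBasis ℝ E).ext_elem fun i => ?_)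
    have := congrArg Complex.re (h i)
    rwa [coordFun, complexFun_re, complexFun_re] at this
  have him : imPart _ z = imPart _ w := by
    refine hinj ((Module.finBasis ℝ E).ext_elem fun i => ?_)
    have := congrArg Complex.im (h i)
    rwa [coordFun, complexFun_im, complexFun_im] at this
  rw [← re_add_I_smul_im z, ← re_add_I_smul_im w, hre, him]

/-- Near each point there is a coordinate frame of smooth vector fields `e i` on `M` with the dual
frame `ε i` of smooth linear forms on `M`. -/
theorem exists_frame_coframe (x₀ : M) :
    ∃ (e : Fin (Module.finrank ℝ E) → ∀ x : M, CTangent E x)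
      (ε : Fin (Module.finrank ℝ E) → ∀ x : M, CTangent E x →ₗ[ℂ] ℂ),
      (∀ i, SmoothField E M (e i)) ∧ (∀ i, SmoothCov E M (ε i)) ∧
      (∀ᶠ x in 𝓝 x₀, ∀ i, ε i x = coordFun x₀ i x) ∧
      ∀ᶠ x in 𝓝 x₀, ∀ v : CTangent E x, ∑ i, ε i x v • e i x = v := by
  have hx := mem_extChartAt_source (I := 𝓘(ℝ, E)) x₀
  have hs := (isOpen_extChartAt_source (I := 𝓘(ℝ, E)) x₀).mem_nhds hx
  choose X hX1 hX2 using fun i => exists_coord_field x₀ hx (Module.finBasis ℝ E i)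
  obtain ⟨ρ, h1, h2, h3⟩ := exists_cutoff (E := E) hs
  refine ⟨fun i y => ofReal _ (X i y), fun i y => (ρ y : ℂ) • coordFun x₀ i y,
    fun i x => fieldSmoothAt_ofReal (hX1 i x), fun i Z hZ x => ?_, ?_, ?_⟩
  · by_cases hxs : x ∈ (extChartAt 𝓘(ℝ, E) x₀).source
    · exact (h1 x).mul ((fieldSmoothAt_iff Z hxs).1 (hZ x) i)
    · have hx' : x ∉ tsupport ρ := fun h => hxs (h3 h)
      refine CSmoothAt.congr (CSmoothAt.const 0) ?_
      filter_upwards [notMem_tsupport_iff_eventuallyEq.1 hx'] with y hy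
      simp [hy]
  · filter_upwards [h2] with x hρ i
    simp [hρ]
  · filter_upwards [h2, hs, Filter.eventually_all.2 hX2] with x hρ hxs hX v
    simp only [hρ, Complex.ofReal_one, one_smul]
    refine coordFun_injective hxs fun j => ?_
    rw [map_sum, Finset.sum_eq_single j]
    · rw [map_smul]
      have : coordFun x₀ j x (ofReal _ (X j x)) = 1 := by
        rw [coordFun, complexFun_ofReal]
        simp [hX]
      rw [this]
      simp
    · intro i _ hij
      rw [map_smul]
      have : coordFun x₀ j x (ofReal _ (X i x)) = 0 := by
        rw [coordFun, complexFun_ofReal]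
        simp [hX, hij]
      rw [this]
      simp
    · simp

/-- Every complex tangent vector extends to a smooth vector field. -/
theorem exists_field_through (x₀ : M) (z : CTangent E x₀) :
    ∃ Z, SmoothField E M Z ∧ Z x₀ = z := by
  obtain ⟨e, ε, he, -, -, hs⟩ := exists_frame_coframe (E := E) x₀
  refine ⟨fun y => ∑ i, ε i x₀ z • e i y, fun x => ?_, hs.self_of_nhds z⟩
  exact FieldSmoothAt.sum _ fun i _ => (he i x).smul (CSmoothAt.const _)

/-! ### Operations on smooth forms -/

theorem smooth_wedgeOne {α : ∀ x : M, CTangent E x →ₗ[ℂ] ℂ} (hα : SmoothCov E M α) {k : ℕ}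
    {u : CForm E M k} (hu : u ∈ smoothForms E M k) :
    (fun x => wedgeOne (α x) (u x) : CForm E M (k + 1)) ∈ smoothForms E M (k + 1) := by
  refine smoothForm_of_apply fun Z hZ x => ?_
  simp only [wedgeOne_apply]
  exact CSmoothAt.sum _ fun i _ => (CSmoothAt.const _).mul ((hα _ (hZ i) x).mul
    (smoothForm_apply hu fun j => hZ _ x))

theorem smooth_wedgeTwo {B : ∀ x : M, CTangent E x →ₗ[ℂ] CTangent E x →ₗ[ℂ] ℂ}
    (hB : ∀ Z W, SmoothField E M Z → SmoothField E M W →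
      ∀ x, CSmoothAt (E := E) (fun y => B y (Z y) (W y)) x) {k : ℕ}
    {u : CForm E M k} (hu : u ∈ smoothForms E M k) :
    (fun x => wedgeTwo (B x) (u x) : CForm E M (k + 1 + 1)) ∈ smoothForms E M (k + 1 + 1) := by
  refine smoothForm_of_apply fun Z hZ x => ?_
  simp only [wedgeTwo_apply]
  refine CSmoothAt.sum _ fun i _ => (CSmoothAt.const _).mul (CSmoothAt.sum _ fun j _ =>
    (CSmoothAt.const _).mul ((hB _ _ (hZ i) (hZ _) x).mul (smoothForm_apply hu fun j => hZ _ x)))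

theorem smooth_curryLeft {W : ∀ x : M, CTangent E x} (hW : SmoothField E M W) {k : ℕ}
    {u : CForm E M (k + 1)} (hu : u ∈ smoothForms E M (k + 1)) :
    (fun x => (u x).curryLeft (W x) : CForm E M k) ∈ smoothForms E M k := by
  refine smoothForm_of_apply fun Z hZ x => ?_
  simp only [AlternatingMap.curryLeft_apply_apply]
  have := smoothForm_apply hu (x := x) (Z := Fin.cons W Z) (fun i => by
    refine Fin.cases ?_ (fun j => ?_) i
    · exact hW x
    · exact hZ j x)
  refine this.congr (Filter.Eventually.of_forall fun y => ?_)
  congr 1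
  funext i
  refine Fin.cases ?_ (fun j => ?_) i <;> rfl

variable (E M) in
/-- The endomorphisms `T x` of the spaces `ℂ ⊗ T_x M` preserve smooth vector fields. -/
def SmoothEnd (T : ∀ x : M, CTangent E x →ₗ[ℂ] CTangent E x) : Prop :=
  ∀ Z, SmoothField E M Z → SmoothField E M fun x => T x (Z x)

theorem smooth_compLinearMap {T : ∀ x : M, CTangent E x →ₗ[ℂ] CTangent E x} (hT : SmoothEnd E M T)
    {k : ℕ} {u : CForm E M k} (hu : u ∈ smoothForms E M k) :
    (fun x => (u x).compLinearMap (T x) : CForm E M k) ∈ smoothForms E M k := by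
  refine smoothForm_of_apply fun Z hZ x => ?_
  exact smoothForm_apply hu fun i => hT _ (hZ i) x

theorem smooth_component {ι : Type*} [Fintype ι] [DecidableEq ι]
    {P : ∀ x : M, ι → CTangent E x →ₗ[ℂ] CTangent E x} (hP : ∀ i, SmoothEnd E M fun x => P x i)
    (c : ι → ℕ) {k : ℕ} {u : CForm E M k} (hu : u ∈ smoothForms E M k) :
    (fun x => component (P x) c k (u x) : CForm E M k) ∈ smoothForms E M k := by
  refine smoothForm_of_apply fun Z hZ x => ?_
  simp only [component_apply]
  exact CSmoothAt.sum _ fun f _ => smoothForm_apply hu fun i => hP _ _ (hZ i) x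

end EvalSmooth

/-! ### The exterior derivative -/

section ExteriorDerivative

variable {E : Type*} [NormedAddCommGroup E] [NormedSpace ℝ E] [FiniteDimensional ℝ E]
variable {M : Type*} [TopologicalSpace M] [ChartedSpace E M]

theorem extD_apply_ofReal {k : ℕ} (u : CForm E M k) (x : M)
    (v : Fin (k + 1) → TangentSpace 𝓘(ℝ, E) x) :
    extD u x (fun i => ofReal _ (v i)) =
      extDeriv (inChart u x) (extChartAt 𝓘(ℝ, E) x x) (fun i => coordMap x x (v i)) := by
  rw [extD, complexify_ofReal]
  rfl

variable [IsManifold 𝓘(ℝ, E) ∞ M]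

theorem minSmoothness_two_le : minSmoothness ℝ 2 ≤ (∞ : WithTop ℕ∞) := by
  rw [minSmoothness_of_isRCLikeNormedField]
  exact WithTop.coe_le_coe.2 le_top

theorem contDiffAt_inChart {k : ℕ} {u : CForm E M k} (hu : u ∈ smoothForms E M k) (x₀ : M) {y : E}
    (hy : y ∈ (extChartAt 𝓘(ℝ, E) x₀).target) : ContDiffAt ℝ ∞ (inChart u x₀) y :=
  (hu x₀).contDiffAt ((isOpen_extChartAt_target x₀).mem_nhds hy)

/-- In each chart, the exterior derivative of a form on `M` is the exterior derivative of the
expression of the form. -/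
theorem inChart_extD {k : ℕ} {u : CForm E M k} (hu : u ∈ smoothForms E M k) (x₀ : M) {y : E}
    (hy : y ∈ (extChartAt 𝓘(ℝ, E) x₀).target) :
    inChart (extD u) x₀ y = extDeriv (inChart u x₀) y := by
  set φ := extChartAt 𝓘(ℝ, E) x₀ with hφ
  set x := φ.symm y with hx
  set ψ := extChartAt 𝓘(ℝ, E) x with hψ
  have hsymm : ∀ z ∈ φ.target, ContMDiffAt 𝓘(ℝ, E) 𝓘(ℝ, E) ∞ φ.symm z := fun z hz =>
    (contMDiffOn_extChartAt_symm x₀).contMDiffAt ((isOpen_extChartAt_target x₀).mem_nhds hz)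
  have hU : ∀ᶠ z in 𝓝 y, z ∈ φ.target ∧ φ.symm z ∈ ψ.source := by
    filter_upwards [(isOpen_extChartAt_target x₀).mem_nhds hy,
      (hsymm y hy).continuousAt.preimage_mem_nhds
        ((isOpen_extChartAt_source (I := 𝓘(ℝ, E)) x).mem_nhds (mem_extChartAt_source x))]
      with z h1 h2
    exact ⟨h1, h2⟩
  have hτ : ∀ z, z ∈ φ.target → φ.symm z ∈ ψ.source →
      coordMap x (φ.symm z) ∘L chartSymmDeriv x₀ z = fderiv ℝ (fun z => ψ (φ.symm z)) z := by
    intro z hz hz'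
    rw [← mfderiv_eq_fderiv]
    refine (mfderiv_comp (I' := 𝓘(ℝ, E)) z ?_ ((hsymm z hz).mdifferentiableAt (by simp))).symm
    exact mdifferentiableAt_extChartAt (by simpa [hψ] using hz')
  have hpull : ∀ z, z ∈ φ.target → φ.symm z ∈ ψ.source → inChart u x₀ z =
      (inChart u x (ψ (φ.symm z))).compContinuousLinearMap
        (fderiv ℝ (fun z => ψ (φ.symm z)) z) := by
    intro z hz hz'
    ext w
    rw [← hτ z hz hz']
    exact apply_eq_inChart u hz' (fun i => chartSymmDeriv x₀ z (w i))
  have hsm : ContDiffAt ℝ ∞ (fun z => ψ (φ.symm z)) y := by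
    have h1 : ContMDiffAt 𝓘(ℝ, E) 𝓘(ℝ, E) ∞ ψ (φ.symm y) := contMDiffAt_extChartAt
    exact (h1.comp y (hsymm y hy)).contDiffAt
  have hd : extDeriv (fun z => (inChart u x (ψ (φ.symm z))).compContinuousLinearMap
      (fderiv ℝ (fun z => ψ (φ.symm z)) z)) y = _ :=
    extDeriv_pullback (r := ∞) (differentiableAt_inChart u hu x) hsm minSmoothness_two_le
  have heq : inChart u x₀ =ᶠ[𝓝 y] fun z => (inChart u x (ψ (φ.symm z))).compContinuousLinearMap
      (fderiv ℝ (fun z => ψ (φ.symm z)) z) := by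
    filter_upwards [hU] with z hz
    exact hpull z hz.1 hz.2
  rw [heq.extDeriv_eq, hd, ← hτ y hy (mem_extChartAt_source x)]
  ext w
  exact extD_apply_ofReal u x (fun i => chartSymmDeriv x₀ y (w i))

theorem extD_mem {k : ℕ} {u : CForm E M k} (hu : u ∈ smoothForms E M k) :
    extD u ∈ smoothForms E M (k + 1) := by
  intro x₀
  have h : ContDiffOn ℝ ∞ (extDeriv (inChart u x₀)) (extChartAt 𝓘(ℝ, E) x₀).target := by
    intro y hy
    refine ContDiffAt.contDiffWithinAt ?_
    have h1 : ContDiffAt ℝ ∞ (fderiv ℝ (inChart u x₀)) y :=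
      (contDiffAt_inChart hu x₀ hy).fderiv_right (by simp)
    exact (ContinuousAlternatingMap.alternatizeUncurryFinCLM ℝ E ℂ).contDiff.contDiffAt.comp y h1
  exact h.congr fun y hy => inChart_extD hu x₀ hy

theorem extD_extD {k : ℕ} {u : CForm E M k} (hu : u ∈ smoothForms E M k) : extD (extD u) = 0 := by
  funext x
  refine form_ext_real fun v => ?_
  rw [extD_apply_ofReal]
  have h : inChart (extD u) x =ᶠ[𝓝 (extChartAt 𝓘(ℝ, E) x x)] extDeriv (inChart u x) := by
    filter_upwards [(isOpen_extChartAt_target (I := 𝓘(ℝ, E)) x).mem_nhds (mem_extChartAt_target x)]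
      with y hy
    exact inChart_extD hu x hy
  rw [h.extDeriv_eq, extDeriv_extDeriv_apply
    (contDiffAt_inChart hu x (mem_extChartAt_target x)) minSmoothness_two_le]
  rfl

theorem extD_congr {k : ℕ} {u w : CForm E M k} {x : M} (h : ∀ᶠ y in 𝓝 x, u y = w y) :
    extD u x = extD w x := by
  have hc : Filter.Tendsto (extChartAt 𝓘(ℝ, E) x).symm (𝓝 (extChartAt 𝓘(ℝ, E) x x)) (𝓝 x) := by
    simpa only [ContinuousAt, extChartAt_to_inv] using
      continuousAt_extChartAt_symm (I := 𝓘(ℝ, E)) x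
  have h1 : ∀ᶠ z in 𝓝 (extChartAt 𝓘(ℝ, E) x x), u ((extChartAt 𝓘(ℝ, E) x).symm z) =
      w ((extChartAt 𝓘(ℝ, E) x).symm z) := hc.eventually h
  have h2 : inChart u x =ᶠ[𝓝 (extChartAt 𝓘(ℝ, E) x x)] inChart w x := by
    filter_upwards [h1] with z hz
    rw [inChart, inChart, hz]
  rw [extD, extD, h2.extDeriv_eq]

theorem extD_add {k : ℕ} {u w : CForm E M k} (hu : u ∈ smoothForms E M k)
    (hw : w ∈ smoothForms E M k) : extD (u + w) = extD u + extD w :=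
  (d k).map_add ⟨u, hu⟩ ⟨w, hw⟩

theorem extD_smul {k : ℕ} (c : ℂ) {u : CForm E M k} (hu : u ∈ smoothForms E M k) :
    extD (c • u) = c • extD u :=
  (d k).map_smul c ⟨u, hu⟩

theorem extD_sub {k : ℕ} {u w : CForm E M k} (hu : u ∈ smoothForms E M k)
    (hw : w ∈ smoothForms E M k) : extD (u - w) = extD u - extD w :=
  (d k).map_sub ⟨u, hu⟩ ⟨w, hw⟩

theorem extD_zero {k : ℕ} : extD (0 : CForm E M k) = 0 :=
  (d k).map_zero

theorem extD_sum {k : ℕ} {ι : Type*} (s : Finset ι) {u : ι → CForm E M k}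
    (hu : ∀ i ∈ s, u i ∈ smoothForms E M k) : extD (∑ i ∈ s, u i) = ∑ i ∈ s, extD (u i) := by
  classical
  induction s using Finset.induction_on with
  | empty => simpa using extD_zero
  | insert i s hi ih =>
    have h2 : ∀ j ∈ s, u j ∈ smoothForms E M k := fun j hj => hu j (Finset.mem_insert_of_mem hj)
    rw [Finset.sum_insert hi, Finset.sum_insert hi,
      extD_add (hu i (Finset.mem_insert_self i s)) ((smoothForms E M k).sum_mem h2), ih h2]

/-! ### The Leibniz rule -/

/-- Exchanging the first two arguments of a doubly alternated expression changes its sign. -/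
theorem double_alternation_swap {V N : Type*} [AddCommGroup V] [Module ℝ V] [AddCommGroup N]
    [Module ℝ N] {k : ℕ} (f : V →ₗ[ℝ] V →ₗ[ℝ] V [⋀^Fin k]→ₗ[ℝ] N) (v : Fin (k + 1 + 1) → V) :
    ∑ i : Fin (k + 1 + 1), (-1 : ℤ) ^ (i : ℕ) • ∑ j : Fin (k + 1), (-1 : ℤ) ^ (j : ℕ) •
      f (v i) (i.removeNth v j) (j.removeNth (i.removeNth v)) =
    - ∑ i : Fin (k + 1 + 1), (-1 : ℤ) ^ (i : ℕ) • ∑ j : Fin (k + 1), (-1 : ℤ) ^ (j : ℕ) •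
      f (i.removeNth v j) (v i) (j.removeNth (i.removeNth v)) := by
  have h := AlternatingMap.alternatizeUncurryFin_alternatizeUncurryFinLM_comp_of_symmetric
    (f := f + f.flip) (by intro x y; simp [add_comm])
  have h2 := congrArg (fun g : V [⋀^Fin (k + 1 + 1)]→ₗ[ℝ] N => g v) h
  simp only [AlternatingMap.alternatizeUncurryFin_apply, LinearMap.comp_apply,
    AlternatingMap.alternatizeUncurryFinLM_apply, LinearMap.add_apply, LinearMap.flip_apply,
    AlternatingMap.add_apply, smul_add, Finset.sum_add_distrib, AlternatingMap.zero_apply] at h2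
  exact eq_neg_of_add_eq_zero_left h2

/-- The values of the exterior derivative of a 1-form, as a bilinear form. -/
def dBilin (α : ∀ x : M, CTangent E x →ₗ[ℂ] ℂ) (x : M) : CTangent E x →ₗ[ℂ] CTangent E x →ₗ[ℂ] ℂ :=
  LinearMap.mk₂ ℂ (fun v w => (((extD (toForm α) x).curryLeft v).curryLeft w) ![])
    (fun v v' w => by rw [map_add, AlternatingMap.curryLeft_add]; rfl)
    (fun c v w => by rw [map_smul, AlternatingMap.curryLeft_smul]; rfl)
    (fun v w w' => by rw [map_add]; rfl)
    (fun c v w => by rw [map_smul]; rfl)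

theorem dBilin_apply (α : ∀ x : M, CTangent E x →ₗ[ℂ] ℂ) (x : M) (v w : CTangent E x) :
    dBilin α x v w = extD (toForm α) x ![v, w] := rfl

theorem dBilin_swap (α : ∀ x : M, CTangent E x →ₗ[ℂ] ℂ) (x : M) (v w : CTangent E x) :
    dBilin α x v w = - dBilin α x w v := by
  rw [dBilin_apply, dBilin_apply, ← (extD (toForm α) x).map_swap _ (show (0 : Fin 2) ≠ 1 by simp)]
  congr 1
  funext i
  fin_cases i <;> simp

variable [T2Space M]

/-- The Leibniz rule `d(α ∧ u) = dα ∧ u - α ∧ du`. Both sides are doubled, since `wedgeTwo` of the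
alternating form `dα` is `2 dα ∧ u`. -/
theorem extD_wedgeOne {α : ∀ x : M, CTangent E x →ₗ[ℂ] ℂ} (hα : SmoothCov E M α) {k : ℕ}
    {u : CForm E M k} (hu : u ∈ smoothForms E M k) (x : M) :
    (2 : ℂ) • extD (fun y => wedgeOne (α y) (u y) : CForm E M (k + 1)) x =
      wedgeTwo (dBilin α x) (u x) - (2 : ℂ) • wedgeOne (α x) (extD u x) := by
  set y₀ := extChartAt 𝓘(ℝ, E) x x with hy₀
  set A := inChart (toForm α) x with hA
  set g := inChart u x with hg
  have hAd : DifferentiableAt ℝ A y₀ := differentiableAt_inChart _ hα.toForm_mem x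
  have hgd : DifferentiableAt ℝ g y₀ := differentiableAt_inChart _ hu x
  have hwd : DifferentiableAt ℝ (inChart (fun y => wedgeOne (α y) (u y) : CForm E M (k + 1)) x) y₀ :=
    differentiableAt_inChart _ (smooth_wedgeOne hα hu) x
  refine form_ext_real fun v => ?_
  have hA0 : ∀ w, α x (ofReal _ w) = A y₀ (fun _ => coordMap x x w) := fun w =>
    apply_eq_inChart (toForm α) (mem_extChartAt_source x) (fun _ => w)
  have hg0 : ∀ w : Fin k → TangentSpace 𝓘(ℝ, E) x,
      u x (fun i => ofReal _ (w i)) = g y₀ (fun i => coordMap x x (w i)) := fun w =>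
    apply_eq_inChart u (mem_extChartAt_source x) w
  set V : Fin (k + 1 + 1) → E := fun i => coordMap x x (v i) with hV
  -- the derivative of the product in the chart, with all the terms of both alternations
  have e1 : extD (fun y => wedgeOne (α y) (u y) : CForm E M (k + 1)) x (fun i => ofReal _ (v i)) =
      ∑ i : Fin (k + 1 + 1), (-1 : ℤ) ^ (i : ℕ) • ∑ j : Fin (k + 1), (-1 : ℤ) ^ (j : ℕ) •
        (fderiv ℝ A y₀ (V i) (fun _ => i.removeNth V j) * g y₀ (j.removeNth (i.removeNth V)) +
          A y₀ (fun _ => i.removeNth V j) * fderiv ℝ g y₀ (V i) (j.removeNth (i.removeNth V))) := by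
    rw [extD_apply_ofReal, extDeriv_apply hwd]
    refine Finset.sum_congr rfl fun i _ => ?_
    congr 1
    have hfun : (fun y => inChart (fun y => wedgeOne (α y) (u y) : CForm E M (k + 1)) x y
        (i.removeNth V)) = fun y => ∑ j : Fin (k + 1), (-1 : ℂ) ^ (j : ℕ) *
          (A y (fun _ => i.removeNth V j) * g y (j.removeNth (i.removeNth V))) := by
      funext y
      exact wedgeOne_apply _ _ _
    rw [hfun]
    have hterm : ∀ j : Fin (k + 1), HasFDerivAt (fun y => (-1 : ℂ) ^ (j : ℕ) *
          (A y (fun _ => i.removeNth V j) * g y (j.removeNth (i.removeNth V)))) _ y₀ := fun j =>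
      ((hAd.continuousAlternatingMap_apply_const (fun _ => i.removeNth V j)).hasFDerivAt.mul
        (hgd.continuousAlternatingMap_apply_const
          (j.removeNth (i.removeNth V))).hasFDerivAt).const_mul ((-1 : ℂ) ^ (j : ℕ))
    rw [(HasFDerivAt.fun_sum fun j _ => hterm j).fderiv]
    simp only [sum_apply, smul_apply,
      add_apply, fderiv_continuousAlternatingMap_apply_const_apply hAd,
      fderiv_continuousAlternatingMap_apply_const_apply hgd]
    refine Finset.sum_congr rfl fun j _ => ?_
    simp only [zsmul_eq_mul, smul_eq_mul]
    push_cast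
    ring
  have e2 : wedgeTwo (dBilin α x) (u x) (fun i => ofReal _ (v i)) =
      ∑ i : Fin (k + 1 + 1), (-1 : ℤ) ^ (i : ℕ) • ∑ j : Fin (k + 1), (-1 : ℤ) ^ (j : ℕ) •
        ((fderiv ℝ A y₀ (V i) (fun _ => i.removeNth V j) -
          fderiv ℝ A y₀ (i.removeNth V j) (fun _ => V i)) *
            g y₀ (j.removeNth (i.removeNth V))) := by
    rw [wedgeTwo_apply]
    refine Finset.sum_congr rfl fun i _ => ?_
    simp only [zsmul_eq_mul]
    push_cast
    congr 1
    refine Finset.sum_congr rfl fun j _ => ?_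
    congr 2
    · have h1 : ![ofReal _ (v i), i.removeNth (fun i => ofReal _ (v i)) j] =
          fun l => ofReal (TangentSpace 𝓘(ℝ, E) x) (![v i, i.removeNth v j] l) := by
        funext l
        fin_cases l <;> rfl
      rw [dBilin_apply, h1, extD_apply_ofReal, extDeriv_apply hAd, Fin.sum_univ_two]
      have h2 : ∀ w w' : E, (fderiv ℝ (fun y => A y (fun _ => w)) y₀) w' =
          fderiv ℝ A y₀ w' (fun _ => w) := fun w w' =>
        fderiv_continuousAlternatingMap_apply_const_apply hAd _ _
      have h3 : (0 : Fin 2).removeNth (fun l => coordMap x x (![v i, i.removeNth v j] l)) =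
          fun _ => i.removeNth V j := by
        funext l
        fin_cases l
        rfl
      have h4 : (1 : Fin 2).removeNth (fun l => coordMap x x (![v i, i.removeNth v j] l)) =
          fun _ => V i := by
        funext l
        fin_cases l
        rfl
      rw [h3, h4, h2, h2]
      simp [sub_eq_add_neg, hV]
      rfl
    · exact hg0 _
  have e3 : wedgeOne (α x) (extD u x) (fun i => ofReal _ (v i)) =
      ∑ i : Fin (k + 1 + 1), (-1 : ℤ) ^ (i : ℕ) • ∑ j : Fin (k + 1), (-1 : ℤ) ^ (j : ℕ) •
        (A y₀ (fun _ => V i) * fderiv ℝ g y₀ (i.removeNth V j) (j.removeNth (i.removeNth V))) := by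
    rw [wedgeOne_apply]
    refine Finset.sum_congr rfl fun i _ => ?_
    have h1 : extD u x (i.removeNth fun i => ofReal _ (v i)) =
        ∑ j : Fin (k + 1), (-1 : ℤ) ^ (j : ℕ) •
          fderiv ℝ g y₀ (i.removeNth V j) (j.removeNth (i.removeNth V)) := by
      refine (extD_apply_ofReal u x (i.removeNth v)).trans ?_
      refine (extDeriv_apply hgd _).trans (Finset.sum_congr rfl fun j _ => ?_)
      exact congrArg _ (fderiv_continuousAlternatingMap_apply_const_apply hgd _ _)
    have h2 : α x (ofReal _ (v i)) = A y₀ (fun _ => V i) := hA0 (v i)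
    rw [h1, h2]
    simp only [zsmul_eq_mul, Finset.mul_sum]
    push_cast
    exact Finset.sum_congr rfl fun j _ => by ring
  -- the terms of the two sides agree up to an exchange of the first two arguments, once for the terms
  -- that differentiate `A` and once for those that differentiate `g`
  let f₁ : E →ₗ[ℝ] E →ₗ[ℝ] E [⋀^Fin k]→ₗ[ℝ] ℂ := LinearMap.mk₂ ℝ
    (fun a b => (fderiv ℝ A y₀ a (fun _ => b)) • (g y₀).toAlternatingMap)
    (fun a a' b => by simp [add_smul])
    (fun c a b => by ext; simp [mul_assoc])
    (fun a b b' => by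
      have := ((AlternatingMap.ofSubsingleton ℝ E ℂ (0 : Fin 1)).symm
        (fderiv ℝ A y₀ a).toAlternatingMap).map_add b b'
      rw [← add_smul]
      exact congrArg (fun c : ℂ => c • (g y₀).toAlternatingMap) this)
    (fun c a b => by
      have := ((AlternatingMap.ofSubsingleton ℝ E ℂ (0 : Fin 1)).symm
        (fderiv ℝ A y₀ a).toAlternatingMap).map_smul c b
      rw [← smul_assoc]
      exact congrArg (fun c : ℂ => c • (g y₀).toAlternatingMap) this)
  let f₂ : E →ₗ[ℝ] E →ₗ[ℝ] E [⋀^Fin k]→ₗ[ℝ] ℂ := LinearMap.mk₂ ℝ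
    (fun a b => (A y₀ (fun _ => b)) • (fderiv ℝ g y₀ a).toAlternatingMap)
    (fun a a' b => by ext; simp)
    (fun c a b => by ext; simp [mul_left_comm])
    (fun a b b' => by
      have := ((AlternatingMap.ofSubsingleton ℝ E ℂ (0 : Fin 1)).symm
        (A y₀).toAlternatingMap).map_add b b'
      rw [← add_smul]
      exact congrArg (fun c : ℂ => c • (fderiv ℝ g y₀ a).toAlternatingMap) this)
    (fun c a b => by
      have := ((AlternatingMap.ofSubsingleton ℝ E ℂ (0 : Fin 1)).symm
        (A y₀).toAlternatingMap).map_smul c b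
      rw [← smul_assoc]
      exact congrArg (fun c : ℂ => c • (fderiv ℝ g y₀ a).toAlternatingMap) this)
  have s1 := double_alternation_swap f₁ V
  have s2 := double_alternation_swap f₂ V
  have f₁a : ∀ a b w, f₁ a b w = fderiv ℝ A y₀ a (fun _ => b) * g y₀ w := fun _ _ _ => rfl
  have f₂a : ∀ a b w, f₂ a b w = A y₀ (fun _ => b) * fderiv ℝ g y₀ a w := fun _ _ _ => rfl
  simp only [f₁a] at s1
  simp only [f₂a] at s2
  rw [AlternatingMap.smul_apply, AlternatingMap.sub_apply, AlternatingMap.smul_apply, e1, e2, e3]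
  simp only [sub_mul, smul_add, smul_sub, Finset.sum_add_distrib, Finset.sum_sub_distrib,
    smul_eq_mul]
  rw [s2]
  linear_combination s1

end ExteriorDerivative

/-! ### The exterior derivative of a 1-form and the Lie bracket -/

section OneForm

variable {E : Type*} [NormedAddCommGroup E] [NormedSpace ℝ E] [FiniteDimensional ℝ E]
variable {M : Type*} [TopologicalSpace M] [ChartedSpace E M] [IsManifold 𝓘(ℝ, E) ∞ M] [T2Space M]

/-- The derivative at `x` of the function `α(Y)` in the direction of the tangent vector `v`. -/
def derivCov (α : ∀ x : M, CTangent E x →ₗ[ℂ] ℂ) (Y : ∀ x : M, TangentSpace 𝓘(ℝ, E) x) (x : M)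
    (v : TangentSpace 𝓘(ℝ, E) x) : ℂ :=
  fderiv ℝ (fun y => α ((extChartAt 𝓘(ℝ, E) x).symm y)
    (ofReal _ (Y ((extChartAt 𝓘(ℝ, E) x).symm y)))) (extChartAt 𝓘(ℝ, E) x x) (coordMap x x v)

/-- The formula `dα(X, Y) = X(α(Y)) - Y(α(X)) - α([X, Y])` for real vector fields. -/
theorem dBilin_ofReal {α : ∀ x : M, CTangent E x →ₗ[ℂ] ℂ} (hα : SmoothCov E M α)
    {X Y : ∀ x : M, TangentSpace 𝓘(ℝ, E) x} {x : M} (hX : RealSmoothAt X x)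
    (hY : RealSmoothAt Y x) :
    dBilin α x (ofReal _ (X x)) (ofReal _ (Y x)) =
      derivCov α Y x (X x) - derivCov α X x (Y x) -
        α x (ofReal _ (mlieBracket 𝓘(ℝ, E) X Y x)) := by
  set φ := extChartAt 𝓘(ℝ, E) x with hφ
  set y₀ := φ x with hy₀
  have hy₀t : y₀ ∈ φ.target := mem_extChartAt_target x
  have ht : φ.target ∈ 𝓝 y₀ := (isOpen_extChartAt_target x).mem_nhds hy₀t
  set A := inChart (toForm α) x with hA
  have hAd : DifferentiableAt ℝ A y₀ := differentiableAt_inChart _ hα.toForm_mem x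
  -- the expressions of the fields in the chart
  let Q : (∀ x : M, TangentSpace 𝓘(ℝ, E) x) → E → E := fun X y => coordMap x (φ.symm y) (X (φ.symm y))
  have hQ : ∀ X : ∀ x : M, TangentSpace 𝓘(ℝ, E) x, RealSmoothAt X x →
      DifferentiableAt ℝ (Q X) y₀ := by
    intro X hX
    have h1 := (realSmoothAt_iff X (mem_extChartAt_source x)).1 hX
    have h2 : ContMDiffAt 𝓘(ℝ, E) 𝓘(ℝ, E) ∞ φ.symm y₀ :=
      (contMDiffOn_extChartAt_symm x).contMDiffAt ht
    have h3 : φ.symm y₀ = x := extChartAt_to_inv x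
    have h1' : ContMDiffAt 𝓘(ℝ, E) 𝓘(ℝ, E) ∞
        (fun y => (coordMap x y (X y) : E)) (φ.symm y₀) := by
      rw [h3]
      exact h1
    have h4 : ContMDiffAt 𝓘(ℝ, E) 𝓘(ℝ, E) ∞ (Q X) y₀ := ContMDiffAt.comp y₀ h1' h2
    exact h4.contDiffAt.differentiableAt (by simp)
  have hQ0 : ∀ X : ∀ x : M, TangentSpace 𝓘(ℝ, E) x, Q X y₀ = coordMap x x (X x) := by
    intro X
    have h3 : φ.symm y₀ = x := extChartAt_to_inv x
    change coordMap x (φ.symm y₀) (X (φ.symm y₀)) = _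
    rw [h3]
  have hAQ : ∀ X : ∀ x : M, TangentSpace 𝓘(ℝ, E) x, (fun y => A y (fun _ => Q X y)) =ᶠ[𝓝 y₀]
      fun y => α (φ.symm y) (ofReal _ (X (φ.symm y))) := by
    intro X
    filter_upwards [ht] with y hy
    exact inChart_coordMap (toForm α) x hy (fun _ => X (φ.symm y))
  -- the Lie bracket in the chart
  have hbr : coordMap x x (mlieBracket 𝓘(ℝ, E) X Y x) = lieBracket ℝ (Q X) (Q Y) y₀ := by
    have h1 : ∀ X : ∀ x : M, TangentSpace 𝓘(ℝ, E) x,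
        mpullbackWithin 𝓘(ℝ, E) 𝓘(ℝ, E) φ.symm X (Set.range 𝓘(ℝ, E)) =ᶠ[𝓝 y₀] Q X := by
      intro X
      filter_upwards [ht] with y hy
      rw [mpullbackWithin_apply]
      refine (isInvertible_mfderivWithin_extChartAt_symm (I := 𝓘(ℝ, E)) hy).inverse_apply_eq.2 ?_
      rw [ModelWithCorners.range_eq_univ, mfderivWithin_univ]
      exact (chartSymmDeriv_coordMap x hy (X (φ.symm y))).symm
    have h4 : mlieBracket 𝓘(ℝ, E) X Y x = (coordMap x x).inverse
        (lieBracketWithin ℝ (mpullbackWithin 𝓘(ℝ, E) 𝓘(ℝ, E) φ.symm X (Set.range 𝓘(ℝ, E)))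
          (mpullbackWithin 𝓘(ℝ, E) 𝓘(ℝ, E) φ.symm Y (Set.range 𝓘(ℝ, E)))
          (φ.symm ⁻¹' Set.univ ∩ Set.range 𝓘(ℝ, E)) y₀) := rfl
    have h5 : φ.symm ⁻¹' Set.univ ∩ Set.range 𝓘(ℝ, E) = Set.univ := by
      rw [ModelWithCorners.range_eq_univ]
      simp
    have h6 : (coordMap (E := E) x x).IsInvertible :=
      isInvertible_mfderiv_extChartAt (I := 𝓘(ℝ, E)) (mem_extChartAt_source x)
    have h7 : lieBracketWithin ℝ (mpullbackWithin 𝓘(ℝ, E) 𝓘(ℝ, E) φ.symm X (Set.range 𝓘(ℝ, E)))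
          (mpullbackWithin 𝓘(ℝ, E) 𝓘(ℝ, E) φ.symm Y (Set.range 𝓘(ℝ, E))) Set.univ y₀ =
          lieBracket ℝ (Q X) (Q Y) y₀ :=
      (congrFun lieBracketWithin_univ y₀).trans
        (Filter.EventuallyEq.lieBracket_vectorField_eq (h1 X) (h1 Y))
    rw [h4, h5, h7]
    exact h6.self_apply_inverse _
  have hvec : ![ofReal _ (X x), ofReal _ (Y x)] =
      fun l => ofReal (TangentSpace 𝓘(ℝ, E) x) (![X x, Y x] l) := by
    funext l
    fin_cases l <;> rfl
  rw [dBilin_apply, hvec, extD_apply_ofReal]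
  have hvec2 : (fun i => coordMap x x (![X x, Y x] i)) = fun i => (![Q X, Q Y] i) y₀ := by
    funext l
    fin_cases l
    · exact (hQ0 X).symm
    · exact (hQ0 Y).symm
  rw [hvec2]
  have hmain := extDeriv_apply_vectorField (x := y₀) (V := ![Q X, Q Y]) hAd (by
    intro i
    fin_cases i
    · exact hQ X hX
    · exact hQ Y hY)
  refine hmain.trans ?_
  have r0 : (fun y => A y ((0 : Fin 2).removeNth fun i => (![Q X, Q Y] i) y)) =
      fun y => A y (fun _ => Q Y y) := by
    funext y
    congr 1
    funext l
    fin_cases l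
    rfl
  have r1 : (fun y => A y ((1 : Fin 2).removeNth fun i => (![Q X, Q Y] i) y)) =
      fun y => A y (fun _ => Q X y) := by
    funext y
    congr 1
    funext l
    fin_cases l
    rfl
  have hlast : A y₀ (fun _ => lieBracket ℝ (Q X) (Q Y) y₀) =
      α x (ofReal _ (mlieBracket 𝓘(ℝ, E) X Y x)) := by
    rw [← hbr]
    exact (apply_eq_inChart (toForm α) (mem_extChartAt_source x)
      (fun _ => mlieBracket 𝓘(ℝ, E) X Y x)).symm
  rw [Fin.sum_univ_two, r0, r1, (hAQ X).fderiv_eq, (hAQ Y).fderiv_eq]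
  have hv0 : (![Q X, Q Y] 0) y₀ = coordMap x x (X x) := hQ0 X
  have hv1 : (![Q X, Q Y] 1) y₀ = coordMap x x (Y x) := hQ0 Y
  rw [hv0, hv1, ← hlast]
  have hb : ∀ w : Fin 0 → E, A y₀ (Matrix.vecCons (lieBracket ℝ (Q X) (Q Y) y₀) w) =
      A y₀ (fun _ => lieBracket ℝ (Q X) (Q Y) y₀) := by
    intro w
    congr 1
    funext l
    fin_cases l
    rfl
  have hsum : ∀ f : Fin 1 → Fin 1 → ℂ, ∑ i : Fin 1, ∑ j ≥ i, f i j = f 0 0 := by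
    intro f
    simp [Fin.default_eq_zero]
  rw [hsum]
  have hc : ∀ a b : ℂ, (-1 : ℤ) ^ ((0 : Fin 2) : ℕ) • a + (-1 : ℤ) ^ ((1 : Fin 2) : ℕ) • b = a - b := by
    intro a b
    simp [sub_eq_add_neg]
  have hc' : ∀ a : ℂ, (-1 : ℤ) ^ (((0 : Fin 1) : ℕ) + ((0 : Fin 1) : ℕ)) • a = a := by
    intro a
    simp
  rw [hc, hc']
  exact congrArg₂ (· - ·) rfl (hb _)

/-- If the 1-form `α` vanishes on the complex vector fields `Z` and `W`, then
`dα(Z, W) = -α([Z, W])`. -/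
theorem dBilin_eq_neg_bracket {α : ∀ x : M, CTangent E x →ₗ[ℂ] ℂ} (hα : SmoothCov E M α)
    {Z W : ∀ x : M, CTangent E x} {x : M} (hZ : FieldSmoothAt Z x) (hW : FieldSmoothAt W x)
    (hαZ : ∀ y, α y (Z y) = 0) (hαW : ∀ y, α y (W y) = 0) :
    dBilin α x (Z x) (W x) = - α x (cBracket Z W x) := by
  have key : ∀ Z : ∀ x : M, CTangent E x, FieldSmoothAt Z x → (∀ y, α y (Z y) = 0) →
      ∀ v, derivCov α (reField Z) x v = - Complex.I * derivCov α (imField Z) x v := by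
    intro Z hZ h0 v
    have h1 : ∀ y, α y (ofReal _ (reField Z y)) = -Complex.I * α y (ofReal _ (imField Z y)) := by
      intro y
      have hz : Z y = ofReal _ (reField Z y) + Complex.I • ofReal _ (imField Z y) :=
        (re_add_I_smul_im (Z y)).symm
      have := h0 y
      rw [hz, map_add, map_smul, smul_eq_mul] at this
      linear_combination this
    rw [derivCov, derivCov]
    simp only [h1]
    have hd := fderiv_const_smul_field (𝕜 := ℝ) (-Complex.I)
      (f := fun y => α ((extChartAt 𝓘(ℝ, E) x).symm y)
        (ofReal _ (imField Z ((extChartAt 𝓘(ℝ, E) x).symm y))))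
    exact congrArg (fun L => L (coordMap x x v)) (congrFun hd (extChartAt 𝓘(ℝ, E) x x))
  have e1 := dBilin_ofReal hα hZ.1 hW.1
  have e2 := dBilin_ofReal hα hZ.1 hW.2
  have e3 := dBilin_ofReal hα hZ.2 hW.1
  have e4 := dBilin_ofReal hα hZ.2 hW.2
  have hI : ∀ v : TangentSpace 𝓘(ℝ, E) x, Complex.I ⊗ₜ[ℝ] v = Complex.I • ofReal _ v := by
    intro v
    simp [ofReal, TensorProduct.smul_tmul']
  have h1 : ∀ v : TangentSpace 𝓘(ℝ, E) x, (1 : ℂ) ⊗ₜ[ℝ] v = ofReal _ v := fun _ => rfl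
  have hZx : Z x = ofReal _ (reField Z x) + Complex.I • ofReal _ (imField Z x) :=
    (re_add_I_smul_im (Z x)).symm
  have hWx : W x = ofReal _ (reField W x) + Complex.I • ofReal _ (imField W x) :=
    (re_add_I_smul_im (W x)).symm
  rw [cBracket, hI, h1, hZx, hWx]
  simp only [map_add, map_sub, map_smul, LinearMap.add_apply, LinearMap.smul_apply, smul_eq_mul]
  rw [e1, e2, e3, e4, key Z hZ hαZ, key Z hZ hαZ, key W hW hαW, key W hW hαW]
  have hII : Complex.I * Complex.I = -1 := Complex.I_mul_I
  linear_combination (-α x (ofReal _ (mlieBracket 𝓘(ℝ, E) (imField Z) (imField W) x))) * hII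

end OneForm

/-! ### Smoothness of coefficients -/

section Coefficients

variable {E : Type*} [NormedAddCommGroup E] [NormedSpace ℝ E] [FiniteDimensional ℝ E]
variable {M : Type*} [TopologicalSpace M] [ChartedSpace E M] [IsManifold 𝓘(ℝ, E) ∞ M] [T2Space M]

instance finiteDimensional_cTangent (x : M) : FiniteDimensional ℂ (CTangent E x) :=
  inferInstanceAs (FiniteDimensional ℂ (ℂ ⊗[ℝ] E))

theorem finrank_cTangent (x : M) : Module.finrank ℂ (CTangent E x) = Module.finrank ℝ E :=
  Module.finrank_baseChange (R := ℂ) (S := ℝ) (M' := E)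

/-- Every complex linear form on a complexified tangent space extends to a smooth linear form. -/
theorem exists_cov_through (x₀ : M) (l : CTangent E x₀ →ₗ[ℂ] ℂ) :
    ∃ α, SmoothCov E M α ∧ α x₀ = l := by
  obtain ⟨e, ε, -, hε, -, hs⟩ := exists_frame_coframe (E := E) x₀
  refine ⟨fun y => ∑ i, l (e i x₀) • ε i y, fun Z hZ x => ?_, ?_⟩
  · simp only [LinearMap.sum_apply, LinearMap.smul_apply, smul_eq_mul]
    exact CSmoothAt.sum _ fun i _ => (CSmoothAt.const _).mul (hε i Z hZ x)
  · refine LinearMap.ext fun v => ?_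
    conv_rhs => rw [← hs.self_of_nhds v]
    simp [mul_comm]

/-- The coefficients of a smooth vector field with respect to linearly independent smooth vector
fields are smooth. -/
theorem cSmoothAt_coeff {ι : Type*} [Fintype ι] {B : ι → ∀ x : M, CTangent E x} {x₀ : M}
    (hB : ∀ i, FieldSmoothAt (B i) x₀) (hli : LinearIndependent ℂ fun i => B i x₀)
    {W : ∀ x : M, CTangent E x} (hW : FieldSmoothAt W x₀) {c : M → ι → ℂ}
    (hc : ∀ᶠ y in 𝓝 x₀, ∑ i, c y i • B i y = W y) (i : ι) :
    CSmoothAt (E := E) (fun y => c y i) x₀ := by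
  classical
  obtain ⟨g, hg⟩ := (Fintype.linearCombination ℂ fun i => B i x₀).exists_leftInverse_of_injective
    (LinearMap.ker_eq_bot.2 (linearIndependent_iff_injective_fintypeLinearCombination.1 hli))
  choose η hη hηx using fun i => exists_cov_through x₀ (LinearMap.proj i ∘ₗ g)
  have hone : ∀ i j, η i x₀ (B j x₀) = (1 : Matrix ι ι ℂ) i j := by
    intro i j
    have h1 := LinearMap.congr_fun hg (Pi.single j 1)
    rw [LinearMap.comp_apply, Fintype.linearCombination_apply_single, one_smul] at h1
    rw [hηx, LinearMap.comp_apply, h1, LinearMap.proj_apply, LinearMap.id_apply, Matrix.one_apply,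
      Pi.single_apply]
  refine CSmoothAt.of_linear_system (A := fun y i j => η i y (B j y)) (b := fun y i => η i y (W y))
    (fun i j => (hη i).apply (hB j)) (fun i => (hη i).apply hW) ?_ ?_ i
  · rw [show (fun i j => η i x₀ (B j x₀)) = (1 : Matrix ι ι ℂ) from
      funext fun i => funext fun j => hone i j, Matrix.det_one]
    exact one_ne_zero
  · filter_upwards [hc] with y hy i
    rw [← hy, map_sum]
    simp [mul_comm]

end Coefficients

/-! ### The decomposition of the complexified tangent bundle -/

namespace Supplement

section Proj

variable {E : Type*} [NormedAddCommGroup E] [NormedSpace ℝ E]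
variable {M : Type*} [TopologicalSpace M] [ChartedSpace E M] [IsManifold 𝓘(ℝ, E) ∞ M]
variable {S : CRStructure E M} (X : Supplement S)

theorem proj₃_zero_mem (x : M) (v : CTangent E x) : X.proj₃ x 0 v ∈ X.line x :=
  Submodule.projection_apply_mem _ v

theorem proj₃_one_mem (x : M) (v : CTangent E x) : X.proj₃ x 1 v ∈ X.T10 x :=
  Submodule.projection_apply_mem _ v

theorem proj₃_two_mem (x : M) (v : CTangent E x) : X.proj₃ x 2 v ∈ X.T01 x :=
  Submodule.projection_apply_mem _ v

theorem proj₃_zero_eq_self {x : M} {v : CTangent E x} (h : v ∈ X.line x) : X.proj₃ x 0 v = v :=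
  Submodule.projection_apply_of_mem_left _ h

theorem proj₃_one_eq_self {x : M} {v : CTangent E x} (h : v ∈ X.T10 x) : X.proj₃ x 1 v = v :=
  Submodule.projection_apply_of_mem_left _ h

theorem proj₃_two_eq_self {x : M} {v : CTangent E x} (h : v ∈ X.T01 x) : X.proj₃ x 2 v = v :=
  Submodule.projection_apply_of_mem_left _ h

theorem proj₃_zero_eq_zero {x : M} {v : CTangent E x} (h : v ∈ X.T10 x ⊔ X.T01 x) :
    X.proj₃ x 0 v = 0 := (Submodule.projection_apply_eq_zero_iff _).2 h

theorem proj₃_one_eq_zero {x : M} {v : CTangent E x} (h : v ∈ X.T01 x ⊔ X.line x) :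
    X.proj₃ x 1 v = 0 := (Submodule.projection_apply_eq_zero_iff _).2 h

theorem proj₃_two_eq_zero {x : M} {v : CTangent E x} (h : v ∈ X.T10 x ⊔ X.line x) :
    X.proj₃ x 2 v = 0 := (Submodule.projection_apply_eq_zero_iff _).2 h

theorem proj₃_add (x : M) (v : CTangent E x) :
    X.proj₃ x 0 v + X.proj₃ x 1 v + X.proj₃ x 2 v = v := by
  have htop : v ∈ X.line x ⊔ (X.T10 x ⊔ X.T01 x) := by
    rw [(X.isCompl_line x).sup_eq_top]
    trivial
  obtain ⟨a, ha, w, hw, rfl⟩ := Submodule.mem_sup.1 htop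
  obtain ⟨b, hb, c, hc, rfl⟩ := Submodule.mem_sup.1 hw
  simp only [map_add]
  rw [X.proj₃_zero_eq_self ha, X.proj₃_one_eq_self hb, X.proj₃_two_eq_self hc,
    X.proj₃_zero_eq_zero (Submodule.mem_sup_left hb), X.proj₃_zero_eq_zero (Submodule.mem_sup_right hc),
    X.proj₃_one_eq_zero (Submodule.mem_sup_right ha), X.proj₃_one_eq_zero (Submodule.mem_sup_left hc),
    X.proj₃_two_eq_zero (Submodule.mem_sup_right ha), X.proj₃_two_eq_zero (Submodule.mem_sup_left hb)]
  abel

theorem isDecomposition_proj₃ (x : M) : IsDecomposition (X.proj₃ x) where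
  proj_self i v := by
    fin_cases i
    · exact X.proj₃_zero_eq_self (X.proj₃_zero_mem x v)
    · exact X.proj₃_one_eq_self (X.proj₃_one_mem x v)
    · exact X.proj₃_two_eq_self (X.proj₃_two_mem x v)
  proj_of_ne i j v h := by
    fin_cases i <;> fin_cases j
    · exact absurd rfl h
    · exact X.proj₃_zero_eq_zero (Submodule.mem_sup_left (X.proj₃_one_mem x v))
    · exact X.proj₃_zero_eq_zero (Submodule.mem_sup_right (X.proj₃_two_mem x v))
    · exact X.proj₃_one_eq_zero (Submodule.mem_sup_right (X.proj₃_zero_mem x v))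
    · exact absurd rfl h
    · exact X.proj₃_one_eq_zero (Submodule.mem_sup_left (X.proj₃_two_mem x v))
    · exact X.proj₃_two_eq_zero (Submodule.mem_sup_right (X.proj₃_zero_mem x v))
    · exact X.proj₃_two_eq_zero (Submodule.mem_sup_left (X.proj₃_one_mem x v))
    · exact absurd rfl h
  sum_proj v := by
    rw [Fin.sum_univ_three]
    exact X.proj₃_add x v

theorem proj₂_one (x : M) : X.proj₂ x 1 = X.proj₃ x 2 := rfl

theorem proj₂_zero_add (x : M) (v : CTangent E x) : X.proj₂ x 0 v + X.proj₂ x 1 v = v :=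
  Submodule.projection_add_projection_eq_self (X.isCompl_T01 x).symm v

theorem proj₂_zero (x : M) (v : CTangent E x) : X.proj₂ x 0 v = X.proj₃ x 0 v + X.proj₃ x 1 v := by
  have h1 := X.proj₂_zero_add x v
  have h2 := X.proj₃_add x v
  rw [proj₂_one] at h1
  exact add_right_cancel (h1.trans h2.symm)

theorem isDecomposition_proj₂ (x : M) : IsDecomposition (X.proj₂ x) where
  proj_self i v := by
    fin_cases i
    · exact Submodule.projection_apply_of_mem_left _ (Submodule.projection_apply_mem _ v)
    · exact X.proj₃_two_eq_self (X.proj₃_two_mem x v)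
  proj_of_ne i j v h := by
    fin_cases i <;> fin_cases j
    · exact absurd rfl h
    · exact (Submodule.projection_apply_eq_zero_iff _).2 (X.proj₃_two_mem x v)
    · exact (Submodule.projection_apply_eq_zero_iff _).2 (Submodule.projection_apply_mem _ v)
    · exact absurd rfl h
  sum_proj v := by
    rw [Fin.sum_univ_two]
    exact X.proj₂_zero_add x v

theorem ξ_ne_zero (x : M) : X.ξ x ≠ 0 := fun h => X.not_mem x (h ▸ Submodule.zero_mem _)

theorem ξ_mem_line (x : M) : X.ξ x ∈ X.line x := Submodule.mem_span_singleton_self _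

/-- The linear form `θ` with `θ(ξ) = 1` that vanishes on `⁰T' + ⁰T''`. -/
def theta (x : M) : CTangent E x →ₗ[ℂ] ℂ :=
  (LinearEquiv.toSpanNonzeroSingleton ℂ _ (X.ξ x) (X.ξ_ne_zero x)).symm.toLinearMap ∘ₗ
    (X.proj₃ x 0).codRestrict (X.line x) (X.proj₃_zero_mem x)

theorem theta_smul (x : M) (v : CTangent E x) : X.theta x v • X.ξ x = X.proj₃ x 0 v :=
  LinearEquiv.toSpanNonzeroSingleton_symm_apply_smul ℂ _ (X.ξ x) (X.ξ_ne_zero x)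
    ⟨X.proj₃ x 0 v, X.proj₃_zero_mem x v⟩

theorem theta_eq_zero_iff (x : M) (v : CTangent E x) : X.theta x v = 0 ↔ X.proj₃ x 0 v = 0 := by
  rw [← theta_smul, smul_eq_zero, or_iff_left (X.ξ_ne_zero x)]

theorem theta_ξ (x : M) : X.theta x (X.ξ x) = 1 := by
  have h := X.theta_smul x (X.ξ x)
  rw [X.proj₃_zero_eq_self (X.ξ_mem_line x)] at h
  exact smul_left_injective ℂ (X.ξ_ne_zero x) (h.trans (one_smul ℂ _).symm)

/-- The projection onto `⁰T' + ⁰T''` along `ξ`. -/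
def hor (x : M) : CTangent E x →ₗ[ℂ] CTangent E x := LinearMap.id - X.proj₃ x 0

theorem hor_apply (x : M) (v : CTangent E x) : X.hor x v = v - X.theta x v • X.ξ x := by
  rw [theta_smul]
  rfl

theorem hor_eq_add (x : M) (v : CTangent E x) : X.hor x v = X.proj₃ x 1 v + X.proj₃ x 2 v := by
  have h := X.proj₃_add x v
  change v - X.proj₃ x 0 v = _
  rw [sub_eq_iff_eq_add]
  conv_lhs => rw [← h]
  abel

theorem theta_hor (x : M) (v : CTangent E x) : X.theta x (X.hor x v) = 0 := by
  rw [hor_apply, map_sub, map_smul, theta_ξ, smul_eq_mul, mul_one, sub_self]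

theorem hor_ξ (x : M) : X.hor x (X.ξ x) = 0 := by
  rw [hor_apply, theta_ξ, one_smul, sub_self]

theorem hor_of_theta_eq_zero {x : M} {v : CTangent E x} (h : X.theta x v = 0) : X.hor x v = v := by
  rw [hor_apply, h, zero_smul, sub_zero]

theorem hor_hor (x : M) (v : CTangent E x) : X.hor x (X.hor x v) = X.hor x v :=
  X.hor_of_theta_eq_zero (X.theta_hor x v)

theorem theta_of_mem_T10 {x : M} {v : CTangent E x} (h : v ∈ X.T10 x) : X.theta x v = 0 :=
  (X.theta_eq_zero_iff x v).2 (X.proj₃_zero_eq_zero (Submodule.mem_sup_left h))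

theorem theta_of_mem_T01 {x : M} {v : CTangent E x} (h : v ∈ X.T01 x) : X.theta x v = 0 :=
  (X.theta_eq_zero_iff x v).2 (X.proj₃_zero_eq_zero (Submodule.mem_sup_right h))

theorem conj_mem_T10 {x : M} {v : CTangent E x} (h : v ∈ X.T01 x) : conj _ v ∈ X.T10 x := by
  rw [T10, mem_conjSubmodule, conj_conj]
  exact h

theorem conj_mem_T01 {x : M} {v : CTangent E x} (h : v ∈ X.T10 x) : conj _ v ∈ X.T01 x := h

end Proj

section SmoothProj

variable {E : Type*} [NormedAddCommGroup E] [NormedSpace ℝ E] [FiniteDimensional ℝ E]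
variable {M : Type*} [TopologicalSpace M] [ChartedSpace E M] [IsManifold 𝓘(ℝ, E) ∞ M] [T2Space M]
variable {S : CRStructure E M} (X : Supplement S)

omit [T2Space M] in
theorem smoothField_ξ : SmoothField E M X.ξ := (smoothFieldOn_univ_iff _).1 X.smooth

/-- The parts in `⁰T'` and in `⁰T''` and the `ξ`-coefficient of a smooth vector field are smooth: they
are read off from its coefficients, which are smooth, in the local frame that consists of a frame of
`⁰T''`, of its conjugate, and of `ξ`. -/
theorem exists_smooth_coeff {W : ∀ x : M, CTangent E x} (x₀ : M) (hW : FieldSmoothAt W x₀) :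
    FieldSmoothAt (fun x => X.proj₃ x 1 (W x)) x₀ ∧ FieldSmoothAt (fun x => X.proj₃ x 2 (W x)) x₀ ∧
      CSmoothAt (E := E) (fun x => X.theta x (W x)) x₀ := by
  classical
  obtain ⟨U, hU, hx, r, Z, hZ, hZU⟩ := S.exists_frame x₀
  have hsp : ∀ y : M, y ∈ U → ∀ v ∈ X.T01 y, ∃ c : Fin r → ℂ, ∑ i, c i • Z i y = v := by
    intro y hy v hv
    rw [T01, ← (hZU y hy).2] at hv
    exact (Submodule.mem_span_range_iff_exists_fun ℂ).1 hv
  have ha : ∀ y : M, ∃ c : Fin r → ℂ, y ∈ U → ∑ i, c i • Z i y = X.proj₃ y 2 (W y) := by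
    intro y
    by_cases hy : y ∈ U
    · obtain ⟨c, hc⟩ := hsp y hy _ (X.proj₃_two_mem y (W y))
      exact ⟨c, fun _ => hc⟩
    · exact ⟨0, fun h => absurd h hy⟩
  have hb : ∀ y : M, ∃ c : Fin r → ℂ, y ∈ U →
      ∑ i, c i • conjField (Z i) y = X.proj₃ y 1 (W y) := by
    intro y
    by_cases hy : y ∈ U
    · obtain ⟨c, hc⟩ := hsp y hy _ (X.conj_mem_T01 (X.proj₃_one_mem y (W y)))
      refine ⟨fun i => (starRingEnd ℂ) (c i), fun _ => ?_⟩
      have := congrArg (conj _) hc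
      rw [conj_conj, map_sum] at this
      simp only [map_smulₛₗ] at this
      exact this
    · exact ⟨0, fun h => absurd h hy⟩
  choose a ha using ha
  choose b hb using hb
  let B : (Fin r ⊕ Fin r) ⊕ Unit → ∀ x : M, CTangent E x :=
    Sum.elim (Sum.elim Z fun i => conjField (Z i)) fun _ => X.ξ
  have hZs : ∀ i, FieldSmoothAt (Z i) x₀ := fun i => (hZ i).fieldSmoothAt hU hx
  have hBs : ∀ i, FieldSmoothAt (B i) x₀ := by
    rintro ((i | i) | i)
    · exact hZs i
    · exact (hZs i).conj
    · exact X.smoothField_ξ x₀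
  have hmem : ∀ i, Z i x₀ ∈ X.T01 x₀ := by
    intro i
    rw [T01, ← (hZU x₀ hx).2]
    exact Submodule.subset_span ⟨i, rfl⟩
  have hli : LinearIndependent ℂ fun i => B i x₀ := by
    rw [Fintype.linearIndependent_iff]
    intro g hg
    rw [Fintype.sum_sum_type, Fintype.sum_sum_type, Fintype.sum_unique (ι := Unit)] at hg
    have m2 : ∑ i, g (Sum.inl (Sum.inl i)) • Z i x₀ ∈ X.T01 x₀ :=
      Submodule.sum_mem _ fun i _ => Submodule.smul_mem _ _ (hmem i)
    have m1 : ∑ i, g (Sum.inl (Sum.inr i)) • conjField (Z i) x₀ ∈ X.T10 x₀ :=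
      Submodule.sum_mem _ fun i _ => Submodule.smul_mem _ _ (X.conj_mem_T10 (hmem i))
    have m0 : g (Sum.inr default) • X.ξ x₀ ∈ X.line x₀ :=
      Submodule.smul_mem _ _ (X.ξ_mem_line x₀)
    change ∑ i, g (Sum.inl (Sum.inl i)) • Z i x₀ +
      ∑ i, g (Sum.inl (Sum.inr i)) • conjField (Z i) x₀ + g (Sum.inr default) • X.ξ x₀ = 0 at hg
    have h0 := congrArg (X.proj₃ x₀ 0) hg
    have h1 := congrArg (X.proj₃ x₀ 1) hg
    have h2 := congrArg (X.proj₃ x₀ 2) hg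
    rw [map_add, map_add, map_zero, X.proj₃_zero_eq_zero (Submodule.mem_sup_right m2),
      X.proj₃_zero_eq_zero (Submodule.mem_sup_left m1), X.proj₃_zero_eq_self m0, zero_add,
      zero_add, smul_eq_zero, or_iff_left (X.ξ_ne_zero x₀)] at h0
    rw [map_add, map_add, map_zero, X.proj₃_one_eq_zero (Submodule.mem_sup_left m2),
      X.proj₃_one_eq_self m1, X.proj₃_one_eq_zero (Submodule.mem_sup_right m0), zero_add,
      add_zero] at h1
    rw [map_add, map_add, map_zero, X.proj₃_two_eq_self m2,
      X.proj₃_two_eq_zero (Submodule.mem_sup_left m1),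
      X.proj₃_two_eq_zero (Submodule.mem_sup_right m0), add_zero, add_zero] at h2
    have h1' := congrArg (conj _) h1
    rw [map_sum, map_zero] at h1'
    simp only [map_smulₛₗ, conjField, conj_conj] at h1'
    have hli0 := Fintype.linearIndependent_iff.1 (hZU x₀ hx).1
    rintro ((i | i) | i)
    · exact hli0 _ h2 i
    · have := hli0 _ h1' i
      simpa using this
    · exact h0
  have hco := cSmoothAt_coeff hBs hli hW
    (c := fun y => Sum.elim (Sum.elim (a y) (b y)) fun _ => X.theta y (W y)) (by
      filter_upwards [hU.mem_nhds hx] with y hy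
      rw [Fintype.sum_sum_type, Fintype.sum_sum_type, Fintype.sum_unique (ι := Unit)]
      change ∑ i, a y i • Z i y + ∑ i, b y i • conjField (Z i) y + X.theta y (W y) • X.ξ y = W y
      rw [ha y hy, hb y hy, theta_smul]
      conv_rhs => rw [← X.proj₃_add y (W y)]
      abel)
  refine ⟨?_, ?_, hco (Sum.inr ())⟩
  · refine (FieldSmoothAt.sum Finset.univ fun i _ =>
      FieldSmoothAt.smul (hco (Sum.inl (Sum.inr i))) (hZs i).conj).congr ?_
    filter_upwards [hU.mem_nhds hx] with y hy
    exact (hb y hy).symm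
  · refine (FieldSmoothAt.sum Finset.univ fun i _ =>
      FieldSmoothAt.smul (hco (Sum.inl (Sum.inl i))) (hZs i)).congr ?_
    filter_upwards [hU.mem_nhds hx] with y hy
    exact (ha y hy).symm

theorem smoothCov_theta : SmoothCov E M X.theta := fun _ hZ x => (X.exists_smooth_coeff x (hZ x)).2.2

theorem smoothEnd_proj₃ (i : Fin 3) : SmoothEnd E M fun x => X.proj₃ x i := by
  intro Z hZ x
  fin_cases i
  · have h := FieldSmoothAt.smul (X.exists_smooth_coeff x (hZ x)).2.2 (X.smoothField_ξ x)
    simp only [theta_smul] at h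
    exact h
  · exact (X.exists_smooth_coeff x (hZ x)).1
  · exact (X.exists_smooth_coeff x (hZ x)).2.1

theorem smoothEnd_proj₂ (i : Fin 2) : SmoothEnd E M fun x => X.proj₂ x i := by
  intro Z hZ x
  fin_cases i
  · have h := (X.smoothEnd_proj₃ 0 Z hZ x).add (X.smoothEnd_proj₃ 1 Z hZ x)
    simp only [← proj₂_zero] at h
    exact h
  · exact X.smoothEnd_proj₃ 2 Z hZ x

theorem smoothEnd_hor : SmoothEnd E M X.hor := fun Z hZ x =>
  (hZ x).sub (X.smoothEnd_proj₃ 0 Z hZ x)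

end SmoothProj

end Supplement

/-! ### The 2-form `dθ` and the Levi form -/

section Bracket

variable {E : Type*} [NormedAddCommGroup E] [NormedSpace ℝ E] [FiniteDimensional ℝ E]
variable {M : Type*} [TopologicalSpace M] [ChartedSpace E M] [IsManifold 𝓘(ℝ, E) ∞ M]

theorem cBracket_conjField {Z W : ∀ x : M, CTangent E x} {x : M} (hZ : FieldSmoothAt Z x)
    (hW : FieldSmoothAt W x) :
    cBracket (conjField Z) (conjField W) x = conj _ (cBracket Z W x) := by
  have h1 : ∀ Z : ∀ x : M, CTangent E x, reField (conjField Z) = reField Z := fun Z =>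
    funext fun y => rePart_conj (Z y)
  have h2 : ∀ Z : ∀ x : M, CTangent E x, imField (conjField Z) = (-1 : ℝ) • imField Z := by
    intro Z
    funext y
    change imPart _ (conj _ (Z y)) = (-1 : ℝ) • imPart _ (Z y)
    rw [imPart_conj, neg_one_smul]
  have d1 := hZ.2.mdifferentiableAt (by simp)
  have d2 := hW.2.mdifferentiableAt (by simp)
  rw [cBracket, cBracket, h1, h1, h2, h2, mlieBracket_const_smul_left d1,
    mlieBracket_const_smul_left d1, mlieBracket_const_smul_right d2,
    mlieBracket_const_smul_right d2, map_add, conj_tmul, conj_tmul, map_one, Complex.conj_I]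
  simp only [neg_one_smul, neg_neg, TensorProduct.neg_tmul, TensorProduct.tmul_add,
    TensorProduct.tmul_neg]

end Bracket

namespace Supplement

section Levi

variable {E : Type*} [NormedAddCommGroup E] [NormedSpace ℝ E] [FiniteDimensional ℝ E]
variable {M : Type*} [TopologicalSpace M] [ChartedSpace E M] [IsManifold 𝓘(ℝ, E) ∞ M] [T2Space M]
variable {S : CRStructure E M} (X : Supplement S)

theorem exists_field_T01 {x : M} {z : CTangent E x} (hz : z ∈ X.T01 x) :
    ∃ Z, SmoothField E M Z ∧ (∀ y, Z y ∈ X.T01 y) ∧ Z x = z := by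
  obtain ⟨Z, hZ, hZx⟩ := exists_field_through x z
  exact ⟨_, X.smoothEnd_proj₃ 2 Z hZ, fun y => X.proj₃_two_mem y _, by
    rw [hZx]; exact X.proj₃_two_eq_self hz⟩

theorem exists_field_T10 {x : M} {z : CTangent E x} (hz : z ∈ X.T10 x) :
    ∃ Z, SmoothField E M Z ∧ (∀ y, Z y ∈ X.T10 y) ∧ Z x = z := by
  obtain ⟨Z, hZ, hZx⟩ := exists_field_through x z
  exact ⟨_, X.smoothEnd_proj₃ 1 Z hZ, fun y => X.proj₃_one_mem y _, by
    rw [hZx]; exact X.proj₃_one_eq_self hz⟩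

/-- By involutivity of `⁰T''`, the exterior derivative of a 1-form that vanishes on `⁰T''` vanishes on
pairs of vectors of `⁰T''`. -/
theorem dBilin_eq_zero_of_mem_T01 {α : ∀ x : M, CTangent E x →ₗ[ℂ] ℂ} (hα : SmoothCov E M α)
    (h0 : ∀ x, ∀ z ∈ X.T01 x, α x z = 0) {x : M} {z w : CTangent E x} (hz : z ∈ X.T01 x)
    (hw : w ∈ X.T01 x) : dBilin α x z w = 0 := by
  obtain ⟨Z, hZ, hZ1, rfl⟩ := X.exists_field_T01 hz
  obtain ⟨W, hW, hW1, rfl⟩ := X.exists_field_T01 hw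
  rw [dBilin_eq_neg_bracket hα (hZ x) (hW x) (fun y => h0 y _ (hZ1 y)) (fun y => h0 y _ (hW1 y)),
    h0 x _ (S.bracket_mem Z W ((smoothFieldOn_univ_iff _).2 hZ) ((smoothFieldOn_univ_iff _).2 hW)
      hZ1 hW1 x), neg_zero]

theorem dBilin_theta_T01 {x : M} {z w : CTangent E x} (hz : z ∈ X.T01 x) (hw : w ∈ X.T01 x) :
    dBilin X.theta x z w = 0 :=
  X.dBilin_eq_zero_of_mem_T01 X.smoothCov_theta (fun _ _ h => X.theta_of_mem_T01 h) hz hw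

theorem dBilin_theta_T10 {x : M} {z w : CTangent E x} (hz : z ∈ X.T10 x) (hw : w ∈ X.T10 x) :
    dBilin X.theta x z w = 0 := by
  obtain ⟨Z, hZ, hZ1, rfl⟩ := X.exists_field_T10 hz
  obtain ⟨W, hW, hW1, rfl⟩ := X.exists_field_T10 hw
  have hb : cBracket Z W x ∈ X.T10 x := by
    rw [T10, mem_conjSubmodule, ← cBracket_conjField (hZ x) (hW x)]
    exact S.bracket_mem _ _ ((smoothFieldOn_univ_iff _).2 fun y => (hZ y).conj)
      ((smoothFieldOn_univ_iff _).2 fun y => (hW y).conj) hZ1 hW1 x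
  rw [dBilin_eq_neg_bracket X.smoothCov_theta (hZ x) (hW x)
    (fun y => X.theta_of_mem_T10 (hZ1 y)) (fun y => X.theta_of_mem_T10 (hW1 y)),
    X.theta_of_mem_T10 hb, neg_zero]

variable {X} in
/-- On `⁰T''` the hermitian form `dθ(Z, conj Z)` is a non-zero multiple of the Levi form. -/
theorem StronglyPseudoconvex.dBilin_theta_ne_zero (hX : X.StronglyPseudoconvex) {x : M}
    {z : CTangent E x} (hz : z ∈ X.T01 x) (h0 : z ≠ 0) : dBilin X.theta x z (conj _ z) ≠ 0 := by
  obtain ⟨Z, hZ, hZ1, rfl⟩ := X.exists_field_T01 hz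
  have hl : ∃ t : ℝ, t ≠ 0 ∧ X.levi Z Z x = (t : ℂ) • X.ξ x := by
    rcases hX x with h | h
    · obtain ⟨t, ht, h⟩ := h Z ((smoothFieldOn_univ_iff _).2 hZ) hZ1 h0
      exact ⟨t, ht.ne', h⟩
    · obtain ⟨t, ht, h⟩ := h Z ((smoothFieldOn_univ_iff _).2 hZ) hZ1 h0
      exact ⟨t, ht.ne, h⟩
  obtain ⟨t, ht, h⟩ := hl
  have h1 := dBilin_eq_neg_bracket X.smoothCov_theta (hZ x) (hZ x).conj
    (fun y => X.theta_of_mem_T01 (hZ1 y)) (fun y => X.theta_of_mem_T10 (X.conj_mem_T10 (hZ1 y)))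
  intro h2
  have h3 : X.theta x (cBracket Z (conjField Z) x) = 0 := by
    rw [← neg_eq_zero, ← h1]
    exact h2
  rw [levi, ← theta_smul, map_smul, h3, smul_zero, zero_smul] at h
  have := smul_eq_zero.1 h.symm
  rcases this with h4 | h4
  · exact ht (by exact_mod_cast h4)
  · exact X.ξ_ne_zero x h4

/-- The horizontal part `dθ(H·, H·)` of `dθ`. -/
def dthetaHor (x : M) : CTangent E x →ₗ[ℂ] CTangent E x →ₗ[ℂ] ℂ :=
  (dBilin X.theta x).compl₁₂ (X.hor x) (X.hor x)

theorem dthetaHor_apply (x : M) (z w : CTangent E x) :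
    X.dthetaHor x z w = dBilin X.theta x (X.hor x z) (X.hor x w) := rfl

theorem dthetaHor_swap (x : M) (z w : CTangent E x) : X.dthetaHor x z w = - X.dthetaHor x w z := by
  rw [dthetaHor_apply, dthetaHor_apply]
  exact dBilin_swap _ _ _ _

theorem dthetaHor_hor_left (x : M) (z w : CTangent E x) :
    X.dthetaHor x (X.hor x z) w = X.dthetaHor x z w := by
  rw [dthetaHor_apply, hor_hor]
  rfl

theorem dthetaHor_hor_right (x : M) (z w : CTangent E x) :
    X.dthetaHor x z (X.hor x w) = X.dthetaHor x z w := by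
  rw [dthetaHor_apply, hor_hor]
  rfl

theorem dthetaHor_compl₁₂ (x : M) :
    (X.dthetaHor x).compl₁₂ (X.hor x) (X.hor x) = X.dthetaHor x := by
  refine LinearMap.ext fun z => LinearMap.ext fun w => ?_
  change X.dthetaHor x (X.hor x z) (X.hor x w) = _
  rw [dthetaHor_hor_left, dthetaHor_hor_right]

theorem smooth_dthetaHor {Z W : ∀ x : M, CTangent E x} (hZ : SmoothField E M Z)
    (hW : SmoothField E M W) (x : M) :
    CSmoothAt (E := E) (fun y => X.dthetaHor y (Z y) (W y)) x := by
  refine (smoothForm_apply (extD_mem X.smoothCov_theta.toForm_mem) (x := x)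
    (Z := ![fun y => X.hor y (Z y), fun y => X.hor y (W y)]) fun i => ?_).congr
      (Filter.Eventually.of_forall fun y => ?_)
  · fin_cases i
    · exact X.smoothEnd_hor Z hZ x
    · exact X.smoothEnd_hor W hW x
  · rw [dthetaHor_apply, dBilin_apply]
    congr 1
    funext i
    fin_cases i <;> rfl

variable {X} in
/-- `dθ` is non-degenerate on horizontal vectors: as it has type `(1, 1)`, the `⁰T''`-part `b` and the
`⁰T'`-part `a` of a vector are detected by pairing it with `conj b` and with `conj a`. -/
theorem StronglyPseudoconvex.dthetaHor_nondegenerate (hX : X.StronglyPseudoconvex) {x : M}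
    {w : CTangent E x} (hw : X.theta x w = 0) (h : ∀ z, X.dthetaHor x w z = 0) : w = 0 := by
  have ha := X.proj₃_one_mem x w
  have hb := X.proj₃_two_mem x w
  set a := X.proj₃ x 1 w
  set b := X.proj₃ x 2 w
  have hwab : w = a + b := by rw [← X.hor_eq_add, X.hor_of_theta_eq_zero hw]
  have key : ∀ z, X.theta x z = 0 → dBilin X.theta x a z + dBilin X.theta x b z = 0 := by
    intro z hz
    have h1 := h z
    rwa [dthetaHor_apply, X.hor_of_theta_eq_zero hw, X.hor_of_theta_eq_zero hz, hwab, map_add,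
      LinearMap.add_apply] at h1
  have hb0 : b = 0 := by
    by_contra hb0
    have h1 := key _ (X.theta_of_mem_T10 (X.conj_mem_T10 hb))
    rw [X.dBilin_theta_T10 ha (X.conj_mem_T10 hb), zero_add] at h1
    exact hX.dBilin_theta_ne_zero hb hb0 h1
  have ha0 : a = 0 := by
    by_contra ha0
    have hc := X.conj_mem_T01 ha
    have h1 := key _ (X.theta_of_mem_T01 hc)
    rw [hb0, map_zero, LinearMap.zero_apply, add_zero, dBilin_swap, neg_eq_zero] at h1
    refine hX.dBilin_theta_ne_zero hc (fun h2 => ha0 ?_) (by rw [conj_conj]; exact h1)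
    rw [← conj_conj _ a, h2, map_zero]
  rw [hwab, ha0, hb0, add_zero]

/-- The bilinear form `dθ(H·, H·) + θ ⊗ θ`, which is non-degenerate on a strongly pseudoconvex
manifold. -/
def polarity (x : M) : CTangent E x →ₗ[ℂ] Module.Dual ℂ (CTangent E x) :=
  X.dthetaHor x + (X.theta x).smulRight (X.theta x)

theorem polarity_apply (x : M) (w z : CTangent E x) :
    X.polarity x w z = X.dthetaHor x w z + X.theta x w * X.theta x z := rfl

theorem theta_of_polarity {x : M} {w : CTangent E x} : X.polarity x w (X.ξ x) = X.theta x w := by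
  rw [polarity_apply, ← dthetaHor_hor_right, hor_ξ, map_zero, theta_ξ, zero_add, mul_one]

variable {X} (hX : X.StronglyPseudoconvex)

theorem StronglyPseudoconvex.ker_polarity (hX : X.StronglyPseudoconvex) (x : M) :
    LinearMap.ker (X.polarity x) = ⊥ := by
  rw [LinearMap.ker_eq_bot']
  intro w hw
  have hθ : X.theta x w = 0 := by rw [← theta_of_polarity, hw]; rfl
  refine hX.dthetaHor_nondegenerate hθ fun z => ?_
  have := LinearMap.congr_fun hw z
  rwa [polarity_apply, hθ, zero_mul, add_zero] at this

/-- The horizontal vector `♯α` with `dθ(♯α, z) = α(H z)`. -/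
def StronglyPseudoconvex.sharp (x : M) :
    Module.Dual ℂ (CTangent E x) →ₗ[ℂ] CTangent E x :=
  ((X.polarity x).linearEquivOfInjective (LinearMap.ker_eq_bot.1 (hX.ker_polarity x))
    Subspace.dual_finrank_eq.symm).symm.toLinearMap ∘ₗ (X.hor x).dualMap

theorem StronglyPseudoconvex.polarity_sharp (x : M) (α : Module.Dual ℂ (CTangent E x))
    (z : CTangent E x) : X.polarity x (hX.sharp x α) z = α (X.hor x z) := by
  have := ((X.polarity x).linearEquivOfInjective (LinearMap.ker_eq_bot.1 (hX.ker_polarity x))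
    Subspace.dual_finrank_eq.symm).apply_symm_apply ((X.hor x).dualMap α)
  exact LinearMap.congr_fun this z

theorem StronglyPseudoconvex.theta_sharp (x : M) (α : Module.Dual ℂ (CTangent E x)) :
    X.theta x (hX.sharp x α) = 0 := by
  rw [← theta_of_polarity, hX.polarity_sharp, hor_ξ, map_zero]

theorem StronglyPseudoconvex.dthetaHor_sharp (x : M) (α : Module.Dual ℂ (CTangent E x))
    (z : CTangent E x) : X.dthetaHor x (hX.sharp x α) z = α (X.hor x z) := by
  have := hX.polarity_sharp x α z
  rwa [polarity_apply, hX.theta_sharp, zero_mul, add_zero] at this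

theorem StronglyPseudoconvex.sharp_dthetaHor (x : M) (z : CTangent E x) :
    hX.sharp x (X.dthetaHor x z) = X.hor x z := by
  rw [← sub_eq_zero]
  refine hX.dthetaHor_nondegenerate ?_ fun w => ?_
  · rw [map_sub, hX.theta_sharp, theta_hor, sub_zero]
  · rw [map_sub, LinearMap.sub_apply, hX.dthetaHor_sharp, dthetaHor_hor_left, dthetaHor_hor_right,
      sub_self]

/-- `♯` maps smooth linear forms to smooth vector fields: in a local frame, the coefficients of `♯α`
solve a linear system. -/
theorem StronglyPseudoconvex.smooth_sharp {α : ∀ x : M, CTangent E x →ₗ[ℂ] ℂ}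
    (hα : SmoothCov E M α) : SmoothField E M fun x => hX.sharp x (α x) := by
  intro x
  obtain ⟨e, ε, he, hε, -, hs⟩ := exists_frame_coframe (E := E) x
  have hc : ∀ j, CSmoothAt (E := E) (fun y => ε j y (hX.sharp y (α y))) x := by
    refine fun j => CSmoothAt.of_linear_system (A := fun y i j => X.polarity y (e j y) (e i y))
      (b := fun y i => α y (X.hor y (e i y))) (c := fun y j => ε j y (hX.sharp y (α y)))
      (fun i j => ?_) (fun i => hα.apply (X.smoothEnd_hor _ (he i) x)) ?_ ?_ j
    · exact (X.smooth_dthetaHor (he j) (he i) x).add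
        ((X.smoothCov_theta.apply (he j x)).mul (X.smoothCov_theta.apply (he i x)))
    -- the matrix of `polarity` in the frame is invertible at `x`
    · intro hdet
      obtain ⟨v, hv0, hv⟩ := Matrix.exists_mulVec_eq_zero_iff.2 hdet
      have hspan : ⊤ ≤ Submodule.span ℂ (Set.range fun i => e i x) := by
        intro w _
        rw [← hs.self_of_nhds w]
        exact Submodule.sum_mem _ fun i _ => Submodule.smul_mem _ _
          (Submodule.subset_span ⟨i, rfl⟩)
      have hli : LinearIndependent ℂ fun i => e i x :=
        linearIndependent_of_top_le_span_of_card_eq_finrank hspan (by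
          rw [finrank_cTangent, Fintype.card_fin])
      have hzero : X.polarity x (∑ j, v j • e j x) = 0 := by
        refine LinearMap.ext fun w => ?_
        rw [← hs.self_of_nhds w, map_sum]
        refine Finset.sum_eq_zero fun i _ => ?_
        have hvi := congrFun hv i
        rw [map_smul, map_sum, LinearMap.sum_apply]
        simp only [map_smul, LinearMap.smul_apply]
        simp only [Matrix.mulVec, dotProduct, Pi.zero_apply] at hvi
        rw [show ∑ j, v j • X.polarity x (e j x) (e i x) = 0 by
          rw [← hvi]
          exact Finset.sum_congr rfl fun j _ => mul_comm _ _, smul_zero]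
      have h0 : ∑ j, v j • e j x = 0 := by
        have : ∑ j, v j • e j x ∈ LinearMap.ker (X.polarity x) := hzero
        rwa [hX.ker_polarity] at this
      exact hv0 (funext (Fintype.linearIndependent_iff.1 hli v h0))
    · filter_upwards [hs] with y hy i
      rw [← hX.polarity_sharp]
      conv_rhs => rw [← hy (hX.sharp y (α y)), map_sum, LinearMap.sum_apply]
      refine Finset.sum_congr rfl fun j _ => ?_
      rw [map_smul, LinearMap.smul_apply, smul_eq_mul, mul_comm]
  refine (FieldSmoothAt.sum Finset.univ fun j _ => FieldSmoothAt.smul (hc j) (he j x)).congr ?_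
  filter_upwards [hs] with y hy
  exact (hy _).symm

end Levi

end Supplement

/-! ### The Lefschetz operators of `dθ` on horizontal forms -/

/-- The contraction of a bilinear expression in a vector and a linear form does not depend on the
pair of dual frames that is used to compute it. -/
theorem sum_frame_eq {V N ι κ : Type*} [AddCommGroup V] [Module ℂ V] [AddCommGroup N] [Module ℂ N]
    [Fintype ι] [Fintype κ] (F : V →ₗ[ℂ] (V →ₗ[ℂ] ℂ) →ₗ[ℂ] N) {e : ι → V} {ε : ι → V →ₗ[ℂ] ℂ}
    {e' : κ → V} {ε' : κ → V →ₗ[ℂ] ℂ} (h : ∀ v, ∑ i, ε i v • e i = v)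
    (h' : ∀ v, ∑ j, ε' j v • e' j = v) : ∑ i, F (e i) (ε i) = ∑ j, F (e' j) (ε' j) := by
  have h1 : ∀ i, F (e i) (ε i) = ∑ j, ε' j (e i) • F (e' j) (ε i) := by
    intro i
    conv_lhs => rw [← h' (e i), map_sum, LinearMap.sum_apply]
    simp only [map_smul, LinearMap.smul_apply]
  have h2 : ∀ j, F (e' j) (ε' j) = ∑ i, ε' j (e i) • F (e' j) (ε i) := by
    intro j
    have : ε' j = ∑ i, ε' j (e i) • ε i := by
      refine LinearMap.ext fun v => ?_
      conv_lhs => rw [← h v, map_sum]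
      simp [mul_comm]
    conv_lhs => rw [this, map_sum]
    simp only [map_smul]
  simp only [h1, h2]
  exact Finset.sum_comm

namespace Supplement

section Lefschetz

variable {E : Type*} [NormedAddCommGroup E] [NormedSpace ℝ E] [FiniteDimensional ℝ E]
variable {M : Type*} [TopologicalSpace M] [ChartedSpace E M] [IsManifold 𝓘(ℝ, E) ∞ M] [T2Space M]
variable {S : CRStructure E M} {X : Supplement S} (hX : X.StronglyPseudoconvex)

/-- The bilinear map `(w, α) ↦ ι_{H w} ι_{♯α} γ`. -/
def StronglyPseudoconvex.contractBilin (x : M) {k : ℕ} (γ : CTangent E x [⋀^Fin (k + 1 + 1)]→ₗ[ℂ] ℂ) :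
    CTangent E x →ₗ[ℂ] (CTangent E x →ₗ[ℂ] ℂ) →ₗ[ℂ] CTangent E x [⋀^Fin k]→ₗ[ℂ] ℂ :=
  LinearMap.mk₂ ℂ (fun w α => (γ.curryLeft (hX.sharp x α)).curryLeft (X.hor x w))
    (fun w w' α => by rw [map_add, map_add])
    (fun c w α => by rw [map_smul, map_smul])
    (fun w α α' => by rw [map_add, map_add, AlternatingMap.curryLeft_add, LinearMap.add_apply])
    (fun c w α => by rw [map_smul, map_smul, AlternatingMap.curryLeft_smul, LinearMap.smul_apply])

theorem StronglyPseudoconvex.contractBilin_apply (x : M) {k : ℕ}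
    (γ : CTangent E x [⋀^Fin (k + 1 + 1)]→ₗ[ℂ] ℂ) (w : CTangent E x) (α : CTangent E x →ₗ[ℂ] ℂ) :
    hX.contractBilin x γ w α = (γ.curryLeft (hX.sharp x α)).curryLeft (X.hor x w) := rfl

/-- The contraction `Λ` of forms with the bivector inverse to `dθ(H·, H·)`. The bases chosen in the
tangent spaces do not vary smoothly, but by `contract_eq` any other frame gives the same operator. -/
def StronglyPseudoconvex.contract {k : ℕ} (γ : CForm E M (k + 1 + 1)) : CForm E M k := fun x =>
  ∑ i, hX.contractBilin x (γ x) (Module.finBasis ℂ (CTangent E x) i)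
    ((Module.finBasis ℂ (CTangent E x)).coord i)

theorem StronglyPseudoconvex.contract_eq {k : ℕ} (γ : CForm E M (k + 1 + 1)) (x : M) {ι : Type*}
    [Fintype ι] {e : ι → CTangent E x} {ε : ι → CTangent E x →ₗ[ℂ] ℂ}
    (h : ∀ v, ∑ i, ε i v • e i = v) :
    hX.contract γ x = ∑ i, (((γ x).curryLeft (hX.sharp x (ε i))).curryLeft (X.hor x (e i))) :=
  sum_frame_eq (hX.contractBilin x (γ x)) (fun v => (Module.finBasis ℂ (CTangent E x)).sum_repr v) h

theorem StronglyPseudoconvex.contract_mem {k : ℕ} {γ : CForm E M (k + 1 + 1)}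
    (hγ : γ ∈ smoothForms E M (k + 1 + 1)) : hX.contract γ ∈ smoothForms E M k := by
  refine smoothForm_of_apply fun Z hZ x => ?_
  obtain ⟨e, ε, he, hε, -, hs⟩ := exists_frame_coframe (E := E) x
  have h : ∀ i, (fun y => (((γ y).curryLeft (hX.sharp y (ε i y))).curryLeft (X.hor y (e i y))) :
      CForm E M k) ∈ smoothForms E M k := fun i =>
    smooth_curryLeft (X.smoothEnd_hor _ (he i)) (smooth_curryLeft (hX.smooth_sharp (hε i)) hγ)
  refine (CSmoothAt.sum Finset.univ fun i _ => smoothForm_apply (h i) fun j => hZ j x).congr ?_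
  filter_upwards [hs] with y hy
  rw [hX.contract_eq γ y hy, sum_alternatingMap_apply]

variable (X) in
/-- The smooth forms that depend on the horizontal parts of their arguments only. -/
def horForms (k : ℕ) : Submodule ℂ (CForm E M k) where
  carrier := {u | u ∈ smoothForms E M k ∧ ∀ x, (u x).compLinearMap (X.hor x) = u x}
  add_mem' := by
    rintro u w ⟨hu, hu'⟩ ⟨hw, hw'⟩
    refine ⟨Submodule.add_mem _ hu hw, fun x => ?_⟩
    conv_rhs => rw [Pi.add_apply, ← hu' x, ← hw' x]
    rfl
  zero_mem' := ⟨Submodule.zero_mem _, fun _ => rfl⟩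
  smul_mem' := by
    rintro c u ⟨hu, hu'⟩
    refine ⟨Submodule.smul_mem _ c hu, fun x => ?_⟩
    conv_rhs => rw [Pi.smul_apply, ← hu' x]
    rfl

theorem curryLeft_comp_hor {x : M} {k : ℕ} {γ : CTangent E x [⋀^Fin (k + 1)]→ₗ[ℂ] ℂ}
    (hγ : γ.compLinearMap (X.hor x) = γ) (w : CTangent E x) :
    (γ.curryLeft w).compLinearMap (X.hor x) = γ.curryLeft w := by
  ext v
  conv_lhs => rw [← hγ]
  conv_rhs => rw [← hγ]
  change γ (fun i => X.hor x ((Matrix.vecCons w fun j => X.hor x (v j)) i)) =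
    γ (fun i => X.hor x (Matrix.vecCons w v i))
  congr 1
  funext i
  refine Fin.cases rfl (fun j => ?_) i
  exact X.hor_hor x (v j)

variable (X) in
/-- The Lefschetz operator: exterior multiplication of horizontal forms by `2 dθ(H·, H·)`, the factor
being that of `wedgeTwo`. -/
def lefschetz (k : ℕ) : X.horForms k →ₗ[ℂ] X.horForms (k + 2) where
  toFun γ := ⟨fun x => wedgeTwo (X.dthetaHor x) (γ.1 x),
    smooth_wedgeTwo (fun _ _ hZ hW x => X.smooth_dthetaHor hZ hW x) γ.2.1, fun x => by
      rw [wedgeTwo_compLinearMap, dthetaHor_compl₁₂, γ.2.2 x]⟩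
  map_add' γ γ' := Subtype.ext (funext fun x => map_add (wedgeTwo (X.dthetaHor x)) _ _)
  map_smul' c γ := Subtype.ext (funext fun x => map_smul (wedgeTwo (X.dthetaHor x)) c _)

/-- The operator `Λ` on horizontal forms. -/
def StronglyPseudoconvex.dualLefschetz (k : ℕ) : X.horForms (k + 2) →ₗ[ℂ] X.horForms k where
  toFun γ := ⟨hX.contract γ.1, hX.contract_mem γ.2.1, fun x => by
    ext v
    change hX.contract γ.1 x (fun i => X.hor x (v i)) = hX.contract γ.1 x v
    rw [contract, sum_alternatingMap_apply, sum_alternatingMap_apply]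
    refine Finset.sum_congr rfl fun i _ => ?_
    exact congrArg (fun u => u v) (curryLeft_comp_hor (curryLeft_comp_hor (γ.2.2 x) _) _)⟩
  map_add' γ γ' := Subtype.ext (funext fun x => by
    change hX.contract (γ.1 + γ'.1) x = hX.contract γ.1 x + hX.contract γ'.1 x
    simp only [contract, ← Finset.sum_add_distrib]
    refine Finset.sum_congr rfl fun i _ => ?_
    rw [contractBilin_apply, Pi.add_apply, AlternatingMap.curryLeft_add, LinearMap.add_apply,
      AlternatingMap.curryLeft_add]
    rfl)
  map_smul' c γ := Subtype.ext (funext fun x => by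
    change hX.contract (c • γ.1) x = c • hX.contract γ.1 x
    simp only [contract, Finset.smul_sum]
    refine Finset.sum_congr rfl fun i _ => ?_
    rw [contractBilin_apply, Pi.smul_apply, AlternatingMap.curryLeft_smul, LinearMap.smul_apply,
      AlternatingMap.curryLeft_smul]
    rfl)

/-- The commutation relation of the Lefschetz operators on horizontal forms. The number `N` enters as
half of the trace of the projection to the horizontal vectors. -/
theorem StronglyPseudoconvex.lefschetz_commutator {N : ℕ} (hN : Module.finrank ℝ E = 2 * N + 1)
    (k : ℕ) (β : X.horForms (k + 2)) :
    X.lefschetz k (hX.dualLefschetz k β) - hX.dualLefschetz (k + 2) (X.lefschetz (k + 2) β) =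
      (4 * (((k + 2 : ℕ) : ℂ) - N)) • β := by
  refine Subtype.ext (funext fun x => ?_)
  -- the bivector that defines `Λ` is the sum of the `H b_i ∧ ♯ b_i^*`
  set b := Module.finBasis ℂ (CTangent E x)
  have hb : ∀ l : CTangent E x →ₗ[ℂ] ℂ, ∑ i, l (b i) • b.coord i = l := by
    intro l
    refine b.ext fun j => ?_
    rw [LinearMap.sum_apply, Finset.sum_eq_single j]
    · simp
    · intro i _ hij
      simp [hij.symm]
    · simp
  refine wedgeTwo_commutator Finset.univ (X.dthetaHor x) (X.dthetaHor_swap x)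
    (fun i => X.hor x (b i)) (fun i => hX.sharp x (b.coord i)) (X.hor x) (N : ℂ)
    (fun z => ?_) (fun z => ?_) ?_ (β.1 x) (fun v i => ?_)
  · have h1 : ∀ i, X.dthetaHor x (X.hor x (b i)) z = - X.dthetaHor x z (b i) := by
      intro i
      rw [dthetaHor_hor_left, dthetaHor_swap]
    simp only [h1, neg_smul, Finset.sum_neg_distrib, ← map_smul, ← map_sum, hb]
    rw [map_neg, hX.sharp_dthetaHor]
  · simp only [hX.dthetaHor_sharp, ← map_smul, ← map_sum]
    rw [show ∑ i, b.coord i (X.hor x z) • b i = X.hor x z from b.sum_repr _, hor_hor]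
  · simp only [hX.dthetaHor_sharp, hor_hor]
    simp only [hor_apply, map_sub, map_smul, smul_eq_mul, Finset.sum_sub_distrib]
    have h1 : ∑ i, X.theta x (b i) * b.coord i (X.ξ x) = 1 := by
      have := LinearMap.congr_fun (hb (X.theta x)) (X.ξ x)
      rw [LinearMap.sum_apply, theta_ξ] at this
      exact this
    have h2 : ∑ i, b.coord i (b i) = ((2 * N + 1 : ℕ) : ℂ) := by
      rw [← hN, ← finrank_cTangent (E := E) x]
      simp [b]
    rw [h1, h2]
    push_cast
    ring
  · rw [← β.2.2 x]
    change (β.1 x) (fun j => X.hor x (Function.update v i (X.hor x (v i)) j)) =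
      (β.1 x) (fun j => X.hor x (v j))
    congr 1
    funext j
    by_cases h : j = i
    · subst h
      rw [Function.update_self, hor_hor]
    · rw [Function.update_of_ne h]

include hX in
/-- Exterior multiplication by `dθ` is surjective onto the horizontal forms of degree above the
middle. -/
theorem StronglyPseudoconvex.exists_lefschetz_eq {N : ℕ} (hN : Module.finrank ℝ E = 2 * N + 1)
    {k : ℕ} (hk : N < k + 2) (β : X.horForms (k + 2)) : ∃ γ, X.lefschetz k γ = β := by
  refine exists_lefschetz_preimage X.lefschetz hX.dualLefschetz N (2 * N + 2) ?_
    (hX.lefschetz_commutator hN) k hk β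
  intro k hk β
  refine Subtype.ext (funext fun x => alternating_eq_zero_of_finrank_lt ?_ _)
  rw [finrank_cTangent, hN]
  omega

include hX in
/-- In degrees above the middle, every smooth horizontal form is the horizontal part of `dv` for a
smooth form `v` that vanishes on horizontal vectors. -/
theorem StronglyPseudoconvex.exists_vertical_primitive {N : ℕ}
    (hN : Module.finrank ℝ E = 2 * N + 1) {k : ℕ} (hk : N < k + 1) {β : CForm E M (k + 1)}
    (hβ : β ∈ X.horForms (k + 1)) :
    ∃ v ∈ smoothForms E M k, (∀ x, (v x).compLinearMap (X.hor x) = 0) ∧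
      ∀ x, (extD v x).compLinearMap (X.hor x) = β x := by
  cases k with
  | zero =>
    -- the real dimension is one, and the horizontal vectors are zero
    have hh : ∀ (x : M) (w : CTangent E x), X.hor x w = 0 := by
      intro x w
      have h1 : Module.finrank ℂ (CTangent E x) = 1 := by
        rw [finrank_cTangent, hN]
        omega
      obtain ⟨c, rfl⟩ := (finrank_eq_one_iff_of_nonzero' _ (X.ξ_ne_zero x)).1 h1 w
      rw [map_smul, hor_ξ, smul_zero]
    refine ⟨0, Submodule.zero_mem _, fun x => rfl, fun x => ?_⟩
    rw [extD_zero, ← hβ.2 x]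
    ext v
    change 0 = β x fun i => X.hor x (v i)
    exact ((β x).map_coord_zero 0 (hh x _)).symm
  | succ k =>
    -- `v = 2 θ ∧ γ`: on horizontal vectors `dv` agrees with `2 dθ ∧ γ`, which is `L γ`
    obtain ⟨γ, hγ⟩ := hX.exists_lefschetz_eq hN hk ⟨β, hβ⟩
    have hs := smooth_wedgeOne X.smoothCov_theta γ.2.1
    have hθ : ∀ x, X.theta x ∘ₗ X.hor x = 0 := fun x => LinearMap.ext fun w => X.theta_hor x w
    refine ⟨(2 : ℂ) • fun x => wedgeOne (X.theta x) (γ.1 x), Submodule.smul_mem _ _ hs,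
      fun x => ?_, fun x => ?_⟩
    · change (2 : ℂ) • (wedgeOne (X.theta x) (γ.1 x)).compLinearMap (X.hor x) = 0
      rw [wedgeOne_compLinearMap, hθ, map_zero, LinearMap.zero_apply, smul_zero]
    · rw [extD_smul _ hs, Pi.smul_apply, extD_wedgeOne X.smoothCov_theta γ.2.1]
      have h1 := congrFun (congrArg Subtype.val hγ) x
      change (wedgeTwo (dBilin X.theta x) (γ.1 x)).compLinearMap (X.hor x) -
        (2 : ℂ) • (wedgeOne (X.theta x) (extD γ.1 x)).compLinearMap (X.hor x) = _
      rw [wedgeOne_compLinearMap, wedgeTwo_compLinearMap, hθ, γ.2.2 x, map_zero,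
        LinearMap.zero_apply, smul_zero, sub_zero]
      exact h1

end Lefschetz

end Supplement

/-! ### Types of vertical forms and of their exterior derivatives -/

namespace Supplement

section VerticalPointwise

variable {E : Type*} [NormedAddCommGroup E] [NormedSpace ℝ E]
variable {M : Type*} [TopologicalSpace M] [ChartedSpace E M] [IsManifold 𝓘(ℝ, E) ∞ M]
variable {S : CRStructure E M} (X : Supplement S)

theorem hor_of_proj_ne {x : M} {a : Fin 3} {z : CTangent E x} (ha : a ≠ 0)
    (hz : X.proj₃ x a z = z) : X.hor x z = z := by
  change z - X.proj₃ x 0 z = z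
  rw [← hz, (X.isDecomposition_proj₃ x).proj_of_ne 0 a _ ha.symm, sub_zero]

theorem hor_of_proj_zero {x : M} {z : CTangent E x} (hz : X.proj₃ x 0 z = z) : X.hor x z = 0 := by
  change z - X.proj₃ x 0 z = 0
  rw [hz, sub_self]

/-- The horizontal part of a form on tuples of homogeneous vectors. -/
theorem comp_hor_apply {x : M} {k : ℕ} (u : CTangent E x [⋀^Fin k]→ₗ[ℂ] ℂ) {f : Fin k → Fin 3}
    {v : Fin k → CTangent E x} (hv : ∀ j, X.proj₃ x (f j) (v j) = v j) :
    u.compLinearMap (X.hor x) v = if countOf f 0 = 0 then u v else 0 := by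
  rw [AlternatingMap.compLinearMap_apply]
  split_ifs with h
  · congr 1
    funext j
    refine X.hor_of_proj_ne (fun h0 => ?_) (hv j)
    have := countOf_pos (f := f) j
    rw [h0, h] at this
    exact lt_irrefl _ this
  · obtain ⟨j, hj⟩ := exists_of_countOf_pos (Nat.pos_of_ne_zero h)
    refine u.map_coord_zero j (X.hor_of_proj_zero ?_)
    have := hv j
    rwa [hj] at this

/-- A form vanishes on tuples that contain two multiples of `ξ`. -/
theorem apply_eq_zero_of_two_le {x : M} {k : ℕ} (u : CTangent E x [⋀^Fin k]→ₗ[ℂ] ℂ)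
    {f : Fin k → Fin 3} {v : Fin k → CTangent E x} (hv : ∀ j, X.proj₃ x (f j) (v j) = v j)
    (h : 2 ≤ countOf f 0) : u v = 0 := by
  obtain ⟨i, hi, j, hj, hij⟩ := Finset.one_lt_card.1 h
  have hi := (Finset.mem_filter.1 hi).2
  have hj := (Finset.mem_filter.1 hj).2
  refine u.map_linearDependent v fun hli => ?_
  have h1 := hv i
  have h2 := hv j
  rw [hi, ← theta_smul] at h1
  rw [hj, ← theta_smul] at h2
  have hpair : LinearIndependent ℂ ![v i, v j] := by
    have hinj : Function.Injective ![i, j] := by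
      intro a b hab
      fin_cases a <;> fin_cases b
      · rfl
      · exact absurd hab hij
      · exact absurd hab.symm hij
      · rfl
    have := LinearIndependent.comp hli ![i, j] hinj
    rwa [show v ∘ ![i, j] = ![v i, v j] by funext a; fin_cases a <;> rfl] at this
  have h3 := LinearIndependent.pair_iff.1 hpair (X.theta x (v j)) (- X.theta x (v i)) (by
    have e : ∀ s t : ℂ, s • t • X.ξ x + -t • s • X.ξ x = 0 := fun s t => by module
    have := e (X.theta x (v j)) (X.theta x (v i))
    rwa [h1, h2] at this)
  refine hli.ne_zero j ?_
  rw [← h2, h3.1, zero_smul]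

/-- A form that vanishes on horizontal vectors is a multiple of `θ`. -/
theorem eq_wedgeOne_of_comp_hor_eq_zero {x : M} {k : ℕ} {u : CTangent E x [⋀^Fin (k + 1)]→ₗ[ℂ] ℂ}
    (hu : u.compLinearMap (X.hor x) = 0) : wedgeOne (X.theta x) (u.curryLeft (X.ξ x)) = u := by
  have hθ : X.theta x ∘ₗ X.hor x = 0 := LinearMap.ext fun w => X.theta_hor x w
  have hz : (u - wedgeOne (X.theta x) (u.curryLeft (X.ξ x))).curryLeft (X.ξ x) = 0 := by
    rw [sub_eq_add_neg, AlternatingMap.curryLeft_add, LinearMap.add_apply]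
    have h1 : (-wedgeOne (X.theta x) (u.curryLeft (X.ξ x))).curryLeft (X.ξ x) =
        - (wedgeOne (X.theta x) (u.curryLeft (X.ξ x))).curryLeft (X.ξ x) := rfl
    rw [h1]
    cases k with
    | zero =>
      ext v
      rw [AlternatingMap.add_apply, AlternatingMap.neg_apply,
        AlternatingMap.curryLeft_apply_apply (wedgeOne _ _), wedgeOne_apply, Fin.sum_univ_one]
      have e1 : (Matrix.vecCons (X.ξ x) v) 0 = X.ξ x := rfl
      have e2 : (0 : Fin 1).removeNth (Matrix.vecCons (X.ξ x) v) = v := by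
        funext i
        exact i.elim0
      rw [e1, e2, theta_ξ]
      simp
    | succ k =>
      rw [curryLeft_wedgeOne, theta_ξ, AlternatingMap.curryLeft_same]
      simp
  have h2 := compLinearMap_eq_self_of_curryLeft_eq_zero _ _ hz (X.hor x) fun v =>
    ⟨X.theta x v, by rw [hor_apply, sub_sub_cancel]⟩
  have h3 : (u - wedgeOne (X.theta x) (u.curryLeft (X.ξ x))).compLinearMap (X.hor x) =
      u.compLinearMap (X.hor x) -
        (wedgeOne (X.theta x) (u.curryLeft (X.ξ x))).compLinearMap (X.hor x) := rfl
  rw [h3, hu, wedgeOne_compLinearMap, hθ, map_zero, LinearMap.zero_apply, sub_zero] at h2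
  exact (sub_eq_zero.1 h2.symm).symm

/-- The components of multidegree `(1, a, b)` vanish on horizontal vectors. -/
theorem component_one_comp_hor {x : M} {k a b : ℕ} (u : CTangent E x [⋀^Fin k]→ₗ[ℂ] ℂ) :
    (component (X.proj₃ x) ![1, a, b] k u).compLinearMap (X.hor x) = 0 := by
  refine (X.isDecomposition_proj₃ x).ext fun f v hv => ?_
  rw [X.comp_hor_apply _ hv, (X.isDecomposition_proj₃ x).component_apply_of_proj _ _ f v hv]
  split_ifs with h1 h2
  · rw [h2] at h1
    exact absurd h1 one_ne_zero
  · rfl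
  · rfl

theorem fin_three_funext {g : Fin 3 → ℕ} {a b c : ℕ} (h0 : g 0 = a) (h1 : g 1 = b)
    (h2 : g 2 = c) : g = ![a, b, c] := by
  funext i
  fin_cases i
  · exact h0
  · exact h1
  · exact h2

/-- A form that vanishes on horizontal vectors is the sum of its components of multidegree
`(1, a, b)`. -/
theorem sum_component_one {x : M} {k : ℕ} {u : CTangent E x [⋀^Fin (k + 1)]→ₗ[ℂ] ℂ}
    (hu : u.compLinearMap (X.hor x) = 0) :
    ∑ ab ∈ Finset.HasAntidiagonal.antidiagonal k, component (X.proj₃ x) ![1, ab.1, ab.2] (k + 1) u = u := by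
  have h := (X.isDecomposition_proj₃ x).sum_component u
    ((Finset.HasAntidiagonal.antidiagonal k).image fun ab => ![1, ab.1, ab.2]) (by
      intro f v hv hf
      have h1 : countOf f 0 ≠ 1 := by
        intro h1
        refine hf (Finset.mem_image.2 ⟨(countOf f 1, countOf f 2), ?_, ?_⟩)
        · have := sum_countOf f
          rw [Fin.sum_univ_three] at this
          rw [Finset.HasAntidiagonal.mem_antidiagonal]
          dsimp only
          omega
        · exact (fin_three_funext h1 rfl rfl).symm
      by_cases h0 : countOf f 0 = 0
      · have := X.comp_hor_apply u hv
        rw [if_pos h0, hu] at this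
        exact this.symm
      · exact X.apply_eq_zero_of_two_le u hv (by omega))
  rw [Finset.sum_image] at h
  · exact h
  · rintro ⟨a, b⟩ - ⟨a', b'⟩ - hab
    have h1 := congrFun hab 1
    have h2 := congrFun hab 2
    exact Prod.ext h1 h2

end VerticalPointwise

section VerticalDerivative

variable {E : Type*} [NormedAddCommGroup E] [NormedSpace ℝ E] [FiniteDimensional ℝ E]
variable {M : Type*} [TopologicalSpace M] [ChartedSpace E M] [IsManifold 𝓘(ℝ, E) ∞ M] [T2Space M]
variable {S : CRStructure E M} (X : Supplement S)

/-- The 2-form `dθ(H·, H·)` has type `(1, 1)`. -/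
theorem type_of_dthetaHor_ne_zero {x : M} {a b : Fin 3} {z w : CTangent E x}
    (hz : X.proj₃ x a z = z) (hw : X.proj₃ x b w = w) (h : X.dthetaHor x z w ≠ 0) :
    a = 1 ∧ b = 2 ∨ a = 2 ∧ b = 1 := by
  have ha : a ≠ 0 := by
    rintro rfl
    refine h ?_
    rw [← dthetaHor_hor_left, X.hor_of_proj_zero hz, map_zero, LinearMap.zero_apply]
  have hb : b ≠ 0 := by
    rintro rfl
    refine h ?_
    rw [← dthetaHor_hor_right, X.hor_of_proj_zero hw, map_zero]
  rw [dthetaHor_apply, X.hor_of_proj_ne ha hz, X.hor_of_proj_ne hb hw] at h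
  have h11 : ¬ (a = 1 ∧ b = 1) := by
    rintro ⟨rfl, rfl⟩
    exact h (X.dBilin_theta_T10 (hz ▸ X.proj₃_one_mem x z) (hw ▸ X.proj₃_one_mem x w))
  have h22 : ¬ (a = 2 ∧ b = 2) := by
    rintro ⟨rfl, rfl⟩
    exact h (X.dBilin_theta_T01 (hz ▸ X.proj₃_two_mem x z) (hw ▸ X.proj₃_two_mem x w))
  revert ha hb h11 h22
  clear hz hw h
  revert a b
  decide

/-- If a smooth form `u` vanishes on horizontal vectors, then the horizontal part of `du` is the
product of `dθ` and of the form `ι_ξ u`; hence its part of type `(a + 1, b + 1)` is determined by the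
component of `u` of multidegree `(1, a, b)`. -/
theorem exists_type_of_extD_ne_zero {k : ℕ} {u : CForm E M (k + 1)}
    (hu : u ∈ smoothForms E M (k + 1)) (hv : ∀ x, (u x).compLinearMap (X.hor x) = 0) {x : M}
    {f : Fin (k + 2) → Fin 3} {v : Fin (k + 2) → CTangent E x}
    (hf : ∀ j, X.proj₃ x (f j) (v j) = v j) (h0 : countOf f 0 = 0) (h : extD u x v ≠ 0) :
    ∃ a b, countOf f = ![0, a + 1, b + 1] ∧ component (X.proj₃ x) ![1, a, b] (k + 1) (u x) ≠ 0 := by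
  have hγ := smooth_curryLeft X.smoothField_ξ hu
  have hθ : X.theta x ∘ₗ X.hor x = 0 := LinearMap.ext fun w => X.theta_hor x w
  have h1 := extD_wedgeOne X.smoothCov_theta hγ x
  rw [show (fun y => wedgeOne (X.theta y) ((u y).curryLeft (X.ξ y)) : CForm E M (k + 1)) = u from
    funext fun y => X.eq_wedgeOne_of_comp_hor_eq_zero (hv y)] at h1
  have h2 : (2 : ℂ) • (extD u x).compLinearMap (X.hor x) =
      wedgeTwo (X.dthetaHor x) (((u x).curryLeft (X.ξ x)).compLinearMap (X.hor x)) := by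
    have h3 := congrArg (fun g => AlternatingMap.compLinearMap g (X.hor x)) h1
    change (2 : ℂ) • (extD u x).compLinearMap (X.hor x) =
      (wedgeTwo (dBilin X.theta x) ((u x).curryLeft (X.ξ x))).compLinearMap (X.hor x) -
      (2 : ℂ) • (wedgeOne (X.theta x) (extD (fun y => (u y).curryLeft (X.ξ y) : CForm E M k) x)).compLinearMap
        (X.hor x) at h3
    rw [wedgeOne_compLinearMap, wedgeTwo_compLinearMap, hθ, map_zero, LinearMap.zero_apply,
      smul_zero, sub_zero] at h3
    exact h3
  have h4 : wedgeTwo (X.dthetaHor x) (((u x).curryLeft (X.ξ x)).compLinearMap (X.hor x)) v ≠ 0 := by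
    rw [← h2, AlternatingMap.smul_apply, X.comp_hor_apply _ hf, if_pos h0]
    exact smul_ne_zero two_ne_zero h
  -- a non-zero term of `dθ ∧ ι_ξ u`: `dθ` is evaluated on two of the arguments, one of which lies in
  -- `⁰T'` and the other in `⁰T''`, and `u` on `ξ` and the remaining arguments
  rw [wedgeTwo_apply] at h4
  obtain ⟨i, -, hi⟩ := Finset.exists_ne_zero_of_sum_ne_zero h4
  obtain ⟨j, -, hj⟩ := Finset.exists_ne_zero_of_sum_ne_zero (right_ne_zero_of_mul hi)
  have hj' := right_ne_zero_of_mul hj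
  have hB := left_ne_zero_of_mul hj'
  have hg := right_ne_zero_of_mul hj'
  have hf' : ∀ l, X.proj₃ x (i.removeNth f l) (i.removeNth v l) = i.removeNth v l := fun l => hf _
  have hf'' : ∀ l, X.proj₃ x (j.removeNth (i.removeNth f) l) (j.removeNth (i.removeNth v) l) =
      j.removeNth (i.removeNth v) l := fun l => hf' _
  have htype := X.type_of_dthetaHor_ne_zero (hf i) (hf' j) hB
  rw [X.comp_hor_apply _ hf''] at hg
  have hg0 : countOf (j.removeNth (i.removeNth f)) 0 = 0 := by
    by_contra hne
    rw [if_neg hne] at hg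
    exact hg rfl
  rw [if_pos hg0, AlternatingMap.curryLeft_apply_apply] at hg
  have hcount : ∀ a, countOf f a = (if f i = a then 1 else 0) +
      ((if i.removeNth f j = a then 1 else 0) + countOf (j.removeNth (i.removeNth f)) a) := by
    intro a
    rw [countOf_eq_add_removeNth f i, countOf_eq_add_removeNth (i.removeNth f) j]
  set g := j.removeNth (i.removeNth f) with hgdef
  refine ⟨countOf g 1, countOf g 2, fin_three_funext h0 ?_ ?_, fun hc => hg ?_⟩
  · rw [hcount 1]
    rcases htype with ⟨ha, hb⟩ | ⟨ha, hb⟩ <;> rw [ha, hb] <;> simp [add_comm]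
  · rw [hcount 2]
    rcases htype with ⟨ha, hb⟩ | ⟨ha, hb⟩ <;> rw [ha, hb] <;> simp [add_comm]
  · have hcons : ∀ l, X.proj₃ x ((Fin.cons 0 g : Fin (k + 1) → Fin 3) l)
        (Matrix.vecCons (X.ξ x) (j.removeNth (i.removeNth v)) l) =
        Matrix.vecCons (X.ξ x) (j.removeNth (i.removeNth v)) l := by
      intro l
      refine Fin.cases ?_ (fun l => ?_) l
      · exact X.proj₃_zero_eq_self (X.ξ_mem_line x)
      · exact hf'' l
    have hcc : ∀ a, countOf (Fin.cons 0 g : Fin (k + 1) → Fin 3) a =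
        (if (0 : Fin 3) = a then 1 else 0) + countOf g a := by
      intro a
      rw [countOf_eq_add_removeNth _ 0]
      simp
    have h5 := (X.isDecomposition_proj₃ x).component_apply_of_proj ![1, countOf g 1, countOf g 2]
      (u x) _ _ hcons
    rw [hc, if_pos (fin_three_funext (by rw [hcc, hg0]; simp) (by rw [hcc]; simp)
      (by rw [hcc]; simp))] at h5
    exact h5.symm

end VerticalDerivative

end Supplement

/-! ### The filtration by the number of arguments in `⁰T''` -/

namespace Supplement

section Filtration

variable {E : Type*} [NormedAddCommGroup E] [NormedSpace ℝ E] [FiniteDimensional ℝ E]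
variable {M : Type*} [TopologicalSpace M] [ChartedSpace E M] [IsManifold 𝓘(ℝ, E) ∞ M] [T2Space M]
variable {S : CRStructure E M} (X : Supplement S)

/-- The form `u` vanishes at `x` on the tuples with at least `m` arguments in `⁰T''`. -/
def VanishesFrom (m : ℕ) {k : ℕ} (u : CForm E M k) (x : M) : Prop :=
  ∀ (f : Fin k → Fin 2) (v : Fin k → CTangent E x), (∀ j, X.proj₂ x (f j) (v j) = v j) →
    m ≤ countOf f 1 → u x v = 0

variable {X}

theorem VanishesFrom.add {m k : ℕ} {u w : CForm E M k} {x : M} (hu : X.VanishesFrom m u x)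
    (hw : X.VanishesFrom m w x) : X.VanishesFrom m (u + w) x := by
  intro f v hv hm
  rw [Pi.add_apply, AlternatingMap.add_apply, hu f v hv hm, hw f v hv hm, add_zero]

theorem VanishesFrom.smul {m k : ℕ} {u : CForm E M k} {x : M} (c : ℂ)
    (hu : X.VanishesFrom m u x) : X.VanishesFrom m (c • u) x := by
  intro f v hv hm
  rw [Pi.smul_apply, AlternatingMap.smul_apply, hu f v hv hm, smul_zero]

theorem VanishesFrom.sum {m k : ℕ} {ι : Type*} (s : Finset ι) {u : ι → CForm E M k} {x : M}
    (hu : ∀ i ∈ s, X.VanishesFrom m (u i) x) : X.VanishesFrom m (∑ i ∈ s, u i) x := by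
  intro f v hv hm
  rw [Finset.sum_apply, sum_alternatingMap_apply]
  exact Finset.sum_eq_zero fun i hi => hu i hi f v hv hm

theorem VanishesFrom.of_eq_smul {m k : ℕ} {u w : CForm E M k} {x : M} {c : ℂ} (hc : c ≠ 0)
    (h : c • u x = w x) (hw : X.VanishesFrom m w x) : X.VanishesFrom m u x := by
  intro f v hv hm
  have h1 := hw f v hv hm
  rw [← h, AlternatingMap.smul_apply, smul_eq_mul] at h1
  exact (mul_eq_zero.1 h1).resolve_left hc

/-- Multiplication by a linear form that vanishes on `⁰T''` preserves the filtration. -/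
theorem vanishesFrom_wedgeOne {α : ∀ x : M, CTangent E x →ₗ[ℂ] ℂ} {k m : ℕ} {γ : CForm E M k} {x : M}
    (hγ : X.VanishesFrom m γ x) (hα : ∀ z ∈ X.T01 x, α x z = 0) :
    X.VanishesFrom m (fun y => wedgeOne (α y) (γ y) : CForm E M (k + 1)) x := by
  intro f v hv hm
  change wedgeOne (α x) (γ x) v = 0
  rw [wedgeOne_apply]
  refine Finset.sum_eq_zero fun i _ => ?_
  by_cases hi : f i = 1
  · have h1 := hv i
    rw [hi] at h1
    rw [hα (v i) (h1 ▸ X.proj₃_two_mem x (v i)), zero_mul, mul_zero]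
  · rw [hγ (i.removeNth f) (i.removeNth v) (fun j => hv _) ?_, mul_zero, mul_zero]
    have := countOf_eq_add_removeNth f i 1
    rw [if_neg hi] at this
    omega

theorem vanishesFrom_succ_wedgeOne {α : ∀ x : M, CTangent E x →ₗ[ℂ] ℂ} {k m : ℕ} {γ : CForm E M k}
    {x : M} (hγ : X.VanishesFrom m γ x) :
    X.VanishesFrom (m + 1) (fun y => wedgeOne (α y) (γ y) : CForm E M (k + 1)) x := by
  intro f v hv hm
  change wedgeOne (α x) (γ x) v = 0
  rw [wedgeOne_apply]
  refine Finset.sum_eq_zero fun i _ => ?_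
  rw [hγ (i.removeNth f) (i.removeNth v) (fun j => hv _) ?_, mul_zero, mul_zero]
  have := countOf_eq_add_removeNth f i 1
  split_ifs at this <;> omega

theorem vanishesFrom_wedgeTwo {B : ∀ x : M, CTangent E x →ₗ[ℂ] CTangent E x →ₗ[ℂ] ℂ} {k m : ℕ}
    {γ : CForm E M k} {x : M} (hγ : X.VanishesFrom m γ x)
    (hB : ∀ z ∈ X.T01 x, ∀ w ∈ X.T01 x, B x z w = 0) :
    X.VanishesFrom (m + 1) (fun y => wedgeTwo (B y) (γ y) : CForm E M (k + 1 + 1)) x := by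
  intro f v hv hm
  change wedgeTwo (B x) (γ x) v = 0
  rw [wedgeTwo_apply]
  refine Finset.sum_eq_zero fun i _ => mul_eq_zero_of_right _ (Finset.sum_eq_zero fun j _ => ?_)
  refine mul_eq_zero_of_right _ ?_
  have hv' : ∀ l, X.proj₂ x (i.removeNth f l) (i.removeNth v l) = i.removeNth v l := fun l => hv _
  by_cases h : f i = 1 ∧ i.removeNth f j = 1
  · have h1 := hv i
    have h2 := hv' j
    rw [h.1] at h1
    rw [h.2] at h2
    rw [hB _ (h1 ▸ X.proj₃_two_mem x (v i)) _ (h2 ▸ X.proj₃_two_mem x _), zero_mul]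
  · rw [hγ (j.removeNth (i.removeNth f)) (j.removeNth (i.removeNth v)) (fun l => hv' _) ?_, mul_zero]
    have e1 := countOf_eq_add_removeNth f i 1
    have e2 := countOf_eq_add_removeNth (i.removeNth f) j 1
    by_cases h1 : f i = 1
    · rw [if_neg fun h2 => h ⟨h1, h2⟩] at e2
      split_ifs at e1 <;> omega
    · rw [if_neg h1] at e1
      split_ifs at e2 <;> omega

theorem vanishesFrom_succ_succ_wedgeTwo {B : ∀ x : M, CTangent E x →ₗ[ℂ] CTangent E x →ₗ[ℂ] ℂ}
    {k m : ℕ} {γ : CForm E M k} {x : M} (hγ : X.VanishesFrom m γ x) :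
    X.VanishesFrom (m + 1 + 1) (fun y => wedgeTwo (B y) (γ y) : CForm E M (k + 1 + 1)) x := by
  intro f v hv hm
  change wedgeTwo (B x) (γ x) v = 0
  rw [wedgeTwo_apply]
  refine Finset.sum_eq_zero fun i _ => mul_eq_zero_of_right _ (Finset.sum_eq_zero fun j _ => ?_)
  refine mul_eq_zero_of_right _ ?_
  have hv' : ∀ l, X.proj₂ x (i.removeNth f l) (i.removeNth v l) = i.removeNth v l := fun l => hv _
  rw [hγ (j.removeNth (i.removeNth f)) (j.removeNth (i.removeNth v)) (fun l => hv' _) ?_, mul_zero]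
  have e1 := countOf_eq_add_removeNth f i 1
  have e2 := countOf_eq_add_removeNth (i.removeNth f) j 1
  split_ifs at e1 e2 <;> omega

theorem two_smul_extD_wedgeOne {α : ∀ x : M, CTangent E x →ₗ[ℂ] ℂ} (hα : SmoothCov E M α) {k : ℕ}
    {u : CForm E M k} (hu : u ∈ smoothForms E M k) (x : M) :
    (2 : ℂ) • extD (fun y => wedgeOne (α y) (u y) : CForm E M (k + 1)) x =
      ((fun y => wedgeTwo (dBilin α y) (u y) : CForm E M (k + 1 + 1)) +
        (-2 : ℂ) • (fun y => wedgeOne (α y) (extD u y) : CForm E M (k + 1 + 1))) x := by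
  rw [extD_wedgeOne hα hu, sub_eq_add_neg, ← neg_smul]
  rfl

theorem vanishesFrom_curryLeft {m k : ℕ} {u : CForm E M (k + 1)} {x : M}
    (hu : X.VanishesFrom m u x) (W : ∀ x : M, CTangent E x) :
    X.VanishesFrom m (fun y => (u y).curryLeft (W y) : CForm E M k) x := by
  intro f v hv hm
  change u x (Matrix.vecCons (W x) v) = 0
  rw [(X.isDecomposition_proj₂ x).map_eq_sum]
  refine Finset.sum_eq_zero fun g _ => ?_
  by_cases hg : ∀ j : Fin k, g j.succ = f j
  · refine hu g _ (fun j => (X.isDecomposition_proj₂ x).proj_self _ _) ?_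
    rw [countOf_eq_add_removeNth g 0, show (0 : Fin (k + 1)).removeNth g = f from funext hg]
    omega
  · push Not at hg
    obtain ⟨j, hj⟩ := hg
    refine (u x).map_coord_zero j.succ ?_
    change X.proj₂ x (g j.succ) (v j) = 0
    rw [← hv j, (X.isDecomposition_proj₂ x).proj_of_ne _ _ _ hj]

theorem vanishesFrom_curryLeft_T01 {m k : ℕ} {u : CForm E M (k + 1)} {x : M}
    (hu : X.VanishesFrom (m + 1) u x) {W : ∀ x : M, CTangent E x} (hW : W x ∈ X.T01 x) :
    X.VanishesFrom m (fun y => (u y).curryLeft (W y) : CForm E M k) x := by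
  intro f v hv hm
  change u x (Matrix.vecCons (W x) v) = 0
  refine hu (Fin.cons 1 f) _ (fun j => ?_) ?_
  · refine Fin.cases ?_ (fun j => ?_) j
    · exact X.proj₃_two_eq_self hW
    · exact hv j
  · rw [countOf_eq_add_removeNth _ 0]
    simp
    omega

/-- The exterior derivative raises the filtration by at most one. The form is locally a sum of
products of 1-forms and of forms of lower degree; the 1-forms may be taken to vanish on `⁰T''`, except
when the other factor is the contraction with a vector of `⁰T''`. For 1-forms the assertion is the
involutivity of `⁰T''`. -/
theorem vanishesFrom_extD {k : ℕ} : ∀ {m : ℕ} {u : CForm E M k}, u ∈ smoothForms E M k →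
    (∀ x, X.VanishesFrom m u x) → ∀ x, X.VanishesFrom (m + 1) (extD u) x := by
  have hzero : ∀ {k : ℕ} {u : CForm E M k}, (∀ x, X.VanishesFrom 0 u x) → u = 0 := by
    intro k u hu
    funext x
    exact (X.isDecomposition_proj₂ x).ext fun f v hv => hu x f v hv (Nat.zero_le _)
  induction k with
  | zero =>
    intro m u hu hm x f v hv hle
    have h1 := sum_countOf f
    rw [Fin.sum_univ_two] at h1
    have h2 : m = 0 := by omega
    subst h2
    rw [hzero hm, extD_zero]
    rfl
  | succ k ih =>
    intro m u hu hm x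
    cases m with
    | zero =>
      rw [hzero hm, extD_zero]
      intro f v hv hle
      rfl
    | succ m =>
      obtain ⟨e, ε, he, hε, -, hs⟩ := exists_frame_coframe (E := E) x
      -- the 1-forms `ε i ∘ P'` and `ε i ∘ P''`, for the projections `P'` and `P''` onto `T'` and
      -- `⁰T''`, and the forms with which they are multiplied
      let a : Fin (Module.finrank ℝ E) → ∀ y : M, CTangent E y →ₗ[ℂ] ℂ :=
        fun i y => ε i y ∘ₗ X.proj₂ y 0
      let c : Fin (Module.finrank ℝ E) → ∀ y : M, CTangent E y →ₗ[ℂ] ℂ :=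
        fun i y => ε i y ∘ₗ X.proj₂ y 1
      let g : Fin (Module.finrank ℝ E) → CForm E M k := fun i y => (u y).curryLeft (e i y)
      let h : Fin (Module.finrank ℝ E) → CForm E M k :=
        fun i y => (u y).curryLeft (X.proj₂ y 1 (e i y))
      have ha : ∀ i, SmoothCov E M (a i) := fun i Z hZ y =>
        hε i _ (X.smoothEnd_proj₂ 0 Z hZ) y
      have hc : ∀ i, SmoothCov E M (c i) := fun i Z hZ y =>
        hε i _ (X.smoothEnd_proj₂ 1 Z hZ) y
      have hg : ∀ i, g i ∈ smoothForms E M k := fun i => smooth_curryLeft (he i) hu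
      have hh : ∀ i, h i ∈ smoothForms E M k := fun i =>
        smooth_curryLeft (X.smoothEnd_proj₂ 1 _ (he i)) hu
      have hgv : ∀ i y, X.VanishesFrom (m + 1) (g i) y := fun i y => vanishesFrom_curryLeft (hm y) _
      have hhv : ∀ i y, X.VanishesFrom m (h i) y := fun i y =>
        vanishesFrom_curryLeft_T01 (hm y) (X.proj₃_two_mem y (e i y))
      have ha0 : ∀ i y, ∀ z ∈ X.T01 y, a i y z = 0 := by
        intro i y z hz
        change ε i y (X.proj₂ y 0 z) = 0
        rw [proj₂_zero, X.proj₃_zero_eq_zero (Submodule.mem_sup_right hz),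
          X.proj₃_one_eq_zero (Submodule.mem_sup_left hz), add_zero, map_zero]
      let G : Fin (Module.finrank ℝ E) → CForm E M (k + 1) := fun i y => wedgeOne (a i y) (g i y)
      let K : Fin (Module.finrank ℝ E) → CForm E M (k + 1) := fun i y => wedgeOne (c i y) (h i y)
      have hG : ∀ i, G i ∈ smoothForms E M (k + 1) := fun i => smooth_wedgeOne (ha i) (hg i)
      have hK : ∀ i, K i ∈ smoothForms E M (k + 1) := fun i => smooth_wedgeOne (hc i) (hh i)
      -- each of the `k + 1` arguments of `u` is split by `P' + P'' = 1`, whence the factor `k + 1`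
      have hsum : ∀ᶠ y in 𝓝 x, (((k + 1 : ℕ) : ℂ) • u) y = (∑ i, G i + ∑ i, K i) y := by
        filter_upwards [hs] with y hy
        ext v
        rw [Pi.add_apply, Finset.sum_apply, Finset.sum_apply, AlternatingMap.add_apply]
        have e1 := sum_wedgeOne_curryLeft_apply Finset.univ (fun i => a i y) (fun i => e i y)
          (X.proj₂ y 0) (fun z => hy _) (u y) v
        have e2 := sum_wedgeOne_curryLeft_apply Finset.univ (fun i => c i y)
          (fun i => X.proj₂ y 1 (e i y)) (X.proj₂ y 1) (fun z => by
            have := congrArg (X.proj₂ y 1) (hy (X.proj₂ y 1 z))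
            rw [map_sum, (X.isDecomposition_proj₂ y).proj_self] at this
            simp only [map_smul] at this
            exact this) (u y) v
        change _ = (∑ i, wedgeOne (a i y) ((u y).curryLeft (e i y))) v +
          (∑ i, wedgeOne (c i y) ((u y).curryLeft (X.proj₂ y 1 (e i y)))) v
        rw [e1, e2, ← Finset.sum_add_distrib]
        simp only [← AlternatingMap.map_update_add, proj₂_zero_add, Function.update_eq_self]
        simp
      have hd : ((k + 1 : ℕ) : ℂ) • extD u x = (∑ i, extD (G i) + ∑ i, extD (K i)) x := by
        have e1 := extD_congr hsum
        rw [extD_smul _ hu, extD_add (Submodule.sum_mem _ fun i _ => hG i)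
          (Submodule.sum_mem _ fun i _ => hK i), extD_sum _ fun i _ => hG i,
          extD_sum _ fun i _ => hK i] at e1
        exact e1
      refine VanishesFrom.of_eq_smul (Nat.cast_ne_zero.2 k.succ_ne_zero) hd
        (VanishesFrom.add (VanishesFrom.sum _ fun i _ => ?_) (VanishesFrom.sum _ fun i _ => ?_))
      · refine VanishesFrom.of_eq_smul two_ne_zero (two_smul_extD_wedgeOne (ha i) (hg i) x)
          (VanishesFrom.add ?_ (VanishesFrom.smul _ ?_))
        · exact vanishesFrom_wedgeTwo (hgv i x) fun z hz w hw =>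
            X.dBilin_eq_zero_of_mem_T01 (ha i) (ha0 i) hz hw
        · exact vanishesFrom_wedgeOne (ih (hg i) (hgv i) x) (ha0 i x)
      · refine VanishesFrom.of_eq_smul two_ne_zero (two_smul_extD_wedgeOne (hc i) (hh i) x)
          (VanishesFrom.add ?_ (VanishesFrom.smul _ ?_))
        · exact vanishesFrom_succ_succ_wedgeTwo (hhv i x)
        · exact vanishesFrom_succ_wedgeOne (ih (hh i) (hhv i) x)

end Filtration

end Supplement

/-! ### The spaces `C^{p,q}`, `D^{p,q}` and `F^{p,q}` -/

namespace Supplement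

section TypesPointwise

variable {E : Type*} [NormedAddCommGroup E] [NormedSpace ℝ E]
variable {M : Type*} [TopologicalSpace M] [ChartedSpace E M] [IsManifold 𝓘(ℝ, E) ∞ M]
variable {S : CRStructure E M} (X : Supplement S)

/-- The components for `ℂ ⊗ TM = T' + ⁰T''` on tuples that are homogeneous for the finer
decomposition `ℂ ⊗ TM = ℂ ξ + ⁰T' + ⁰T''`. -/
theorem component₂_apply {x : M} {p q k : ℕ} (u : CTangent E x [⋀^Fin k]→ₗ[ℂ] ℂ)
    {f : Fin k → Fin 3} {v : Fin k → CTangent E x} (hv : ∀ j, X.proj₃ x (f j) (v j) = v j) :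
    component (X.proj₂ x) ![p, q] k u v =
      if countOf f 0 + countOf f 1 = p ∧ countOf f 2 = q then u v else 0 := by
  let τ : Fin 3 → Fin 2 := ![0, 0, 1]
  have hτ : ∀ j, X.proj₂ x (τ (f j)) (v j) = v j := by
    intro j
    have hj := hv j
    have hne := (X.isDecomposition_proj₃ x).proj_of_ne
    generalize f j = a at hj
    rw [← hj]
    fin_cases a
    · change X.proj₂ x 0 (X.proj₃ x 0 (v j)) = X.proj₃ x 0 (v j)
      rw [proj₂_zero, (X.isDecomposition_proj₃ x).proj_self, hne 1 0 _ (by decide), add_zero]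
    · change X.proj₂ x 0 (X.proj₃ x 1 (v j)) = X.proj₃ x 1 (v j)
      rw [proj₂_zero, (X.isDecomposition_proj₃ x).proj_self, hne 0 1 _ (by decide), zero_add]
    · exact (X.isDecomposition_proj₃ x).proj_self 2 (v j)
  have h1 : countOf (τ ∘ f) 1 = countOf f 2 := by
    rw [countOf, countOf]
    congr 1
    ext j
    simp only [Finset.mem_filter, Finset.mem_univ, true_and, Function.comp_apply]
    generalize f j = a
    revert a
    decide
  have h0 : countOf (τ ∘ f) 0 = countOf f 0 + countOf f 1 := by
    have e1 := sum_countOf f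
    have e2 := sum_countOf (τ ∘ f)
    rw [Fin.sum_univ_three] at e1
    rw [Fin.sum_univ_two] at e2
    omega
  rw [(X.isDecomposition_proj₂ x).component_apply_of_proj ![p, q] u (τ ∘ f) v hτ]
  congr 1
  rw [eq_iff_iff, funext_iff, Fin.forall_fin_two, h0, h1]
  rfl

theorem fin_three_eq_iff {g : Fin 3 → ℕ} {a b c : ℕ} :
    g = ![a, b, c] ↔ g 0 = a ∧ g 1 = b ∧ g 2 = c :=
  ⟨fun h => by subst h; exact ⟨rfl, rfl, rfl⟩, fun h => fin_three_funext h.1 h.2.1 h.2.2⟩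

theorem component₃_apply {x : M} {a p q k : ℕ} (u : CTangent E x [⋀^Fin k]→ₗ[ℂ] ℂ)
    {f : Fin k → Fin 3} {v : Fin k → CTangent E x} (hv : ∀ j, X.proj₃ x (f j) (v j) = v j) :
    component (X.proj₃ x) ![a, p, q] k u v =
      if countOf f 0 = a ∧ countOf f 1 = p ∧ countOf f 2 = q then u v else 0 := by
  rw [(X.isDecomposition_proj₃ x).component_apply_of_proj ![a, p, q] u f v hv]
  simp only [fin_three_eq_iff]

theorem component₂_eq_of_component₃_one {x : M} {p q k : ℕ} {u : CTangent E x [⋀^Fin k]→ₗ[ℂ] ℂ}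
    (hu : component (X.proj₃ x) ![1, p, q] k u = u) :
    component (X.proj₂ x) ![p + 1, q] k u = u := by
  refine (X.isDecomposition_proj₃ x).ext fun f v hv => ?_
  rw [X.component₂_apply u hv]
  split_ifs with h
  · rfl
  · rw [← hu, X.component₃_apply u hv, if_neg fun h' => h ⟨by omega, h'.2.2⟩]

theorem component₃_one_eq {x : M} {p q k : ℕ} {u : CTangent E x [⋀^Fin k]→ₗ[ℂ] ℂ}
    (hu : component (X.proj₂ x) ![p + 1, q] k u = u) (hv : u.compLinearMap (X.hor x) = 0) :
    component (X.proj₃ x) ![1, p, q] k u = u := by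
  refine (X.isDecomposition_proj₃ x).ext fun f v hf => ?_
  rw [X.component₃_apply u hf]
  split_ifs with h
  · rfl
  · rw [← hu, X.component₂_apply u hf]
    split_ifs with h2
    · by_cases h0 : countOf f 0 = 0
      · have := X.comp_hor_apply u hf
        rw [if_pos h0, hv] at this
        exact this
      · refine (X.apply_eq_zero_of_two_le u hf ?_).symm
        by_contra h3
        exact h ⟨by omega, by omega, h2.2⟩
    · rfl

theorem eq_zero_of_component₂_zero {x : M} {q k : ℕ} {u : CTangent E x [⋀^Fin k]→ₗ[ℂ] ℂ}
    (hu : component (X.proj₂ x) ![0, q] k u = u) (hv : u.compLinearMap (X.hor x) = 0) : u = 0 := by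
  refine (X.isDecomposition_proj₃ x).ext fun f v hf => ?_
  by_cases h0 : countOf f 0 = 0
  · have := X.comp_hor_apply u hf
    rw [if_pos h0, hv] at this
    exact this.symm
  · rw [← hu, X.component₂_apply u hf, if_neg fun h => h0 (by omega)]
    rfl

theorem component₂_eq_add {x : M} {p q k : ℕ} (u : CTangent E x [⋀^Fin k]→ₗ[ℂ] ℂ) :
    component (X.proj₂ x) ![p + 1, q] k u =
      component (X.proj₃ x) ![0, p + 1, q] k u + component (X.proj₃ x) ![1, p, q] k u := by
  refine (X.isDecomposition_proj₃ x).ext fun f v hf => ?_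
  rw [AlternatingMap.add_apply, X.component₂_apply u hf, X.component₃_apply u hf,
    X.component₃_apply u hf]
  by_cases h2 : 2 ≤ countOf f 0
  · rw [X.apply_eq_zero_of_two_le u hf h2]
    simp
  · by_cases h0 : countOf f 0 = 0
    · simp [h0]
    · have h1 : countOf f 0 = 1 := by omega
      simp [h1, add_comm 1]

theorem component₃_zero_component₂ {x : M} {p q k : ℕ} (u : CTangent E x [⋀^Fin k]→ₗ[ℂ] ℂ) :
    component (X.proj₃ x) ![0, p, q] k (component (X.proj₂ x) ![p, q] k u) =
      component (X.proj₃ x) ![0, p, q] k u := by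
  refine (X.isDecomposition_proj₃ x).ext fun f v hf => ?_
  rw [X.component₃_apply _ hf, X.component₃_apply u hf, X.component₂_apply u hf]
  split_ifs with h1 h2 h2
  · rfl
  · exact absurd ⟨by omega, h1.2.2⟩ h2
  · rfl

end TypesPointwise

section Types

variable {E : Type*} [NormedAddCommGroup E] [NormedSpace ℝ E] [FiniteDimensional ℝ E]
variable {M : Type*} [TopologicalSpace M] [ChartedSpace E M] [IsManifold 𝓘(ℝ, E) ∞ M] [T2Space M]
variable {S : CRStructure E M} {X : Supplement S}

theorem part₂_mem {p q k : ℕ} {u : CForm E M k} (hu : u ∈ smoothForms E M k) :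
    X.part₂ p q k u ∈ smoothForms E M k :=
  smooth_component X.smoothEnd_proj₂ _ hu

theorem part₃_mem {a p q k : ℕ} {u : CForm E M k} (hu : u ∈ smoothForms E M k) :
    X.part₃ a p q k u ∈ smoothForms E M k :=
  smooth_component X.smoothEnd_proj₃ _ hu

theorem mem_C_iff {p q : ℕ} {u : SmoothForm E M (p + q)} :
    u ∈ X.C p q ↔ ∀ x, component (X.proj₂ x) ![p, q] (p + q) (u.1 x) = u.1 x :=
  funext_iff (f := X.part₂ p q (p + q) u.1) (g := u.1)

theorem mem_D_succ_iff {p q k : ℕ} {u : SmoothForm E M k} :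
    u ∈ X.D (p + 1) q k ↔ ∀ x, component (X.proj₃ x) ![1, p, q] k (u.1 x) = u.1 x :=
  funext_iff (f := X.part₃ 1 p q k u.1) (g := u.1)

theorem D_le_C (p q : ℕ) : X.D p q (p + q) ≤ X.C p q := by
  cases p with
  | zero => exact bot_le
  | succ p => exact fun u hu => mem_C_iff.2 fun x =>
      X.component₂_eq_of_component₃_one (mem_D_succ_iff.1 hu x)

theorem mem_D_of_mem_C {p q : ℕ} {u : SmoothForm E M (p + q)} (hu : u ∈ X.C p q)
    (hv : ∀ x, (u.1 x).compLinearMap (X.hor x) = 0) : u ∈ X.D p q (p + q) := by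
  cases p with
  | zero =>
    exact Subtype.ext (funext fun x => X.eq_zero_of_component₂_zero (mem_C_iff.1 hu x) (hv x))
  | succ p => exact mem_D_succ_iff.2 fun x => X.component₃_one_eq (mem_C_iff.1 hu x) (hv x)

theorem part₃_zero_of_mem_D {p q k : ℕ} {u : SmoothForm E M k} (hu : u ∈ X.D p q k) :
    X.part₃ 0 p q k u.1 = 0 := by
  cases p with
  | zero =>
    have : u = 0 := hu
    rw [this]
    exact map_zero _
  | succ p =>
    funext x
    change component (X.proj₃ x) ![0, p + 1, q] k (u.1 x) = 0
    rw [← mem_D_succ_iff.1 hu x, (X.isDecomposition_proj₃ x).component_component, if_neg]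
    exact fun h => zero_ne_one (congrFun h 0)

/-- On `F^{p,q}` the operators `∂̄_b` and `d''` agree. -/
theorem dbar_eq_dSecond {p q : ℕ} {u : SmoothForm E M (p + q)} (hu : u ∈ X.F p q (p + q)) :
    X.dbar p q u = X.dSecond p q (p + q) u := by
  cases p with
  | zero =>
    have : u = 0 := hu.1
    rw [this, map_zero, map_zero]
  | succ p =>
    funext x
    have h1 : component (X.proj₃ x) ![0, p + 1, q + 1] _ (extD u.1 x) = 0 := congrFun hu.2 x
    exact (X.component₂_eq_add (extD u.1 x)).trans (by rw [h1, zero_add]; rfl)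

theorem mem_F_of_part₃_dbar {p q : ℕ} {u : SmoothForm E M (p + q)} (hu : u ∈ X.D p q (p + q))
    (h : X.part₃ 0 p (q + 1) (p + (q + 1)) (X.dbar p q u) = 0) : u ∈ X.F p q (p + q) := by
  refine ⟨hu, ?_⟩
  have h1 : X.part₃ 0 p (q + 1) (p + (q + 1)) (X.dbar p q u) =
      X.part₃ 0 p (q + 1) (p + q + 1) (d (p + q) u) :=
    funext fun x => X.component₃_zero_component₂ (extD u.1 x)
  exact h1.symm.trans h

theorem dbar_mem {p q : ℕ} (u : SmoothForm E M (p + q)) :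
    X.dbar p q u ∈ smoothForms E M (p + (q + 1)) :=
  part₂_mem (extD_mem u.2)

theorem dbar_mem_C {p q : ℕ} (u : SmoothForm E M (p + q)) :
    (⟨X.dbar p q u, dbar_mem u⟩ : SmoothForm E M (p + (q + 1))) ∈ X.C p (q + 1) := by
  refine mem_C_iff.2 fun x => ?_
  change component (X.proj₂ x) _ _ (component (X.proj₂ x) _ _ (extD u.1 x)) =
    component (X.proj₂ x) _ _ (extD u.1 x)
  rw [(X.isDecomposition_proj₂ x).component_component, if_pos rfl]

/-- `∂̄_b ∂̄_b = 0`: the form `du - ∂̄_b u` has at most `q` arguments in `⁰T''`, so that its exterior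
derivative, which is the opposite of `d ∂̄_b u`, has at most `q + 1`. -/
theorem dbar_dbar {p q : ℕ} {u : SmoothForm E M (p + q)} (hu : u ∈ X.C p q) :
    X.dbar p (q + 1) ⟨X.dbar p q u, dbar_mem u⟩ = 0 := by
  have hfilt : ∀ x, X.VanishesFrom (q + 1) u.1 x := by
    intro x f v hv hq
    rw [← mem_C_iff.1 hu x, (X.isDecomposition_proj₂ x).component_apply_of_proj _ _ f v hv, if_neg]
    intro h
    have : countOf f 1 = q := congrFun h 1
    omega
  have hd := vanishesFrom_extD u.2 hfilt
  have hr : ∀ x, X.VanishesFrom (q + 1) (extD u.1 - X.dbar p q u) x := by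
    intro x f v hv hq
    change extD u.1 x v - component (X.proj₂ x) ![p, q + 1] (p + q + 1) (extD u.1 x) v = 0
    rw [(X.isDecomposition_proj₂ x).component_apply_of_proj _ _ f v hv]
    split_ifs with h
    · exact sub_self _
    · rw [sub_zero]
      refine hd x f v hv ?_
      have h1 := sum_countOf f
      rw [Fin.sum_univ_two] at h1
      by_contra h2
      refine h (funext fun i => ?_)
      fin_cases i
      · change countOf f 0 = p
        omega
      · change countOf f 1 = q + 1
        omega
  have hdr := vanishesFrom_extD (Submodule.sub_mem _ (extD_mem u.2) (dbar_mem (X := X) u)) hr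
  have hdd : extD (extD u.1 - X.dbar p q u) = - extD (X.dbar p q u) := by
    rw [extD_sub (extD_mem u.2) (dbar_mem (X := X) u), extD_extD u.2, zero_sub]
  funext x
  change component (X.proj₂ x) ![p, q + 1 + 1] (p + (q + 1) + 1) (extD (X.dbar p q u) x) = 0
  refine (X.isDecomposition_proj₂ x).ext fun f v hv => ?_
  rw [(X.isDecomposition_proj₂ x).component_apply_of_proj _ _ f v hv]
  split_ifs with h
  · have h1 := hdr x f v hv (le_of_eq (congrFun h 1).symm)
    rw [hdd] at h1
    exact neg_eq_zero.1 h1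
  · rfl

theorem exists_closed_of_mem_imDbar {p q : ℕ} {b : CForm E M (p + q)} (hb : b ∈ X.imDbar p q) :
    ∃ b' ∈ X.kerDbar p q, incl E M (p + q) b' = b := by
  cases q with
  | zero =>
    have : b = 0 := hb
    exact ⟨0, Submodule.zero_mem _, this.symm⟩
  | succ q =>
    obtain ⟨w, hw, rfl⟩ := hb
    exact ⟨⟨X.dbar p q w, dbar_mem w⟩, ⟨dbar_mem_C w, dbar_dbar hw⟩, rfl⟩

/-- The variant of `exists_type_of_extD_ne_zero` for forms of arbitrary degree. -/
theorem exists_type_of_extD_ne_zero' {m : ℕ} {u : CForm E M m}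
    (hu : u ∈ smoothForms E M m) (hv : ∀ x, (u x).compLinearMap (X.hor x) = 0) {x : M}
    {f : Fin (m + 1) → Fin 3} {v : Fin (m + 1) → CTangent E x}
    (hf : ∀ j, X.proj₃ x (f j) (v j) = v j) (h0 : countOf f 0 = 0) (h : extD u x v ≠ 0) :
    ∃ a b, countOf f = ![0, a + 1, b + 1] ∧ component (X.proj₃ x) ![1, a, b] m (u x) ≠ 0 := by
  cases m with
  | zero =>
    have : u = 0 := by
      funext x
      ext w
      have h1 := congrArg (fun g => g w) (hv x)
      change u x (fun i => X.hor x (w i)) = 0 at h1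
      rwa [show (fun i => X.hor x (w i)) = w from funext fun i => i.elim0] at h1
    rw [this, extD_zero] at h
    exact absurd rfl h
  | succ k => exact X.exists_type_of_extD_ne_zero hu hv hf h0 h

theorem hor_mem_horForms {k : ℕ} {u : CForm E M k} (hu : u ∈ smoothForms E M k) :
    (fun x => (u x).compLinearMap (X.hor x) : CForm E M k) ∈ X.horForms k := by
  refine ⟨smooth_compLinearMap X.smoothEnd_hor hu, fun x => ?_⟩
  ext v
  change u x (fun i => X.hor x (X.hor x (v i))) = u x fun i => X.hor x (v i)
  simp only [hor_hor]

/-- In degrees above the middle, a form of type `(p, 0)` or `(0, q)` has no horizontal part: it would be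
the horizontal part of `dv` for a vertical form `v`, which has no component of such a type. -/
theorem StronglyPseudoconvex.comp_hor_eq_zero (hX : X.StronglyPseudoconvex) {N : ℕ}
    (hN : Module.finrank ℝ E = 2 * N + 1) {p q k : ℕ} (hk : N < k + 1) (hpq : p = 0 ∨ q = 0)
    {u : CForm E M (k + 1)} (hu : u ∈ smoothForms E M (k + 1))
    (huc : ∀ x, component (X.proj₂ x) ![p, q] (k + 1) (u x) = u x) (x : M) :
    (u x).compLinearMap (X.hor x) = 0 := by
  obtain ⟨v, hv, hv0, hdv⟩ := hX.exists_vertical_primitive hN hk (hor_mem_horForms hu)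
  refine (X.isDecomposition_proj₃ x).ext fun f w hw => ?_
  rw [X.comp_hor_apply _ hw]
  split_ifs with h0
  · by_contra hne
    have h1 : extD v x w ≠ 0 := by
      have h2 := congrArg (fun g => g w) (hdv x)
      change (extD v x).compLinearMap (X.hor x) w = (u x).compLinearMap (X.hor x) w at h2
      rw [X.comp_hor_apply _ hw, X.comp_hor_apply _ hw, if_pos h0, if_pos h0] at h2
      rw [h2]
      exact hne
    obtain ⟨a, b, hab, -⟩ := exists_type_of_extD_ne_zero' hv hv0 hw h0 h1
    have h3 : ¬ (countOf f 0 + countOf f 1 = p ∧ countOf f 2 = q) := by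
      rw [hab]
      change ¬ (0 + (a + 1) = p ∧ b + 1 = q)
      omega
    refine hne ?_
    rw [← huc x, X.component₂_apply _ hw, if_neg h3]
    rfl
  · rfl

/-- In degrees above the middle, every element of `C^{p,q}` differs from an element of `D^{p,q}` by an
element of `∂̄_b C^{p,q-1}`. -/
theorem StronglyPseudoconvex.exists_mem_D (hX : X.StronglyPseudoconvex) {N : ℕ}
    (hN : Module.finrank ℝ E = 2 * N + 1) {p q : ℕ} (hk : N < p + q)
    {u : SmoothForm E M (p + q)} (hu : u ∈ X.C p q) :
    ∃ u' ∈ X.D p q (p + q), incl E M (p + q) u - incl E M (p + q) u' ∈ X.imDbar p q := by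
  have key : (∀ x, (u.1 x).compLinearMap (X.hor x) = 0) →
      ∃ u' ∈ X.D p q (p + q), incl E M (p + q) u - incl E M (p + q) u' ∈ X.imDbar p q :=
    fun h => ⟨u, mem_D_of_mem_C hu h, by rw [sub_self]; exact Submodule.zero_mem _⟩
  cases q with
  | zero =>
    cases p with
    | zero => exact absurd hk (Nat.not_lt_zero N)
    | succ p => exact key (hX.comp_hor_eq_zero hN (k := p) hk (Or.inr rfl) u.2 (mem_C_iff.1 hu))
  | succ q =>
    cases p with
    | zero =>
      have hus : (u.1 : CForm E M (0 + q + 1)) ∈ smoothForms E M (0 + q + 1) := u.2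
      exact key (hX.comp_hor_eq_zero hN (p := 0) (q := q + 1) hk (Or.inl rfl) hus (mem_C_iff.1 hu))
    | succ p =>
      obtain ⟨v, hv, hv0, hdv⟩ := hX.exists_vertical_primitive hN (k := p + 1 + q) hk
        (hor_mem_horForms u.2)
      -- only the part `w` of `v` in `D^{p+1,q}` contributes to the type of `u`; the difference `v - w`
      -- has no component of that type, and `d (v - w)` none of type `(p + 1, q + 1)`
      let w : SmoothForm E M (p + 1 + q) := ⟨X.part₃ 1 p q (p + 1 + q) v, part₃_mem hv⟩
      have hwx : ∀ x, w.1 x = component (X.proj₃ x) ![1, p, q] (p + 1 + q) (v x) := fun x => rfl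
      have hwC : w ∈ X.C (p + 1) q := mem_C_iff.2 fun x => X.component₂_eq_of_component₃_one (by
        rw [hwx, (X.isDecomposition_proj₃ x).component_component, if_pos rfl])
      have hr : ∀ x, ((v - w.1) x).compLinearMap (X.hor x) = 0 := by
        intro x
        change (v x).compLinearMap (X.hor x) - (w.1 x).compLinearMap (X.hor x) = 0
        rw [hv0 x, hwx, X.component_one_comp_hor, sub_zero]
      let w' : SmoothForm E M (p + 1 + (q + 1)) := ⟨X.dbar (p + 1) q w, dbar_mem w⟩
      have hw'C : w' ∈ X.C (p + 1) (q + 1) := dbar_mem_C w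
      have hor0 : ∀ x, ((u - w').1 x).compLinearMap (X.hor x) = 0 := by
        intro x
        refine (X.isDecomposition_proj₃ x).ext fun f z hz => ?_
        rw [X.comp_hor_apply _ hz]
        split_ifs with h0
        · change u.1 x z - component (X.proj₂ x) ![p + 1, q + 1] (p + 1 + (q + 1))
            (extD w.1 x) z = 0
          rw [← mem_C_iff.1 hu x, X.component₂_apply _ hz, X.component₂_apply _ hz]
          split_ifs with hpq
          · have h2 := congrArg (fun g => g z) (hdv x)
            change (extD v x).compLinearMap (X.hor x) z = (u.1 x).compLinearMap (X.hor x) z at h2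
            rw [X.comp_hor_apply _ hz, X.comp_hor_apply _ hz, if_pos h0, if_pos h0] at h2
            by_contra hne
            have h1 : extD (v - w.1) x z ≠ 0 := by
              rw [extD_sub hv w.2]
              change extD v x z - extD w.1 x z ≠ 0
              rw [h2]
              exact hne
            obtain ⟨a, b, hab, hc⟩ := exists_type_of_extD_ne_zero'
              (Submodule.sub_mem _ hv w.2) hr hz h0 h1
            have ha : a = p := by
              have h3 : countOf f 1 = a + 1 := congrFun hab 1
              omega
            have hb : b = q := by
              have h3 : countOf f 2 = b + 1 := congrFun hab 2
              omega
            subst ha hb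
            refine hc ?_
            rw [Pi.sub_apply, map_sub, hwx, (X.isDecomposition_proj₃ x).component_component,
              if_pos rfl, sub_self]
          · exact sub_self _
        · rfl
      have hw' : incl E M (p + 1 + (q + 1)) w' ∈ X.imDbar (p + 1) (q + 1) :=
        Submodule.mem_map_of_mem hwC
      refine ⟨u - w', mem_D_of_mem_C (Submodule.sub_mem _ hu hw'C) hor0, ?_⟩
      rw [map_sub, sub_sub_cancel]
      exact hw'

end Types

end Supplement

/-! ### The forms of `F^k` -/

namespace Supplement

section FTotal

variable {E : Type*} [NormedAddCommGroup E] [NormedSpace ℝ E] [FiniteDimensional ℝ E]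
variable {M : Type*} [TopologicalSpace M] [ChartedSpace E M] [IsManifold 𝓘(ℝ, E) ∞ M] [T2Space M]
variable {S : CRStructure E M} {X : Supplement S}

theorem mem_F_succ_iff {p q k : ℕ} {u : SmoothForm E M k} :
    u ∈ X.F (p + 1) q k ↔ u ∈ X.D (p + 1) q k ∧
      ∀ x, component (X.proj₃ x) ![0, p + 1, q + 1] (k + 1) (extD u.1 x) = 0 := by
  refine and_congr_right fun _ => ?_
  exact funext_iff (f := X.part₃ 0 (p + 1) (q + 1) (k + 1) (extD u.1)) (g := 0)

variable (X) in
/-- The smooth forms `u` that vanish on horizontal vectors and for which `du` vanishes on horizontal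
vectors. -/
def verticalForms (k : ℕ) : Submodule ℂ (SmoothForm E M k) where
  carrier := {u | (∀ x, (u.1 x).compLinearMap (X.hor x) = 0) ∧
    ∀ x, (d k u x).compLinearMap (X.hor x) = 0}
  add_mem' := by
    rintro u w ⟨h1, h2⟩ ⟨h3, h4⟩
    refine ⟨fun x => ?_, fun x => ?_⟩
    · change (u.1 x).compLinearMap (X.hor x) + (w.1 x).compLinearMap (X.hor x) = 0
      rw [h1, h3, add_zero]
    · rw [map_add]
      change (d k u x).compLinearMap (X.hor x) + (d k w x).compLinearMap (X.hor x) = 0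
      rw [h2, h4, add_zero]
  zero_mem' := ⟨fun x => rfl, fun x => by rw [map_zero]; rfl⟩
  smul_mem' := by
    rintro c u ⟨h1, h2⟩
    refine ⟨fun x => ?_, fun x => ?_⟩
    · change c • (u.1 x).compLinearMap (X.hor x) = 0
      rw [h1, smul_zero]
    · rw [map_smul]
      change c • (d k u x).compLinearMap (X.hor x) = 0
      rw [h2, smul_zero]

theorem F_le_verticalForms (p q k : ℕ) : X.F p q k ≤ X.verticalForms k := by
  cases p with
  | zero =>
    intro u hu
    have : u = 0 := hu.1
    rw [this]
    exact Submodule.zero_mem _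
  | succ p =>
    intro u hu
    obtain ⟨hD, hF⟩ := mem_F_succ_iff.1 hu
    have hD := mem_D_succ_iff.1 hD
    have hv : ∀ x, (u.1 x).compLinearMap (X.hor x) = 0 := fun x => by
      rw [← hD x]
      exact X.component_one_comp_hor _
    refine ⟨hv, fun x => (X.isDecomposition_proj₃ x).ext fun f v hf => ?_⟩
    change (extD u.1 x).compLinearMap (X.hor x) v = 0
    rw [X.comp_hor_apply _ hf]
    split_ifs with h0
    · by_contra hne
      obtain ⟨a, b, hab, hc⟩ := exists_type_of_extD_ne_zero' u.2 hv hf h0 hne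
      rw [← hD x, (X.isDecomposition_proj₃ x).component_component] at hc
      have hpq : (![1, a, b] : Fin 3 → ℕ) = ![1, p, q] := by
        by_contra h
        rw [if_neg h] at hc
        exact hc rfl
      have ha : a = p := congrFun hpq 1
      have hb : b = q := congrFun hpq 2
      subst ha hb
      have h1 := congrArg (fun g => g v) (hF x)
      change component (X.proj₃ x) ![0, a + 1, b + 1] (k + 1) (extD u.1 x) v = 0 at h1
      rw [(X.isDecomposition_proj₃ x).component_apply_of_proj _ _ f v hf, if_pos hab] at h1
      exact hne h1
    · rfl

theorem mem_Ftot_of_mem_F {p q k : ℕ} (h : p + q = k) {u : SmoothForm E M k} (hu : u ∈ X.F p q k) :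
    u ∈ X.Ftot k :=
  Submodule.mem_iSup_of_mem p (Submodule.mem_iSup_of_mem q (Submodule.mem_iSup_of_mem h hu))

variable (X) in
/-- `F^k` consists of the forms `u` such that `u` and `du` vanish on horizontal vectors. -/
theorem Ftot_eq_verticalForms (k : ℕ) : X.Ftot k = X.verticalForms k := by
  refine le_antisymm (iSup_le fun p => iSup_le fun q => iSup_le fun _ => F_le_verticalForms p q k) ?_
  rintro u ⟨hv, hdv⟩
  cases k with
  | zero =>
    have : u = 0 := Subtype.ext (funext fun x => by
      ext w
      have h1 := congrArg (fun g => g w) (hv x)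
      change u.1 x (fun i => X.hor x (w i)) = 0 at h1
      rwa [show (fun i => X.hor x (w i)) = w from funext fun i => i.elim0] at h1)
    rw [this]
    exact Submodule.zero_mem _
  | succ k =>
    let c : ℕ × ℕ → SmoothForm E M (k + 1) := fun ab =>
      ⟨X.part₃ 1 ab.1 ab.2 (k + 1) u.1, part₃_mem u.2⟩
    have hcx : ∀ ab x, (c ab).1 x = component (X.proj₃ x) ![1, ab.1, ab.2] (k + 1) (u.1 x) :=
      fun ab x => rfl
    have hsum : ∑ ab ∈ Finset.HasAntidiagonal.antidiagonal k, c ab = u := by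
      have hinj : Function.Injective (incl E M (k + 1)) := Subtype.val_injective
      refine hinj ?_
      rw [map_sum]
      funext x
      rw [Finset.sum_apply]
      exact X.sum_component_one (hv x)
    -- the horizontal parts of the `d (c ab)` have different types and add up to zero
    rw [← hsum]
    refine Submodule.sum_mem _ fun ab hab => ?_
    rw [Finset.HasAntidiagonal.mem_antidiagonal] at hab
    have hr : ∀ x, ((u.1 - (c ab).1) x).compLinearMap (X.hor x) = 0 := by
      intro x
      change (u.1 x).compLinearMap (X.hor x) - ((c ab).1 x).compLinearMap (X.hor x) = 0
      rw [hv x, hcx, X.component_one_comp_hor, sub_zero]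
    refine mem_Ftot_of_mem_F (p := ab.1 + 1) (q := ab.2) (by omega)
      (mem_F_succ_iff.2 ⟨mem_D_succ_iff.2 fun x => ?_, fun x => ?_⟩)
    · rw [hcx, (X.isDecomposition_proj₃ x).component_component, if_pos rfl]
    · refine (X.isDecomposition_proj₃ x).ext fun f v hf => ?_
      rw [(X.isDecomposition_proj₃ x).component_apply_of_proj _ _ f v hf]
      split_ifs with h
      · have h0 : countOf f 0 = 0 := congrFun h 0
        have h1 := congrArg (fun g => g v) (hdv x)
        change (extD u.1 x).compLinearMap (X.hor x) v = 0 at h1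
        rw [X.comp_hor_apply _ hf, if_pos h0] at h1
        by_contra hne
        have h2 : extD (u.1 - (c ab).1) x v ≠ 0 := by
          rw [extD_sub u.2 (c ab).2]
          change extD u.1 x v - extD (c ab).1 x v ≠ 0
          rw [h1, zero_sub]
          exact neg_ne_zero.2 hne
        obtain ⟨a, b, hab', hc⟩ := exists_type_of_extD_ne_zero'
          (Submodule.sub_mem _ u.2 (c ab).2) hr hf h0 h2
        have h3 := h.symm.trans hab'
        have ha : ab.1 = a := Nat.succ_injective (congrFun h3 1)
        have hb : ab.2 = b := Nat.succ_injective (congrFun h3 2)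
        subst ha hb
        refine hc ?_
        rw [Pi.sub_apply, map_sub, hcx, (X.isDecomposition_proj₃ x).component_component,
          if_pos rfl, sub_self]
      · rfl

/-- In degrees above the middle, every smooth form vanishes on horizontal vectors after an exact form
has been subtracted. -/
theorem StronglyPseudoconvex.exists_sub_d_vertical (hX : X.StronglyPseudoconvex) {N : ℕ}
    (hN : Module.finrank ℝ E = 2 * N + 1) {k : ℕ} (hk : N < k + 1) (u : SmoothForm E M (k + 1)) :
    ∃ (v : SmoothForm E M k) (w : SmoothForm E M (k + 1)), incl E M (k + 1) w = d k v ∧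
      d (k + 1) w = 0 ∧ ∀ x, ((u - w).1 x).compLinearMap (X.hor x) = 0 := by
  obtain ⟨v, hv, -, hdv⟩ := hX.exists_vertical_primitive hN hk (hor_mem_horForms u.2)
  refine ⟨⟨v, hv⟩, ⟨extD v, extD_mem hv⟩, rfl, extD_extD hv, fun x => ?_⟩
  change (u.1 x).compLinearMap (X.hor x) - (extD v x).compLinearMap (X.hor x) = 0
  rw [hdv x, sub_self]

end FTotal

end Supplement

/-! ### Isomorphisms of quotients -/

/-- The map of quotients induced by an inclusion `A ⊆ B` is an isomorphism if it is well defined,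
injective, and surjective. -/
theorem exists_quotient_equiv {V : Type*} [AddCommGroup V] [Module ℂ V] {A B : Submodule ℂ V}
    (h : A ≤ B) (P : Submodule ℂ A) (Q : Submodule ℂ B)
    (hPQ : ∀ a : A, a ∈ P ↔ Submodule.inclusion h a ∈ Q)
    (hs : Function.Surjective fun a : A => (Submodule.Quotient.mk (Submodule.inclusion h a) : B ⧸ Q)) :
    ∃ e : (A ⧸ P) ≃ₗ[ℂ] (B ⧸ Q), ∀ a : A,
      e (Submodule.Quotient.mk a) = Submodule.Quotient.mk (Submodule.inclusion h a) := by
  have hle : P ≤ Q.comap (Submodule.inclusion h) := fun a ha => (hPQ a).1 ha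
  refine ⟨LinearEquiv.ofBijective (P.mapQ Q (Submodule.inclusion h) hle) ⟨?_, ?_⟩, fun a => rfl⟩
  · rw [← LinearMap.ker_eq_bot, LinearMap.ker_eq_bot']
    intro y hy
    obtain ⟨a, rfl⟩ := Submodule.Quotient.mk_surjective P y
    rw [Submodule.mapQ_apply, Submodule.Quotient.mk_eq_zero, ← hPQ] at hy
    exact (Submodule.Quotient.mk_eq_zero P).2 hy
  · intro y
    obtain ⟨a, ha⟩ := hs y
    exact ⟨Submodule.Quotient.mk a, ha⟩

namespace Supplement

section Main

variable {E : Type*} [NormedAddCommGroup E] [NormedSpace ℝ E] [FiniteDimensional ℝ E]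
variable {M : Type*} [TopologicalSpace M] [ChartedSpace E M] [IsManifold 𝓘(ℝ, E) ∞ M] [T2Space M]
variable {S : CRStructure E M} {X : Supplement S}

/-! ### Kohn–Rossi cohomology -/

theorem mem_kerSecond {p q : ℕ} {u : SmoothForm E M (p + q)} (hu : u ∈ X.D p q (p + q))
    (h : X.dbar p q u = 0) : u ∈ X.kerSecond p q := by
  have hF : u ∈ X.F p q (p + q) := mem_F_of_part₃_dbar hu (by rw [h, map_zero])
  exact ⟨hF, (dbar_eq_dSecond hF).symm.trans h⟩

theorem kerSecond_le_kerDbar (p q : ℕ) : X.kerSecond p q ≤ X.kerDbar p q :=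
  fun _ hu => ⟨D_le_C p q hu.1.1, (dbar_eq_dSecond hu.1).trans hu.2⟩

theorem dbar_eq_of_sub_mem {p q : ℕ} {u u' : SmoothForm E M (p + q)}
    (h : incl E M (p + q) u - incl E M (p + q) u' ∈ X.imDbar p q) : X.dbar p q u = X.dbar p q u' := by
  obtain ⟨b, hb, hbu⟩ := exists_closed_of_mem_imDbar h
  have hinj : Function.Injective (incl E M (p + q)) := Subtype.val_injective
  have h1 : b = u - u' := hinj (by rw [hbu, map_sub])
  have h2 : X.dbar p q b = 0 := hb.2
  rwa [h1, map_sub, sub_eq_zero] at h2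

theorem StronglyPseudoconvex.surjective_kohnRossi (hX : X.StronglyPseudoconvex) {N : ℕ}
    (hN : Module.finrank ℝ E = 2 * N + 1) {p q : ℕ} (hk : N < p + q) :
    Function.Surjective fun u : X.kerSecond p q =>
      (Submodule.Quotient.mk (Submodule.inclusion (kerSecond_le_kerDbar p q) u) :
        X.KohnRossi p q) := by
  intro y
  obtain ⟨⟨u, hu⟩, rfl⟩ := Submodule.Quotient.mk_surjective _ y
  obtain ⟨u', hu', hb⟩ := hX.exists_mem_D hN hk hu.1
  have h0 : X.dbar p q u = 0 := hu.2
  refine ⟨⟨u', mem_kerSecond hu' (by rw [← dbar_eq_of_sub_mem hb, h0])⟩, ?_⟩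
  refine ((Submodule.Quotient.eq _).2 ?_).symm
  exact hb

theorem StronglyPseudoconvex.mem_boundSecond_iff (hX : X.StronglyPseudoconvex) {N : ℕ}
    (hN : Module.finrank ℝ E = 2 * N + 1) {p q : ℕ} (hk : N + 1 < p + q) (a : X.kerSecond p q) :
    a ∈ X.boundSecond p q ↔
      Submodule.inclusion (kerSecond_le_kerDbar p q) a ∈ X.boundDbar p q := by
  obtain ⟨a, ha⟩ := a
  change incl E M (p + q) a ∈ X.imSecond p q ↔ incl E M (p + q) a ∈ X.imDbar p q
  cases q with
  | zero => exact Iff.rfl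
  | succ q =>
    constructor
    · rintro ⟨w, hw, hwa⟩
      exact ⟨w, D_le_C p q hw.1, (dbar_eq_dSecond hw).trans hwa⟩
    · rintro ⟨w, hw, hwa⟩
      obtain ⟨w', hw', hb⟩ := hX.exists_mem_D hN (by omega) hw
      have h1 : X.dbar p q w' = incl E M (p + (q + 1)) a := (dbar_eq_of_sub_mem hb).symm.trans hwa
      have hF : w' ∈ X.F p q (p + q) := mem_F_of_part₃_dbar hw' (by
        rw [h1]
        exact part₃_zero_of_mem_D ha.1.1)
      exact ⟨w', hF, (dbar_eq_dSecond hF).symm.trans h1⟩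

/-! ### De Rham cohomology -/

theorem kerF_le_kerD (k : ℕ) : X.kerF k ≤ kerD E M k := inf_le_right

theorem StronglyPseudoconvex.surjective_deRham (hX : X.StronglyPseudoconvex) {N : ℕ}
    (hN : Module.finrank ℝ E = 2 * N + 1) {k : ℕ} (hk : N < k) :
    Function.Surjective fun u : X.kerF k =>
      (Submodule.Quotient.mk (Submodule.inclusion (kerF_le_kerD k) u) : DeRham E M k) := by
  intro y
  obtain ⟨⟨u, hu⟩, rfl⟩ := Submodule.Quotient.mk_surjective _ y
  cases k with
  | zero => exact absurd hk (Nat.not_lt_zero N)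
  | succ k =>
    obtain ⟨v, w, hw, hdw, hv⟩ := hX.exists_sub_d_vertical hN hk u
    have hu0 : d (k + 1) u = 0 := hu
    have hd : d (k + 1) (u - w) = 0 := by rw [map_sub, hu0, hdw, sub_zero]
    have hF : u - w ∈ X.Ftot (k + 1) := by
      rw [Ftot_eq_verticalForms]
      exact ⟨hv, fun x => by rw [hd]; rfl⟩
    refine ⟨⟨u - w, hF, hd⟩, ((Submodule.Quotient.eq _).2 ?_).symm⟩
    change incl E M (k + 1) (u - (u - w)) ∈ LinearMap.range (d (E := E) (M := M) k)
    rw [sub_sub_cancel, hw]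
    exact ⟨v, rfl⟩

theorem StronglyPseudoconvex.mem_boundF_iff (hX : X.StronglyPseudoconvex) {N : ℕ}
    (hN : Module.finrank ℝ E = 2 * N + 1) {k : ℕ} (hk : N + 1 < k) (a : X.kerF k) :
    a ∈ X.boundF k ↔ Submodule.inclusion (kerF_le_kerD k) a ∈ boundD E M k := by
  obtain ⟨a, ha⟩ := a
  change incl E M k a ∈ X.imF k ↔ incl E M k a ∈ imD E M k
  cases k with
  | zero => exact Iff.rfl
  | succ k =>
    constructor
    · rintro ⟨w, -, hwa⟩
      exact ⟨w, hwa⟩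
    · rintro ⟨w, hwa⟩
      cases k with
      | zero => exact absurd hk (by omega)
      | succ k =>
        obtain ⟨v, w', -, hdw, hv⟩ := hX.exists_sub_d_vertical hN (by omega) w
        have hd : d (k + 1) (w - w') = incl E M (k + 1 + 1) a := by
          rw [map_sub, hdw, sub_zero, hwa]
        refine ⟨w - w', ?_, hd⟩
        change w - w' ∈ X.Ftot (k + 1)
        rw [Ftot_eq_verticalForms]
        refine ⟨hv, fun x => ?_⟩
        rw [hd]
        have h1 := ha.1
        rw [Ftot_eq_verticalForms] at h1
        exact h1.1 x

end Main

end Supplement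

end CRManifold

end

theorem theorem3p2
    {E : Type*} [NormedAddCommGroup E] [NormedSpace ℝ E] [FiniteDimensional ℝ E]
    {M : Type*} [TopologicalSpace M] [T2Space M] [SecondCountableTopology M]
    [ChartedSpace E M] [IsManifold 𝓘(ℝ, E) ∞ M]
    (n : ℕ) (hn : 1 ≤ n) (hdim : Module.finrank ℝ E = 2 * n - 1)
    (S : CRManifold.CRStructure E M) (X : CRManifold.Supplement S)
    (hX : X.StronglyPseudoconvex) :
    (∀ p q : ℕ, p + q = n → ∃ h : X.kerSecond p q ≤ X.kerDbar p q,
      Function.Surjective fun u : X.kerSecond p q =>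
        (Submodule.Quotient.mk (Submodule.inclusion h u) : X.KohnRossi p q)) ∧
    (∀ p q : ℕ, n + 1 ≤ p + q → ∃ h : X.kerSecond p q ≤ X.kerDbar p q,
      ∃ e : X.HSecond p q ≃ₗ[ℂ] X.KohnRossi p q, ∀ u : X.kerSecond p q,
        e (Submodule.Quotient.mk u) = Submodule.Quotient.mk (Submodule.inclusion h u)) ∧
    (∀ k : ℕ, k = n → ∃ h : X.kerF k ≤ CRManifold.kerD E M k,
      Function.Surjective fun u : X.kerF k =>
        (Submodule.Quotient.mk (Submodule.inclusion h u) : CRManifold.DeRham E M k)) ∧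
    (∀ k : ℕ, n + 1 ≤ k → ∃ h : X.kerF k ≤ CRManifold.kerD E M k,
      ∃ e : X.HF k ≃ₗ[ℂ] CRManifold.DeRham E M k, ∀ u : X.kerF k,
        e (Submodule.Quotient.mk u) = Submodule.Quotient.mk (Submodule.inclusion h u)) := by
  have hN : Module.finrank ℝ E = 2 * (n - 1) + 1 := by omega
  refine ⟨fun p q h => ⟨CRManifold.Supplement.kerSecond_le_kerDbar p q,
      hX.surjective_kohnRossi hN (by omega)⟩,
    fun p q h => ⟨CRManifold.Supplement.kerSecond_le_kerDbar p q,
      CRManifold.exists_quotient_equiv _ _ _ (hX.mem_boundSecond_iff hN (by omega))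
        (hX.surjective_kohnRossi hN (by omega))⟩,
    fun k h => ⟨CRManifold.Supplement.kerF_le_kerD k, hX.surjective_deRham hN (by omega)⟩,
    fun k h => ⟨CRManifold.Supplement.kerF_le_kerD k,
      CRManifold.exists_quotient_equiv _ _ _ (hX.mem_boundF_iff hN (by omega))
        (hX.surjective_deRham hN (by omega))⟩⟩
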